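/- **Setting.** There are $N$ sources, served one packet after another without idling by repeating a pattern $P=[P_0,\dots,P_{K-1}]\in\{1,\dots,N\}^K$: slot $i=0,1,2,\dots$ serves source $P_{i \bmod K}$. The service times of source $m$ are nonnegative with law $\nu_m$, mean $s_m$, finite second moment $q_m$ and moment generating function (MGF) $G_m(z)=\mathbb E[e^{zS_m}]$; a packet of source $m$ is dropped with probability $p_m\in[0,1]$. All service times and all drop events are mutually independent. A packet is generated at the beginning of its slot and, unless dropped, received at its end. Fix a source $n$ that appears $\alpha_n\ge 1$ times in $P$, with $p_n<1$, $s_n>0$, and put $u_n=1-p_n$. Number the appearances of source $n$ in the repeated pattern by $k=0,1,2,\dots$. Let $H_{n,k}$ be the total service time strictly between the appearances $k$ and $k+1$, with mean $s_{n,k}$, second moment $q_{n,k}$ and MGF $G_{n,k}$ (all periodic in $k$ with period $\alpha_n$). Let $\tilde H_{n,k}$ be the time from the end of a source-$n$ transmission to the beginning of the next successful one, given that the former is successful and occurs at appearance $k$; let $\tilde G_{n,k}$ be its MGF. Let $\tilde S_{n,j}$ be the time from the end of the $j$-th to the beginning of the $(j+1)$-th successful source-$n$ transmission. The age $\Delta_n(t)$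 is $t$ minus the generation time of the freshest source-$n$ update received by time $t$ (at time $0$ an update of some age $a_0\ge0$ is available). **Coefficients.** Put $g=1+s_nz+\tfrac{q_n}{2}z^2$ and $h_k=1+s_{n,k}z+\tfrac{q_{n,k}}{2}z^2$. Then $a_{n,k},b_{n,k}$ are the coefficients of $z,z^2$ in the polynomial $u_n\sum_{j=1}^{\alpha_n}p_n^{j-1}g^{j-1}\prod_{l=1}^{j}h_{k+l-1}$, and $c_{n,k},d_{n,k}$ (which do not depend on $k$) are those in $1-p_n^{\alpha_n}g^{\alpha_n}\prod_{m=1}^{\alpha_n}h_{m-1}$. (Here $0^0=1$.) **Theorem.** 1. $G_{n,k}(z)=\prod_{m\ne n}G_m(z)^{\alpha_{n,k,m}}$ (with the convention that an infinite MGF is assigned the value $0$), where $\alpha_{n,k,m}$ is the number of appearances of source $m$ strictly between the appearances $k$ and $k+1$ of source $n$. 2. For every real $z$ at which the service time MGFs of all sources in $P$ are finite and $p_n^{\alpha_n}G_n(z)^{\alpha_n}\prod_{m=1}^{\alpha_n}G_{n,m-1}(z)<1$, and for every $k$, $\tilde G_{n,k}(z)$ is finite and $$\tilde G_{n,k}(z)=u_n\sum_{i=0}^{\infty}p_n^{i}\,G_n(z)^{i}\prod_{l=0}^{i}G_{n,k+l}(z)=\frac{u_n\sum_{j=1}^{\alpha_n}p_n^{j-1}G_n(z)^{j-1}\prod_{l=1}^{j}G_{n,k+l-1}(z)}{1-p_n^{\alpha_n}G_n(z)^{\alpha_n}\prod_{m=1}^{\alpha_n}G_{n,m-1}(z)}.$$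 If the service time MGFs of all sources in $P$ are finite near $0$, then the numerator and the denominator of this fraction are $(1-p_n^{\alpha_n})+a_{n,k}z+b_{n,k}z^2+O(z^3)$ and $(1-p_n^{\alpha_n})+c_{n,k}z+d_{n,k}z^2+O(z^3)$ as $z\to0$. 3. The sequence $(\tilde S_{n,j})_j$ has a steady-state law, that of a random variable $\tilde S_n$: the averages $\frac1M\sum_{j<M}\mathbb P(\tilde S_{n,j}\in A)$ tend to $\mathbb P(\tilde S_n\in A)$ for every Borel set $A$, and if $p_n>0$ then already $\mathbb P(\tilde S_{n,j}\in A)\to\mathbb P(\tilde S_n\in A)$. For all $z$ as in 2, the MGF of $\tilde S_n$ is finite and equal to $\frac1{\alpha_n}\sum_{k=1}^{\alpha_n}\tilde G_{n,k-1}(z)$. 4. $\tilde S_n$ has a finite second moment, and its first two moments are $$\tilde s_n=\frac1{u_n}\Bigl(p_ns_n+\frac1{\alpha_n}\sum_{k=1}^{\alpha_n}s_{n,k-1}\Bigr),\qquad \tilde q_n=\frac1{\alpha_n}\sum_{k=1}^{\alpha_n}\left(\frac{2c_{n,k}(c_{n,k}-a_{n,k})}{(1-p_n^{\alpha_n})^2}+\frac{2(b_{n,k}-d_{n,k})}{1-p_n^{\alpha_n}}\right).$$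 5. Almost surely $\frac1T\int_0^T\Delta_n(t)\,dt\to\mathbb E[\Delta_n]$ as $T\to\infty$, where $$\mathbb E[\Delta_n]=\frac{2s_n^2+4s_n\tilde s_n+q_n+\tilde q_n}{2(s_n+\tilde s_n)}.$$ -/

import Mathlib

open MeasureTheory ProbabilityTheory Filter Topology Finset Polynomial Asymptotics

namespace CyclicAoI

noncomputable section

/-! ### The cyclic schedule -/

/-- The source served in slot `i`, when the pattern `P` of size `K` is repeated for ever. -/
def sched {N K : ℕ} [NeZero K] (P : Fin K → Fin N) (i : ℕ) : Fin N := P (Fin.ofNat K i)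

/-- The number of appearances of source `n` in the pattern. -/
def alpha {N K : ℕ} (P : Fin K → Fin N) (n : Fin N) : ℕ :=
  (Finset.univ.filter (fun k : Fin K => P k = n)).card

/-- The slot of the `k`-th appearance (`k = 0, 1, 2, …`) of source `n` in the repeated pattern. For
`k < alpha P n` this is its `k`-th position in `P`; later ones are the same positions in later
rounds, so that every quantity indexed by `k` below is extended periodically in `k`. -/
def pos {N K : ℕ} [NeZero K] (P : Fin K → Fin N) (n : Fin N) (k : ℕ) : ℕ :=
  Nat.nth (fun i => sched P i = n) k

/-- The number of times source `m` appears strictly between the `k`-th and the `(k+1)`-th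
appearances of source `n`. -/
def alphaSub {N K : ℕ} [NeZero K] (P : Fin K → Fin N) (n : Fin N) (k : ℕ) (m : Fin N) : ℕ :=
  ((Finset.Ioo (pos P n k) (pos P n (k + 1))).filter (fun i => sched P i = m)).card

/-! ### The stochastic model -/

/-- `X i` is the service time in slot `i` and `B i` tells whether the packet of slot `i` is received
(`true`) or dropped. Service times of source `m` have law `ν m`, its packets are dropped with
probability `p m`, and all these random variables are mutually independent. -/
structure IsModel {N K : ℕ} [NeZero K] {Ω : Type*} [MeasurableSpace Ω] (μ : Measure Ω)
    (P : Fin K → Fin N) (p : Fin N → ℝ) (ν : Fin N → Measure ℝ)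
    (X : ℕ → Ω → ℝ) (B : ℕ → Ω → Bool) : Prop where
  measurable_service : ∀ i, Measurable (X i)
  measurable_received : ∀ i, Measurable (B i)
  map_service : ∀ i, μ.map (X i) = ν (sched P i)
  prob_received : ∀ i, μ {ω | B i ω = true} = ENNReal.ofReal (1 - p (sched P i))
  indep_slot : ∀ i, IndepFun (X i) (B i) μ
  indep : iIndepFun (fun i ω => (X i ω, B i ω)) μ

/-- Slot `i` is a successful transmission of source `n`. -/
def Success {N K : ℕ} [NeZero K] {Ω : Type*} (P : Fin K → Fin N) (B : ℕ → Ω → Bool) (n : Fin N)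
    (ω : Ω) (i : ℕ) : Prop :=
  sched P i = n ∧ B i ω = true

/-- The time at which slot `i` begins (so slot `i` ends at `startTime X (i + 1)`): the server is
never idle. -/
def startTime {Ω : Type*} (X : ℕ → Ω → ℝ) (i : ℕ) (ω : Ω) : ℝ := ∑ j ∈ Finset.range i, X j ω

/-- The time from the end of the `j`-th to the beginning of the `(j+1)`-th successful
transmission of source `n` (`j = 0, 1, 2, …`). -/
def interSuccess {N K : ℕ} [NeZero K] {Ω : Type*} (P : Fin K → Fin N) (X : ℕ → Ω → ℝ)
    (B : ℕ → Ω → Bool) (n : Fin N) (j : ℕ) (ω : Ω) : ℝ :=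
  startTime X (Nat.nth (Success P B n ω) (j + 1)) ω
    - startTime X (Nat.nth (Success P B n ω) j + 1) ω

/-- The sum of the service times strictly between the `k`-th and the `(k+1)`-th appearances of
source `n` in the schedule. -/
def subTime {N K : ℕ} [NeZero K] {Ω : Type*} (P : Fin K → Fin N) (X : ℕ → Ω → ℝ) (n : Fin N)
    (k : ℕ) (ω : Ω) : ℝ :=
  ∑ i ∈ Finset.Ioo (pos P n k) (pos P n (k + 1)), X i ω

/-- The time from the end of the slot of the `k`-th appearance of source `n` to the beginning of
the first successful transmission of source `n` after that slot. -/
def nextGap {N K : ℕ} [NeZero K] {Ω : Type*} (P : Fin K → Fin N) (X : ℕ → Ω → ℝ)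
    (B : ℕ → Ω → Bool) (n : Fin N) (k : ℕ) (ω : Ω) : ℝ :=
  startTime X (sInf {i | pos P n k < i ∧ Success P B n ω i}) ω - startTime X (pos P n k + 1) ω

/-- The law of the time between two consecutive successful transmissions of source `n` given that
the first one occurs at the `k`-th appearance of source `n`. -/
def gapLaw {N K : ℕ} [NeZero K] {Ω : Type*} [MeasurableSpace Ω] (μ : Measure Ω)
    (P : Fin K → Fin N) (X : ℕ → Ω → ℝ) (B : ℕ → Ω → Bool) (n : Fin N) (k : ℕ) : Measure ℝ :=
  (ProbabilityTheory.cond μ {ω | B (pos P n k) ω = true}).map (nextGap P X B n k)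

/-- `τ` is the steady-state law of the sequence `Y 0, Y 1, …`: the long-run average of the laws of
the `Y j` converges to `τ` on every measurable set. -/
def IsSteadyStateLaw {Ω : Type*} [MeasurableSpace Ω] (μ : Measure Ω) (Y : ℕ → Ω → ℝ)
    (τ : Measure ℝ) : Prop :=
  IsProbabilityMeasure τ ∧ ∀ A : Set ℝ, MeasurableSet A →
    Tendsto (fun M : ℕ => (M : ℝ)⁻¹ * ∑ j ∈ Finset.range M, μ.real {ω | Y j ω ∈ A}) atTop
      (𝓝 (τ.real A))

/-- The age of information of source `n` at time `t`: `t` minus the generation time of the freshest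
update received by time `t`. The packet of slot `i` is generated at the beginning of the slot and
received, if not dropped, at its end. At time `0` an update of age `a₀` is available. -/
def age {N K : ℕ} [NeZero K] {Ω : Type*} (P : Fin K → Fin N) (X : ℕ → Ω → ℝ)
    (B : ℕ → Ω → Bool) (n : Fin N) (a₀ t : ℝ) (ω : Ω) : ℝ :=
  t - sSup (insert (-a₀)
    {g | ∃ i, Success P B n ω i ∧ startTime X (i + 1) ω ≤ t ∧ g = startTime X i ω})

/-- `a` is the mean age of source `n`: almost surely the time average of the age tends to `a`. -/
def IsMeanAge {N K : ℕ} [NeZero K] {Ω : Type*} [MeasurableSpace Ω] (μ : Measure Ω)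
    (P : Fin K → Fin N) (X : ℕ → Ω → ℝ) (B : ℕ → Ω → Bool) (n : Fin N) (a₀ a : ℝ) : Prop :=
  ∀ᵐ ω ∂μ, Tendsto (fun T : ℝ => T⁻¹ * ∫ t in (0 : ℝ)..T, age P X B n a₀ t ω) atTop (𝓝 a)

/-! ### Moments and expansion coefficients -/

/-- The mean of a law on the line. -/
def mean (ν : Measure ℝ) : ℝ := ∫ x, x ∂ν

/-- The second moment of a law on the line. -/
def secondMoment (ν : Measure ℝ) : ℝ := ∫ x, x ^ 2 ∂ν

/-- The numerator of the closed form of the geometric-type series: `g` stands for the MGF of the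
service time of the source and `h k` for the MGF of the `k`-th sub-pattern, either as numbers
or as polynomials truncating their expansions at `0`. -/
def numer {R : Type*} [CommRing R] (p g : R) (h : ℕ → R) (α k : ℕ) : R :=
  (1 - p) * ∑ j ∈ Finset.Icc 1 α, p ^ (j - 1) * g ^ (j - 1) * ∏ l ∈ Finset.Icc 1 j, h (k + l - 1)

/-- The denominator of the closed form; it does not depend on `k`. -/
def denom {R : Type*} [CommRing R] (p g : R) (h : ℕ → R) (α : ℕ) : R :=
  1 - p ^ α * g ^ α * ∏ m ∈ Finset.Icc 1 α, h (m - 1)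

/-- The second order expansion `1 + m₁ s + (m₂ / 2) s²` of an MGF with first two moments
`m₁`, `m₂`. -/
def truncMGF (m₁ m₂ : ℝ) : ℝ[X] := 1 + C m₁ * X + C (m₂ / 2) * X ^ 2

/-- The numerator with every MGF replaced by its second order expansion. -/
def numerPoly (p s q : ℝ) (sSub qSub : ℕ → ℝ) (α k : ℕ) : ℝ[X] :=
  numer (C p) (truncMGF s q) (fun i => truncMGF (sSub i) (qSub i)) α k

/-- The denominator with every MGF replaced by its second order expansion. -/
def denomPoly (p s q : ℝ) (sSub qSub : ℕ → ℝ) (α : ℕ) : ℝ[X] :=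
  denom (C p) (truncMGF s q) (fun i => truncMGF (sSub i) (qSub i)) α

end

end CyclicAoI

namespace CyclicAoI

noncomputable section

/-! ### Combinatorics of the schedule -/

section Schedule

variable {N K : ℕ} [NeZero K] {P : Fin K → Fin N} {n : Fin N}

/-! The drop events are independent of the service times. Given a success at appearance `k`, the
number `m` of failures before the next success therefore has weights `(1 - p) p ^ m`, and on each
value of `m` the gap is the sum of the service times of a fixed finite set of slots. So the law of
the gap is a geometric mixture of the laws of `gapTime` (`IsModel.gapLaw_eq`). It is periodic in `k`
because the law of the whole path is invariant under the shift by one pattern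
(`IsModel.map_path_shift`).

A failed attempt restarts the search one appearance later, which gives `w k = h k * ((1 - p) + p * g
* w (k + 1))` for the MGFs (`IsModel.mgf_gapLaw_recursion`). After `α` substitutions periodicity
returns `w k` itself, and the resulting linear equation is the closed form. This is
`denom_mul_eq_numer`, valid in any commutative ring because it avoids division.

That generality also yields the moments. Only second moments are assumed, so the MGF need not be
finite near `0` and cannot be differentiated. But the first two moments of the gaps obey the same
recursion modulo `X ^ 3`, with every MGF replaced by its second order polynomial. Applying
`denom_mul_eq_numer` in `ℝ[X] / (X ^ 3)` and comparing coefficients gives the second moment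
(`secondMoment_eq_of_recursion`). The mean comes more directly, by summing its recursion over one
period.

For the steady state, let `w j r` be the probability that the `j`-th success is at an appearance
congruent to `r` modulo `α`. Then `w (j+1) (r+1) = p * w (j+1) r + (1 - p) * w j r`. If `p > 0`, the
deviation from the uniform distribution contracts by a fixed factor. If `p = 0` the recursion is a
rotation; still, the deviations summed over `j` stay bounded, so the averages converge.

Between two receptions the age is linear, and the area below it depends on the service time of the
first packet and on the length of the gap. The mean age is the mean area divided by the mean gap.
Attaching each gap to the slot that opens it turns the sums over whole patterns into Birkhoff sums
of the shift on path space. This shift is ergodic by Kolmogorov's zero-one law (`ergodic_shift`),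
and the pointwise ergodic theorem (`tendsto_birkhoff`) is proved here by a maximal function
argument. Monotonicity of the integral of the age interpolates between receptions. -/

lemma sched_add_period (P : Fin K → Fin N) (i : ℕ) : sched P (i + K) = sched P i := by
  simp [sched, Fin.ofNat]

lemma sched_add_mul_period (P : Fin K → Fin N) (i m : ℕ) : sched P (i + m * K) = sched P i := by
  simp [sched, Fin.ofNat]

lemma sched_val (P : Fin K → Fin N) (k : Fin K) : sched P k = P k := by
  simp [sched]

lemma infinite_sched (hn : ∃ k, P k = n) : {i | sched P i = n}.Infinite := by
  obtain ⟨k, hk⟩ := hn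
  refine Set.infinite_of_injective_forall_mem (f := fun m : ℕ => (k : ℕ) + m * K) ?_ ?_
  · intro a b hab
    have : a * K = b * K := by simpa using hab
    exact Nat.eq_of_mul_eq_mul_right (NeZero.pos K) this
  · intro m
    change sched P (k + m * K) = n
    rw [sched_add_mul_period, sched_val, hk]

lemma pos_strictMono (hn : ∃ k, P k = n) : StrictMono (pos P n) :=
  Nat.nth_strictMono (infinite_sched hn)

lemma sched_pos (hn : ∃ k, P k = n) (k : ℕ) : sched P (pos P n k) = n :=
  Nat.nth_mem_of_infinite (infinite_sched hn) k

lemma exists_pos_eq {i : ℕ} (h : sched P i = n) : ∃ k, pos P n k = i :=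
  ⟨_, Nat.nth_count (p := fun i => sched P i = n) h⟩

lemma count_sched_period (P : Fin K → Fin N) (n : Fin N) :
    Nat.count (fun i => sched P i = n) K = alpha P n := by
  rw [Nat.count_eq_card_filter_range, alpha]
  symm
  refine Finset.card_bij (fun k _ => (k : ℕ)) ?_ ?_ ?_
  · intro k hk
    simpa [sched_val] using hk
  · intro a _ b _ h
    exact Fin.ext h
  · intro b hb
    simp only [Finset.mem_filter, Finset.mem_range] at hb
    refine ⟨⟨b, hb.1⟩, ?_, rfl⟩
    simpa [← sched_val P ⟨b, hb.1⟩] using hb.2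

omit [NeZero K] in
lemma alpha_pos (hn : ∃ k, P k = n) : 0 < alpha P n := by
  obtain ⟨k, hk⟩ := hn
  exact Finset.card_pos.2 ⟨k, by simpa using hk⟩

/-- The slot `K + pos P n k` serves `n`, and it is preceded by `alpha P n` appearances in the first
pattern and, by periodicity, `k` more after it. Its rank among the appearances is therefore `k +
alpha P n`. -/
lemma pos_add_alpha (hn : ∃ k, P k = n) (k : ℕ) : pos P n (k + alpha P n) = pos P n k + K := by
  have h : sched P (K + pos P n k) = n := by rw [add_comm, sched_add_period, sched_pos hn]
  have h2 := Nat.nth_count (p := fun i => sched P i = n) h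
  rw [Nat.count_add, count_sched_period] at h2
  have h3 : (fun i => sched P (K + i) = n) = fun i => sched P i = n := by
    funext i; rw [add_comm, sched_add_period]
  have h4 : Nat.count (fun i => sched P (K + i) = n) (pos P n k) = k := by
    simp only [h3]
    exact Nat.count_nth_of_infinite (infinite_sched hn) k
  rw [h4, add_comm] at h2
  rw [pos, h2, add_comm]

lemma pos_add_mul_alpha (hn : ∃ k, P k = n) (k m : ℕ) :
    pos P n (k + m * alpha P n) = pos P n k + m * K := by
  induction m with
  | zero => simp
  | succ m ih => rw [add_mul, one_mul, ← add_assoc, pos_add_alpha hn, ih]; ring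

lemma pos_lt_period_iff (hn : ∃ k, P k = n) {k : ℕ} : pos P n k < K ↔ k < alpha P n := by
  rw [← count_sched_period, ← not_le, ← not_le, pos, ← Nat.count_le_iff_le_nth (infinite_sched hn)]

lemma sum_range_period {M : Type*} [AddCommMonoid M] (hn : ∃ k, P k = n) (f : ℕ → M)
    (hf : ∀ i, sched P i ≠ n → f i = 0) :
    ∑ i ∈ range K, f i = ∑ k ∈ range (alpha P n), f (pos P n k) := by
  symm
  refine Finset.sum_of_injOn (pos P n) (pos_strictMono hn).injective.injOn ?_ ?_ (fun _ _ => rfl)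
  · intro k hk
    simpa [pos_lt_period_iff hn] using hk
  · intro i hi hi'
    refine hf i fun h => hi' ?_
    obtain ⟨k, rfl⟩ := exists_pos_eq h
    exact ⟨k, by simpa [pos_lt_period_iff hn] using hi, rfl⟩

lemma sched_ne_of_mem_Ioo (hn : ∃ k, P k = n) {i k : ℕ}
    (hi : i ∈ Ioo (pos P n k) (pos P n (k + 1))) : sched P i ≠ n := by
  intro h
  obtain ⟨l, rfl⟩ := exists_pos_eq h
  rw [mem_Ioo, (pos_strictMono hn).lt_iff_lt, (pos_strictMono hn).lt_iff_lt] at hi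
  omega

lemma Ioo_pos_succ (hn : ∃ k, P k = n) (k m : ℕ) :
    Ioo (pos P n k) (pos P n (k + 1 + (m + 1))) =
      insert (pos P n (k + 1 + m)) (Ioo (pos P n k) (pos P n (k + 1 + m)) ∪
        Ioo (pos P n (k + 1 + m)) (pos P n (k + 1 + m + 1))) := by
  have h1 := pos_strictMono hn (show k < k + 1 + m by omega)
  have h2 := pos_strictMono hn (show k + 1 + m < k + 1 + m + 1 by omega)
  ext i
  simp only [mem_insert, mem_union, mem_Ioo, ← add_assoc] at *
  omega

lemma Ioo_pos_add_alpha (hn : ∃ k, P k = n) (k m : ℕ) :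
    Ioo (pos P n (k + alpha P n)) (pos P n (k + alpha P n + 1 + m)) =
      (Ioo (pos P n k) (pos P n (k + 1 + m))).map (addRightEmbedding K) := by
  rw [pos_add_alpha hn, show k + alpha P n + 1 + m = k + 1 + m + alpha P n by ring,
    pos_add_alpha hn, Finset.map_add_right_Ioo]

end Schedule

/-! ### Gaps between successes along a path -/

section Path

variable {N K : ℕ} [NeZero K] {P : Fin K → Fin N} {n : Fin N} {Ω : Type*}
  {X : ℕ → Ω → ℝ} {B : ℕ → Ω → Bool} {ω : Ω}

/-- The total service time of the slots strictly between the `k`-th and the `(k+1+m)`-th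
appearances of source `n`. -/
def gapTime (P : Fin K → Fin N) (X : ℕ → Ω → ℝ) (n : Fin N) (k m : ℕ) (ω : Ω) : ℝ :=
  ∑ i ∈ Ioo (pos P n k) (pos P n (k + 1 + m)), X i ω

/-- The first success after the `k`-th appearance of source `n` is at appearance `k+1+m`. -/
def gapEvent (P : Fin K → Fin N) (B : ℕ → Ω → Bool) (n : Fin N) (k m : ℕ) : Set Ω :=
  {ω | (∀ l ∈ Ioo k (k + 1 + m), B (pos P n l) ω = false) ∧ B (pos P n (k + 1 + m)) ω = true}

lemma gapTime_succ (hn : ∃ k, P k = n) (k m : ℕ) (ω : Ω) :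
    gapTime P X n k (m + 1) ω = gapTime P X n k m ω + X (pos P n (k + 1 + m)) ω
      + subTime P X n (k + 1 + m) ω := by
  rw [gapTime, Ioo_pos_succ hn, sum_insert, sum_union]
  · simp only [gapTime, subTime]; ring
  · rw [Finset.disjoint_left]; intro i; simp only [mem_Ioo]; omega
  · simp

lemma startTime_sub (X : ℕ → Ω → ℝ) {i j : ℕ} (h : i ≤ j) (ω : Ω) :
    startTime X j ω - startTime X i ω = ∑ l ∈ Ico i j, X l ω := by
  rw [startTime, startTime, Finset.sum_Ico_eq_sub _ h]

lemma startTime_sub_eq_gapTime (hn : ∃ k, P k = n) (k m : ℕ) (ω : Ω) :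
    startTime X (pos P n (k + 1 + m)) ω - startTime X (pos P n k + 1) ω = gapTime P X n k m ω := by
  rw [startTime_sub]
  · rfl
  · exact pos_strictMono hn (by omega)

lemma success_iff (hn : ∃ k, P k = n) {i : ℕ} :
    Success P B n ω i ↔ ∃ l, pos P n l = i ∧ B (pos P n l) ω = true := by
  constructor
  · rintro ⟨h1, h2⟩
    obtain ⟨l, rfl⟩ := exists_pos_eq h1
    exact ⟨l, rfl, h2⟩
  · rintro ⟨l, rfl, h⟩
    exact ⟨sched_pos hn l, h⟩

lemma success_pos_iff (hn : ∃ k, P k = n) {l : ℕ} :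
    Success P B n ω (pos P n l) ↔ B (pos P n l) ω = true :=
  ⟨fun h => h.2, fun h => ⟨sched_pos hn l, h⟩⟩

lemma isLeast_of_mem_gapEvent (hn : ∃ k, P k = n) {k m : ℕ} (h : ω ∈ gapEvent P B n k m) :
    IsLeast {i | pos P n k < i ∧ Success P B n ω i} (pos P n (k + 1 + m)) := by
  refine ⟨⟨pos_strictMono hn (by omega), (success_pos_iff hn).2 h.2⟩, ?_⟩
  rintro i ⟨hi, hs⟩
  obtain ⟨l, rfl, hl⟩ := (success_iff hn).1 hs
  rw [(pos_strictMono hn).lt_iff_lt] at hi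
  rw [(pos_strictMono hn).le_iff_le]
  by_contra! hlt
  have := h.1 l (mem_Ioo.2 ⟨hi, hlt⟩)
  simp [this] at hl

lemma disjoint_gapEvent (k : ℕ) : Pairwise (Function.onFun Disjoint (gapEvent (n := n) P B k)) := by
  have key : ∀ m m', m < m' → Disjoint (gapEvent (n := n) P B k m) (gapEvent P B n k m') := by
    intro m m' hm
    rw [Set.disjoint_left]
    rintro ω ⟨_, h⟩ ⟨h', _⟩
    have := h' (k + 1 + m) (mem_Ioo.2 (by omega))
    simp [this] at h
  intro m m' hne
  rcases lt_or_gt_of_ne hne with h | h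
  · exact key _ _ h
  · exact (key _ _ h).symm

lemma nextGap_eq_of_mem_gapEvent (hn : ∃ k, P k = n) {k m : ℕ} (h : ω ∈ gapEvent P B n k m) :
    nextGap P X B n k ω = gapTime P X n k m ω := by
  rw [nextGap, (isLeast_of_mem_gapEvent hn h).csInf_eq, startTime_sub_eq_gapTime hn]

/-- `pos P n` is an increasing bijection from appearances to slots serving `n`. This lets `Nat.nth`
of successes, which runs over slots, be computed from a count over appearances. -/
lemma count_success_pos [DecidablePred (Success P B n ω)] (hn : ∃ k, P k = n) (k : ℕ) :
    Nat.count (Success P B n ω) (pos P n k) = Nat.count (fun l => B (pos P n l) ω = true) k := by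
  rw [Nat.count_eq_card_filter_range, Nat.count_eq_card_filter_range]
  symm
  refine Finset.card_bij (fun l _ => pos P n l) ?_ ?_ ?_
  · intro l hl
    simp only [mem_filter, mem_range] at hl ⊢
    exact ⟨pos_strictMono hn hl.1, (success_pos_iff hn).2 hl.2⟩
  · intro a _ b _ h
    exact (pos_strictMono hn).injective h
  · intro i hi
    simp only [mem_filter, mem_range] at hi
    obtain ⟨l, rfl, hl⟩ := (success_iff hn).1 hi.2
    exact ⟨l, by simpa [hl] using (pos_strictMono hn).lt_iff_lt.1 hi.1, rfl⟩

/-- The number of successes among the first `k` appearances of source `n`. -/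
def successCount (P : Fin K → Fin N) (B : ℕ → Ω → Bool) (n : Fin N) (k : ℕ) (ω : Ω) : ℕ :=
  Nat.count (fun l => B (pos P n l) ω = true) k

lemma successCount_succ (k : ℕ) (ω : Ω) : successCount P B n (k + 1) ω =
    successCount P B n k ω + if B (pos P n k) ω = true then 1 else 0 := Nat.count_succ ..

lemma nth_success (hn : ∃ k, P k = n) {j k : ℕ} (hk : B (pos P n k) ω = true)
    (hj : successCount P B n k ω = j) : Nat.nth (Success P B n ω) j = pos P n k := by
  classical
  rw [← hj, successCount, ← count_success_pos hn]
  exact Nat.nth_count ((success_pos_iff hn).2 hk)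

lemma successCount_of_mem_gapEvent {k m : ℕ} (hk : B (pos P n k) ω = true)
    (h : ω ∈ gapEvent P B n k m) :
    successCount P B n (k + 1 + m) ω = successCount P B n k ω + 1 := by
  have key : ∀ i ≤ m, successCount P B n (k + 1 + i) ω = successCount P B n k ω + 1 := by
    intro i
    induction i with
    | zero => intro _; simp [successCount_succ, hk]
    | succ i ih =>
      intro hi
      rw [← add_assoc, successCount_succ, ih (by omega), h.1 (k + 1 + i) (mem_Ioo.2 (by omega))]
      simp
  exact key m le_rfl

lemma interSuccess_eq_of_mem_gapEvent (hn : ∃ k, P k = n) {j k m : ℕ}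
    (hk : B (pos P n k) ω = true) (hj : successCount P B n k ω = j)
    (h : ω ∈ gapEvent P B n k m) : interSuccess P X B n j ω = gapTime P X n k m ω := by
  rw [interSuccess, nth_success hn hk hj, nth_success hn h.2
    ((successCount_of_mem_gapEvent hk h).trans (by rw [hj])), startTime_sub_eq_gapTime hn]

end Path

end

end CyclicAoI

namespace CyclicAoI

noncomputable section

/-! ### The information carried by a set of service times and drop events -/

section SlotAlgebra

variable {Ω : Type*} {X : ℕ → Ω → ℝ} {B : ℕ → Ω → Bool}

/-- The service times (index `true`) and the drop events (index `false`), coded as reals. -/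
def slotVar (X : ℕ → Ω → ℝ) (B : ℕ → Ω → Bool) (i : ℕ) (j : Bool) (ω : Ω) : ℝ :=
  if j then X i ω else if B i ω then 1 else 0

/-- The σ-algebra generated by the service times `X i`, `(i, true) ∈ S`, and the drop events `B i`,
`(i, false) ∈ S`. -/
@[reducible]
def slotAlg (X : ℕ → Ω → ℝ) (B : ℕ → Ω → Bool) (S : Set (ℕ × Bool)) : MeasurableSpace Ω :=
  ⨆ x ∈ S, MeasurableSpace.comap (slotVar X B x.1 x.2) inferInstance

lemma measurable_slotVar_slotAlg {S : Set (ℕ × Bool)} {x : ℕ × Bool} (hx : x ∈ S) :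
    Measurable[slotAlg X B S] (slotVar X B x.1 x.2) :=
  Measurable.of_comap_le (le_iSup₂_of_le x hx le_rfl)

lemma measurable_service_slotAlg {S : Set (ℕ × Bool)} {i : ℕ} (hi : (i, true) ∈ S) :
    Measurable[slotAlg X B S] (X i) :=
  measurable_slotVar_slotAlg (X := X) (B := B) hi

lemma measurableSet_received_slotAlg {S : Set (ℕ × Bool)} {i : ℕ} (hi : (i, false) ∈ S) (b : Bool) :
    MeasurableSet[slotAlg X B S] {ω | B i ω = b} := by
  have h := measurable_slotVar_slotAlg (X := X) (B := B) hi
    (measurableSet_singleton (if b then (1 : ℝ) else 0))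
  convert h using 1
  ext ω
  cases b <;> cases hb : B i ω <;> simp [slotVar, hb]

end SlotAlgebra

/-! ### Independence of disjoint groups of service times and drop events. -/

section Probability

variable {N K : ℕ} [NeZero K] {P : Fin K → Fin N} {n : Fin N} {Ω : Type*} [MeasurableSpace Ω]
  {μ : Measure Ω} {p : Fin N → ℝ} {ν : Fin N → Measure ℝ}
  {X : ℕ → Ω → ℝ} {B : ℕ → Ω → Bool}

lemma IsModel.measurable_slotVar (h : IsModel μ P p ν X B) (i : ℕ) (j : Bool) :
    Measurable (slotVar X B i j) := by
  cases j
  · have : MeasurableSet {ω | B i ω = true} :=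
      h.measurable_received i (measurableSet_singleton true)
    have h2 : Measurable (fun ω => if B i ω = true then (1 : ℝ) else 0) :=
      Measurable.ite this measurable_const measurable_const
    exact h2
  · exact h.measurable_service i

lemma iIndepFun_bool_of_indepFun {β : Type*} [MeasurableSpace β] [IsProbabilityMeasure μ]
    {Z : Bool → Ω → β} (h : IndepFun (Z true) (Z false) μ) : iIndepFun Z μ := by
  rw [iIndepFun_iff_measure_inter_preimage_eq_mul]
  intro S s hs
  have hS : S = ∅ ∨ S = {true} ∨ S = {false} ∨ S = {true, false} := by
    clear hs; revert S; decide
  rcases hS with rfl | rfl | rfl | rfl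
  · simp
  · simp
  · simp
  · rw [Finset.set_biInter_insert, Finset.set_biInter_singleton, Finset.prod_pair (by simp)]
    exact h.measure_inter_preimage_eq_mul _ _ (hs true (by simp)) (hs false (by simp))

/-- Independence across slots and independence of the two variables within a slot combine into one
family indexed by `ℕ × Bool`. Coding the drop events as reals gives all members a common codomain.
-/
lemma IsModel.iIndepFun_slotVar [IsProbabilityMeasure μ] (h : IsModel μ P p ν X B) :
    iIndepFun (fun (x : ℕ × Bool) => slotVar X B x.1 x.2) μ := by
  have hB : Measurable (fun b : Bool => if b then (1 : ℝ) else 0) := measurable_of_countable _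
  refine iIndepFun_uncurry' (X := slotVar X B) h.measurable_slotVar ?_ fun i => ?_
  · refine h.indep.comp (fun _ (y : ℝ × Bool) (j : Bool) =>
      if j then y.1 else if y.2 then (1 : ℝ) else 0) fun _ => ?_
    refine measurable_pi_lambda _ fun j => ?_
    cases j
    · exact hB.comp measurable_snd
    · exact measurable_fst
  · refine iIndepFun_bool_of_indepFun ?_
    exact (h.indep_slot i).comp measurable_id hB

lemma IsModel.slotAlg_le (h : IsModel μ P p ν X B) (S : Set (ℕ × Bool)) :
    slotAlg X B S ≤ ‹MeasurableSpace Ω› :=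
  iSup₂_le fun x _ => (h.measurable_slotVar x.1 x.2).comap_le

/-- The source of the later factorizations over groups of slots: it suffices to exhibit disjoint
index sets with respect to which the two sides are measurable. -/
lemma IsModel.indep_slotAlg [IsProbabilityMeasure μ] (h : IsModel μ P p ν X B)
    {S T : Set (ℕ × Bool)} (hST : Disjoint S T) : Indep (slotAlg X B S) (slotAlg X B T) μ :=
  indep_iSup_of_disjoint (m := fun x : ℕ × Bool =>
      MeasurableSpace.comap (slotVar X B x.1 x.2) inferInstance)
    (fun x => (h.measurable_slotVar x.1 x.2).comap_le)
    ((iIndepFun_iff_iIndep _ _ _).1 h.iIndepFun_slotVar) hST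

omit [MeasurableSpace Ω] in
lemma slotAlg_mono (X : ℕ → Ω → ℝ) (B : ℕ → Ω → Bool) {S T : Set (ℕ × Bool)} (hST : S ⊆ T) :
    slotAlg X B S ≤ slotAlg X B T :=
  biSup_mono hST

lemma IsModel.real_inter [IsProbabilityMeasure μ] (h : IsModel μ P p ν X B)
    {S T : Set (ℕ × Bool)} (hST : Disjoint S T) {E F : Set Ω} (hE : MeasurableSet[slotAlg X B S] E)
    (hF : MeasurableSet[slotAlg X B T] F) : μ.real (E ∩ F) = μ.real E * μ.real F := by
  simp only [measureReal_def]
  rw [(Indep_iff _ _ _).1 (h.indep_slotAlg hST) E F hE hF, ENNReal.toReal_mul]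

lemma IsModel.indepFun [IsProbabilityMeasure μ] (h : IsModel μ P p ν X B)
    {S T : Set (ℕ × Bool)} (hST : Disjoint S T) {β γ : Type*} [MeasurableSpace β]
    [MeasurableSpace γ] {f : Ω → β} {g : Ω → γ} (hf : Measurable[slotAlg X B S] f)
    (hg : Measurable[slotAlg X B T] g) : IndepFun f g μ := by
  rw [IndepFun_iff_Indep]
  exact indep_of_indep_of_le_right (indep_of_indep_of_le_left (h.indep_slotAlg hST) hf.comap_le)
    hg.comap_le

/-- The service times of the slots in `S`. -/
abbrev servicePart (S : Set ℕ) : Set (ℕ × Bool) := {x | x.1 ∈ S ∧ x.2 = true}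

/-- The drop events of the slots in `S`. -/
abbrev dropPart (S : Set ℕ) : Set (ℕ × Bool) := {x | x.1 ∈ S ∧ x.2 = false}

lemma mem_servicePart {S : Set ℕ} {i : ℕ} (h : i ∈ S) : (i, true) ∈ servicePart S := ⟨h, rfl⟩

lemma mem_dropPart {S : Set ℕ} {i : ℕ} (h : i ∈ S) : (i, false) ∈ dropPart S := ⟨h, rfl⟩

lemma dropPart_mono {S T : Set ℕ} (h : S ⊆ T) : dropPart S ⊆ dropPart T :=
  fun _ hx => ⟨h hx.1, hx.2⟩

lemma disjoint_servicePart_dropPart (S T : Set ℕ) : Disjoint (servicePart S) (dropPart T) := by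
  rw [Set.disjoint_left]
  rintro x ⟨_, h⟩ ⟨_, h'⟩
  simp [h] at h'

lemma disjoint_servicePart {S T : Set ℕ} (h : Disjoint S T) :
    Disjoint (servicePart S) (servicePart T) := by
  rw [Set.disjoint_left] at *
  rintro x ⟨hx, _⟩ ⟨hx', _⟩
  exact h hx hx'

lemma disjoint_dropPart {S T : Set ℕ} (h : Disjoint S T) :
    Disjoint (dropPart S) (dropPart T) := by
  rw [Set.disjoint_left] at *
  rintro x ⟨hx, _⟩ ⟨hx', _⟩
  exact h hx hx'

omit [MeasurableSpace Ω] in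
lemma measurable_sum_service {S : Set ℕ} {s : Finset ℕ} (hs : ∀ i ∈ s, i ∈ S) :
    Measurable[slotAlg X B (servicePart S)] (fun ω => ∑ i ∈ s, X i ω) :=
  Finset.measurable_fun_sum _ fun i hi => measurable_service_slotAlg (mem_servicePart (hs i hi))

omit [MeasurableSpace Ω] in
lemma measurableSet_gapEvent_slotAlg (hn : ∃ k, P k = n) (k m : ℕ) :
    MeasurableSet[slotAlg X B (dropPart (Set.Ioi (pos P n k)))] (gapEvent P B n k m) := by
  have : gapEvent P B n k m = (⋂ l ∈ Ioo k (k + 1 + m), {ω | B (pos P n l) ω = false}) ∩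
      {ω | B (pos P n (k + 1 + m)) ω = true} := by
    ext ω; simp [gapEvent]
  rw [this]
  refine MeasurableSet.inter (Finset.measurableSet_biInter _ fun l hl => ?_) ?_
  · exact measurableSet_received_slotAlg
      (mem_dropPart (Set.mem_Ioi.2 (pos_strictMono hn (mem_Ioo.1 hl).1))) false
  · exact measurableSet_received_slotAlg
      (mem_dropPart (Set.mem_Ioi.2 (pos_strictMono hn (by omega)))) true

omit [MeasurableSpace Ω] in
lemma measurableSet_received_pos_slotAlg (k : ℕ) (b : Bool) :
    MeasurableSet[slotAlg X B (dropPart {pos P n k})] {ω | B (pos P n k) ω = b} :=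
  measurableSet_received_slotAlg (mem_dropPart (Set.mem_singleton _)) b

omit [MeasurableSpace Ω] in
-- The number of successes before appearance `k` is decided by strictly earlier drop events, so it
-- is independent of the attempt at `k` and of everything after it.
lemma measurableSet_successCount_slotAlg (hn : ∃ k, P k = n) (k j : ℕ) :
    MeasurableSet[slotAlg X B (dropPart (Set.Iio (pos P n k)))]
      {ω | successCount P B n k ω = j} := by
  induction k generalizing j with
  | zero => simp [successCount]
  | succ k ih =>
    have hlt := pos_strictMono hn (Nat.lt_succ_self k)
    have hle : slotAlg X B (dropPart (Set.Iio (pos P n k))) ≤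
        slotAlg X B (dropPart (Set.Iio (pos P n (k + 1)))) :=
      slotAlg_mono X B (dropPart_mono (Set.Iio_subset_Iio hlt.le))
    have hb : ∀ b, MeasurableSet[slotAlg X B (dropPart (Set.Iio (pos P n (k + 1))))]
        {ω | B (pos P n k) ω = b} := measurableSet_received_slotAlg (mem_dropPart hlt)
    have : {ω | successCount P B n (k + 1) ω = j} =
        ({ω | successCount P B n k ω = j} ∩ {ω | B (pos P n k) ω = false}) ∪
        ((⋃ i ∈ {i | i + 1 = j}, {ω | successCount P B n k ω = i}) ∩
          {ω | B (pos P n k) ω = true}) := by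
      ext ω
      cases h : B (pos P n k) ω <;> simp [successCount_succ, h]
    rw [this]
    refine (((hle _ (ih j)).inter (hb _))).union (MeasurableSet.inter ?_ (hb _))
    exact MeasurableSet.biUnion (Set.to_countable _) fun i _ => hle _ (ih i)

/-! ### Probabilities of the drop events -/

lemma IsModel.real_received [IsProbabilityMeasure μ] (h : IsModel μ P p ν X B)
    (hp : ∀ m, 0 ≤ p m ∧ p m ≤ 1) (hn : ∃ k, P k = n) (k : ℕ) :
    μ.real {ω | B (pos P n k) ω = true} = 1 - p n := by
  rw [measureReal_def, h.prob_received, sched_pos hn, ENNReal.toReal_ofReal]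
  linarith [(hp n).2]

lemma IsModel.real_dropped [IsProbabilityMeasure μ] (h : IsModel μ P p ν X B)
    (hp : ∀ m, 0 ≤ p m ∧ p m ≤ 1) (hn : ∃ k, P k = n) (k : ℕ) :
    μ.real {ω | B (pos P n k) ω = false} = p n := by
  have h1 : {ω | B (pos P n k) ω = false} = {ω | B (pos P n k) ω = true}ᶜ := by
    ext ω; simp
  rw [h1, probReal_compl_eq_one_sub, h.real_received hp hn]
  · ring
  · exact h.measurable_received _ (measurableSet_singleton true)

lemma IsModel.real_gapEvent [IsProbabilityMeasure μ] (h : IsModel μ P p ν X B)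
    (hp : ∀ m, 0 ≤ p m ∧ p m ≤ 1) (hn : ∃ k, P k = n) (k m : ℕ) :
    μ.real (gapEvent P B n k m) = (1 - p n) * p n ^ m := by
  induction m generalizing k with
  | zero =>
    have : gapEvent P B n k 0 = {ω | B (pos P n (k + 1)) ω = true} := by
      ext ω
      simp only [gapEvent, mem_Ioo, Set.mem_ofPred_eq, add_zero, and_iff_right_iff_imp]
      intro _ l hl; omega
    rw [this, h.real_received hp hn]; simp
  | succ m ih =>
    -- The first attempt is peeled off, not the last, so that what remains is again a `gapEvent`,
    -- now started from `k + 1`.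
    have : gapEvent P B n k (m + 1) = {ω | B (pos P n (k + 1)) ω = false} ∩
        gapEvent P B n (k + 1) m := by
      ext ω
      simp only [gapEvent, mem_Ioo, Set.mem_ofPred_eq, Set.mem_inter_iff,
        show k + 1 + (m + 1) = k + 1 + 1 + m by ring, ← and_assoc, and_congr_left_iff]
      intro _
      constructor
      · intro h
        exact ⟨h _ (by omega), fun l hl => h l (by omega)⟩
      · rintro ⟨h1, h2⟩ l hl
        rcases eq_or_ne l (k + 1) with rfl | hne
        · exact h1
        · exact h2 l (by omega)
    rw [this, h.real_inter (disjoint_dropPart ?_) (measurableSet_received_pos_slotAlg _ _)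
      (measurableSet_gapEvent_slotAlg hn _ _), ih, h.real_dropped hp hn]
    · ring
    · simp

lemma IsModel.real_received_inter_gapEvent [IsProbabilityMeasure μ] (h : IsModel μ P p ν X B)
    (hp : ∀ m, 0 ≤ p m ∧ p m ≤ 1) (hn : ∃ k, P k = n) (k m : ℕ) :
    μ.real ({ω | B (pos P n k) ω = true} ∩ gapEvent P B n k m) =
      (1 - p n) * ((1 - p n) * p n ^ m) := by
  rw [h.real_inter (disjoint_dropPart ?_) (measurableSet_received_pos_slotAlg _ _)
      (measurableSet_gapEvent_slotAlg hn _ _), h.real_received hp hn, h.real_gapEvent hp hn]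
  simp

omit [MeasurableSpace Ω] in
lemma measurableSet_received_inter_gapEvent_slotAlg (hn : ∃ k, P k = n) (k m : ℕ) :
    MeasurableSet[slotAlg X B (dropPart (Set.Ici (pos P n k)))]
      ({ω | B (pos P n k) ω = true} ∩ gapEvent P B n k m) := by
  refine MeasurableSet.inter
    (measurableSet_received_slotAlg (mem_dropPart (Set.mem_Ici.2 le_rfl)) true) ?_
  exact slotAlg_mono X B (dropPart_mono Set.Ioi_subset_Ici_self) _
    (measurableSet_gapEvent_slotAlg hn k m)

lemma IsModel.real_successCount_inter [IsProbabilityMeasure μ] (h : IsModel μ P p ν X B)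
    (hp : ∀ m, 0 ≤ p m ∧ p m ≤ 1) (hn : ∃ k, P k = n) (j k m : ℕ) :
    μ.real ({ω | successCount P B n k ω = j} ∩
      ({ω | B (pos P n k) ω = true} ∩ gapEvent P B n k m)) =
      μ.real {ω | successCount P B n k ω = j} * ((1 - p n) * ((1 - p n) * p n ^ m)) := by
  rw [h.real_inter (disjoint_dropPart (T := Set.Ici (pos P n k)) ?_)
    (measurableSet_successCount_slotAlg hn k j)
    (measurableSet_received_inter_gapEvent_slotAlg hn k m), h.real_received_inter_gapEvent hp hn]
  rw [Set.disjoint_left]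
  intro x hx hx'
  exact not_lt.2 (Set.mem_Ici.1 hx') hx

/-- Conditioning on the attempt at appearance `k` gives Pascal's rule for the binomial counts. It is
the origin of the recursion for the residues of the success positions. -/
lemma IsModel.real_successCount_succ [IsProbabilityMeasure μ] (h : IsModel μ P p ν X B)
    (hp : ∀ m, 0 ≤ p m ∧ p m ≤ 1) (hn : ∃ k, P k = n) (j k : ℕ) :
    μ.real {ω | successCount P B n (k + 1) ω = j + 1} =
      p n * μ.real {ω | successCount P B n k ω = j + 1} +
      (1 - p n) * μ.real {ω | successCount P B n k ω = j} := by
  have hset : {ω | successCount P B n (k + 1) ω = j + 1} =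
      ({ω | successCount P B n k ω = j + 1} ∩ {ω | B (pos P n k) ω = false}) ∪
      ({ω | successCount P B n k ω = j} ∩ {ω | B (pos P n k) ω = true}) := by
    ext ω
    cases h : B (pos P n k) ω <;> simp [successCount_succ, h]
  have hd : Disjoint (dropPart (Set.Iio (pos P n k))) (dropPart {pos P n k}) :=
    disjoint_dropPart (by simp)
  have hC := fun i => measurableSet_successCount_slotAlg (X := X) (B := B) hn k i
  have hb := fun b => measurableSet_received_pos_slotAlg (X := X) (B := B) (P := P) (n := n) k b
  rw [hset, measureReal_union, h.real_inter hd (hC _) (hb _), h.real_inter hd (hC _) (hb _),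
    h.real_received hp hn, h.real_dropped hp hn]
  · ring
  · rw [Set.disjoint_left]
    rintro ω ⟨_, h1⟩ ⟨_, h2⟩
    simp only [Set.mem_ofPred_eq] at h1 h2
    simp [h1] at h2
  · exact (h.slotAlg_le _ _ (hC _)).inter (h.slotAlg_le _ _ (hb _))

lemma IsModel.measurableSet_gapEvent (h : IsModel μ P p ν X B) (hn : ∃ k, P k = n) (k m : ℕ) :
    MeasurableSet (gapEvent P B n k m) :=
  h.slotAlg_le _ _ (measurableSet_gapEvent_slotAlg hn k m)

lemma IsModel.measurable_gapTime (h : IsModel μ P p ν X B) (k m : ℕ) :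
    Measurable (gapTime P X n k m) :=
  Finset.measurable_fun_sum _ fun i _ => h.measurable_service i

lemma hasSum_geometric_weights {p : ℝ} (h0 : 0 ≤ p) (h1 : p < 1) :
    HasSum (fun m : ℕ => (1 - p) * p ^ m) 1 := by
  have := (hasSum_geometric_of_lt_one h0 h1).mul_left (1 - p)
  rwa [mul_inv_cancel₀ (by linarith)] at this

lemma measure_iUnion_eq_one_of_hasSum {ι : Type*} [Countable ι] [IsProbabilityMeasure μ]
    {E : ι → Set Ω} (hE : ∀ i, MeasurableSet (E i)) (hd : Pairwise (Function.onFun Disjoint E))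
    (hs : HasSum (fun i => μ.real (E i)) 1) : ∀ᵐ ω ∂μ, ω ∈ ⋃ i, E i := by
  change (⋃ i, E i) ∈ ae μ
  rw [mem_ae_iff_prob_eq_one (MeasurableSet.iUnion hE), measure_iUnion hd hE]
  rw [← ENNReal.ofReal_one, ← hs.tsum_eq, ENNReal.ofReal_tsum_of_nonneg
    (fun _ => measureReal_nonneg)
    hs.summable]
  simp

lemma IsModel.ae_exists_gapEvent [IsProbabilityMeasure μ] (h : IsModel μ P p ν X B)
    (hp : ∀ m, 0 ≤ p m ∧ p m ≤ 1) (hn : ∃ k, P k = n) (hpn : p n < 1) (k : ℕ) :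
    ∀ᵐ ω ∂μ, ω ∈ ⋃ m, gapEvent P B n k m := by
  refine measure_iUnion_eq_one_of_hasSum (fun m => h.measurableSet_gapEvent hn k m)
    (disjoint_gapEvent k) ?_
  simp_rw [h.real_gapEvent hp hn]
  exact hasSum_geometric_weights (hp n).1 hpn

/-! ### Invariance under the shift by one period -/

lemma IsModel.map_received_eq [IsProbabilityMeasure μ] (h : IsModel μ P p ν X B) (i : ℕ) :
    μ.map (B (i + K)) = μ.map (B i) := by
  have hB := fun i => Measure.isProbabilityMeasure_map
    (h.measurable_received i).aemeasurable (μ := μ)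
  have htrue : (μ.map (B (i + K))) {true} = (μ.map (B i)) {true} := by
    rw [Measure.map_apply (h.measurable_received _) (measurableSet_singleton _),
      Measure.map_apply (h.measurable_received _) (measurableSet_singleton _)]
    have h1 := h.prob_received (i + K)
    rw [sched_add_period, ← h.prob_received i] at h1
    exact h1
  refine Measure.ext_of_singleton fun b => ?_
  cases b
  · have : ({false} : Set Bool) = {true}ᶜ := by ext b; cases b <;> simp
    rw [this, prob_compl_eq_one_sub (measurableSet_singleton _),
      prob_compl_eq_one_sub (measurableSet_singleton _), htrue]
  · exact htrue

/-- The path of all service times and drop events. -/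
def path (X : ℕ → Ω → ℝ) (B : ℕ → Ω → Bool) (ω : Ω) (i : ℕ) : ℝ × Bool := (X i ω, B i ω)

lemma IsModel.measurable_path (h : IsModel μ P p ν X B) : Measurable (path X B) :=
  measurable_pi_lambda _ fun i => (h.measurable_service i).prodMk (h.measurable_received i)

lemma IsModel.map_path [IsProbabilityMeasure μ] (h : IsModel μ P p ν X B) :
    μ.map (path X B) = Measure.infinitePi fun i => μ.map fun ω => (X i ω, B i ω) :=
  h.indep.map_fun_eq_infinitePi_map fun i =>
    (h.measurable_service i).prodMk (h.measurable_received i)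

lemma IsModel.map_slot_add_period [IsProbabilityMeasure μ] (h : IsModel μ P p ν X B) (i : ℕ) :
    (μ.map fun ω => (X (i + K) ω, B (i + K) ω)) = μ.map fun ω => (X i ω, B i ω) := by
  have hXB := fun i => (indepFun_iff_map_prod_eq_prod_map_map (h.measurable_service i).aemeasurable
    (h.measurable_received i).aemeasurable).1 (h.indep_slot i)
  rw [hXB, hXB, h.map_received_eq, h.map_service, h.map_service, sched_add_period]

/-- Both laws are infinite products. Reindexing along the injection `i ↦ i + K` keeps independence,
and the factors agree because the schedule has period `K`. -/
lemma IsModel.map_path_shift [IsProbabilityMeasure μ] (h : IsModel μ P p ν X B) :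
    (μ.map fun ω i => path X B ω (i + K)) = μ.map (path X B) := by
  rw [h.map_path]
  have h1 := (h.indep.precomp (g := fun i => i + K)
    (add_left_injective K)).map_fun_eq_infinitePi_map
    fun i => (h.measurable_service (i + K)).prodMk (h.measurable_received (i + K))
  simp_rw [h.map_slot_add_period] at h1
  exact h1

lemma IsModel.map_gapTime_add_alpha [IsProbabilityMeasure μ] (h : IsModel μ P p ν X B)
    (hn : ∃ k, P k = n) (k m : ℕ) :
    μ.map (gapTime P X n (k + alpha P n) m) = μ.map (gapTime P X n k m) := by
  let f : (ℕ → ℝ × Bool) → ℝ := fun y => ∑ i ∈ Ioo (pos P n k) (pos P n (k + 1 + m)), (y i).1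
  have hf : Measurable f := Finset.measurable_fun_sum _ fun i _ =>
    measurable_fst.comp (measurable_pi_apply i)
  have h1 : gapTime P X n (k + alpha P n) m = f ∘ (fun ω i => path X B ω (i + K)) := by
    funext ω
    simp only [gapTime, Ioo_pos_add_alpha hn, sum_map, f, path, Function.comp,
      addRightEmbedding_apply]
  have h2 : gapTime P X n k m = f ∘ path X B := rfl
  rw [h1, h2, ← Measure.map_map hf h.measurable_path, ← h.map_path_shift, Measure.map_map hf]
  exact measurable_pi_lambda _ fun i => (measurable_pi_apply (i + K)).comp h.measurable_path

end Probability

end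

end CyclicAoI

namespace CyclicAoI

noncomputable section

/-! ### Laws as mixtures -/

section Mixture

variable {Ω β ι : Type*} [MeasurableSpace Ω] [MeasurableSpace β] [Countable ι] {μ : Measure Ω}
  {E : ι → Set Ω} {Y : Ω → β} {Z : ι → Ω → β}

omit [MeasurableSpace β] [Countable ι] in
lemma ae_eq_restrict_of_eqOn (hE : ∀ i, MeasurableSet (E i)) (hY : ∀ i, ∀ ω ∈ E i, Y ω = Z i ω)
    (i : ι) : Y =ᵐ[μ.restrict (E i)] Z i :=
  (ae_restrict_iff' (hE i)).2 (Eventually.of_forall fun ω hω => hY i ω hω)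

lemma aemeasurable_restrict_iUnion (hE : ∀ i, MeasurableSet (E i)) (hZ : ∀ i, Measurable (Z i))
    (hY : ∀ i, ∀ ω ∈ E i, Y ω = Z i ω) : AEMeasurable Y (μ.restrict (⋃ i, E i)) :=
  aemeasurable_iUnion_iff.2 fun i =>
    (hZ i).aemeasurable.congr (ae_eq_restrict_of_eqOn hE hY i).symm

/-- No measurability of `Y` is assumed; it follows almost everywhere from that of the `Z i`. This
suits the gaps, which are defined through infima and `Nat.nth`, with junk values on a null set. -/
lemma map_restrict_iUnion (hE : ∀ i, MeasurableSet (E i))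
    (hd : Pairwise (Function.onFun Disjoint E)) (hZ : ∀ i, Measurable (Z i))
    (hY : ∀ i, ∀ ω ∈ E i, Y ω = Z i ω)
    (hind : ∀ i, ∀ A, MeasurableSet A → μ (E i ∩ Z i ⁻¹' A) = μ (E i) * μ (Z i ⁻¹' A)) :
    (μ.restrict (⋃ i, E i)).map Y = Measure.sum fun i => μ (E i) • μ.map (Z i) := by
  have hYm := aemeasurable_restrict_iUnion (μ := μ) hE hZ hY
  rw [Measure.restrict_iUnion hd hE] at hYm ⊢
  rw [Measure.map_sum hYm]
  congr 1
  funext i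
  rw [Measure.map_congr (ae_eq_restrict_of_eqOn hE hY i)]
  ext A hA
  rw [Measure.map_apply (hZ i) hA, Measure.restrict_apply (hZ i hA), Set.inter_comm, hind i A hA,
    Measure.smul_apply, Measure.map_apply (hZ i) hA, smul_eq_mul]

variable {c : ι → ℝ} {ρ : ι → Measure β} {f : β → ℝ}

lemma integrable_mixture (hc : ∀ i, 0 ≤ c i) (hf : ∀ i, Integrable f (ρ i))
    (hs : Summable fun i => c i * ∫ x, |f x| ∂ρ i) :
    Integrable f (Measure.sum fun i => ENNReal.ofReal (c i) • ρ i) := by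
  refine integrable_sum_measure (fun i => (hf i).smul_measure ENNReal.ofReal_ne_top) ?_
  simpa [integral_smul_measure, ENNReal.toReal_ofReal (hc _)] using hs

omit [Countable ι] in
lemma hasSum_integral_mixture (hc : ∀ i, 0 ≤ c i)
    (hf : Integrable f (Measure.sum fun i => ENNReal.ofReal (c i) • ρ i)) :
    HasSum (fun i => c i * ∫ x, f x ∂ρ i)
      (∫ x, f x ∂(Measure.sum fun i => ENNReal.ofReal (c i) • ρ i)) := by
  have := hasSum_integral_measure hf
  simpa [integral_smul_measure, ENNReal.toReal_ofReal (hc _)] using this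

end Mixture

/-! ### The law of a gap as a geometric mixture. -/

section GapLaw

variable {N K : ℕ} [NeZero K] {P : Fin K → Fin N} {n : Fin N} {Ω : Type*} [MeasurableSpace Ω]
  {μ : Measure Ω} [IsProbabilityMeasure μ] {p : Fin N → ℝ} {ν : Fin N → Measure ℝ}
  {X : ℕ → Ω → ℝ} {B : ℕ → Ω → Bool}

lemma IsModel.measure_inter_service (h : IsModel μ P p ν X B) {β : Type*} [MeasurableSpace β]
    {E : Set Ω} (hE : MeasurableSet[slotAlg X B (dropPart Set.univ)] E) {Z : Ω → β}
    (hZ : Measurable[slotAlg X B (servicePart Set.univ)] Z) {A : Set β} (hA : MeasurableSet A) :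
    μ (E ∩ Z ⁻¹' A) = μ E * μ (Z ⁻¹' A) :=
  (Indep_iff _ _ _).1 (h.indep_slotAlg (disjoint_servicePart_dropPart _ _).symm) E _ hE (hZ hA)

omit [MeasurableSpace Ω] in
lemma measurable_gapTime_slotAlg_univ (k m : ℕ) :
    Measurable[slotAlg X B (servicePart Set.univ)] (gapTime P X n k m) :=
  measurable_sum_service fun _ _ => Set.mem_univ _

/-- The event that the `k`-th appearance of source `n` is a success and that the next success is at
the `(k+1+m)`-th appearance. -/
def successGapEvent (P : Fin K → Fin N) (B : ℕ → Ω → Bool) (n : Fin N) (k m : ℕ) : Set Ω :=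
  {ω | B (pos P n k) ω = true} ∩ gapEvent P B n k m

omit [MeasurableSpace Ω] in
lemma measurableSet_successGapEvent_slotAlg (hn : ∃ k, P k = n) (k m : ℕ) :
    MeasurableSet[slotAlg X B (dropPart Set.univ)] (successGapEvent P B n k m) :=
  slotAlg_mono X B (dropPart_mono (Set.subset_univ _)) _
    (measurableSet_received_inter_gapEvent_slotAlg hn k m)

omit [IsProbabilityMeasure μ] in
lemma IsModel.measurableSet_successGapEvent (h : IsModel μ P p ν X B) (hn : ∃ k, P k = n)
    (k m : ℕ) : MeasurableSet (successGapEvent P B n k m) :=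
  h.slotAlg_le _ _ (measurableSet_successGapEvent_slotAlg hn k m)

omit [MeasurableSpace Ω] in
lemma disjoint_successGapEvent (k : ℕ) :
    Pairwise (Function.onFun Disjoint (successGapEvent (n := n) P B k)) := fun _ _ hm =>
  (disjoint_gapEvent k hm).mono Set.inter_subset_right Set.inter_subset_right

lemma IsModel.restrict_received (h : IsModel μ P p ν X B)
    (hp : ∀ m, 0 ≤ p m ∧ p m ≤ 1) (hn : ∃ k, P k = n) (hpn : p n < 1) (k : ℕ) :
    μ.restrict {ω | B (pos P n k) ω = true} = μ.restrict (⋃ m, successGapEvent P B n k m) := by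
  refine Measure.restrict_congr_set ?_
  filter_upwards [h.ae_exists_gapEvent hp hn hpn k] with ω hω
  apply propext
  change B (pos P n k) ω = true ↔ ω ∈ ⋃ m, successGapEvent P B n k m
  simp only [successGapEvent, ← Set.inter_iUnion]
  exact ⟨fun hb => ⟨hb, hω⟩, fun hb => hb.1⟩

lemma IsModel.aemeasurable_restrict_received (h : IsModel μ P p ν X B)
    (hp : ∀ m, 0 ≤ p m ∧ p m ≤ 1) (hn : ∃ k, P k = n) (hpn : p n < 1) (k : ℕ)
    {β : Type*} [MeasurableSpace β] {Y : Ω → β} {Z : ℕ → Ω → β} (hZ : ∀ m, Measurable (Z m))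
    (hY : ∀ m, ∀ ω ∈ successGapEvent P B n k m, Y ω = Z m ω) :
    AEMeasurable Y (μ.restrict {ω | B (pos P n k) ω = true}) := by
  rw [h.restrict_received hp hn hpn]
  exact aemeasurable_restrict_iUnion (h.measurableSet_successGapEvent hn k) hZ hY

lemma IsModel.map_restrict_received (h : IsModel μ P p ν X B)
    (hp : ∀ m, 0 ≤ p m ∧ p m ≤ 1) (hn : ∃ k, P k = n) (hpn : p n < 1) (k : ℕ)
    {β : Type*} [MeasurableSpace β] {Y : Ω → β} {Z : ℕ → Ω → β}
    (hZ : ∀ m, Measurable[slotAlg X B (servicePart Set.univ)] (Z m))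
    (hY : ∀ m, ∀ ω ∈ successGapEvent P B n k m, Y ω = Z m ω) :
    (μ.restrict {ω | B (pos P n k) ω = true}).map Y =
      Measure.sum fun m => ENNReal.ofReal ((1 - p n) * ((1 - p n) * p n ^ m)) • μ.map (Z m) := by
  have hprob : ∀ m, μ (successGapEvent P B n k m) =
      ENNReal.ofReal ((1 - p n) * ((1 - p n) * p n ^ m)) := fun m => by
    rw [← h.real_received_inter_gapEvent hp hn k m, ofReal_measureReal]
    rfl
  rw [h.restrict_received hp hn hpn, map_restrict_iUnion
    (h.measurableSet_successGapEvent hn k) (disjoint_successGapEvent k)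
    (fun m => (hZ m).mono (h.slotAlg_le _) le_rfl) hY
    fun m A hA => h.measure_inter_service (measurableSet_successGapEvent_slotAlg hn k m) (hZ m) hA]
  simp_rw [hprob]

/-- Conditioning on the position of the next success involves drop events only, so it does not
affect the service times being summed. All facts on MGFs and moments of the gaps are read off from
this mixture. -/
lemma IsModel.gapLaw_eq (h : IsModel μ P p ν X B)
    (hp : ∀ m, 0 ≤ p m ∧ p m ≤ 1) (hn : ∃ k, P k = n) (hpn : p n < 1) (k : ℕ) :
    gapLaw μ P X B n k = Measure.sum fun m =>
      ENNReal.ofReal ((1 - p n) * p n ^ m) • μ.map (gapTime P X n k m) := by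
  have hu : 0 < 1 - p n := by linarith
  rw [gapLaw, ProbabilityTheory.cond, Measure.map_smul, h.map_restrict_received hp hn hpn k
    (measurable_gapTime_slotAlg_univ k) (fun m ω hω => nextGap_eq_of_mem_gapEvent hn hω.2)]
  rw [← ofReal_measureReal, h.real_received hp hn]
  ext A hA
  simp only [Measure.smul_apply, Measure.sum_apply _ hA, smul_eq_mul, ← ENNReal.tsum_mul_left]
  congr 1
  funext m
  -- The restricted law carries two factors `1 - p n`, one for each success; the normalization of
  -- the conditional measure cancels the first.
  rw [ENNReal.ofReal_mul hu.le, ← mul_assoc, ← mul_assoc, ENNReal.inv_mul_cancel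
    (by simpa using hu) ENNReal.ofReal_ne_top, one_mul]

lemma IsModel.isProbabilityMeasure_map_gapTime (h : IsModel μ P p ν X B) (k m : ℕ) :
    IsProbabilityMeasure (μ.map (gapTime P X n k m)) :=
  Measure.isProbabilityMeasure_map (h.measurable_gapTime k m).aemeasurable

lemma IsModel.isProbabilityMeasure_gapLaw (h : IsModel μ P p ν X B)
    (hp : ∀ m, 0 ≤ p m ∧ p m ≤ 1) (hn : ∃ k, P k = n) (hpn : p n < 1) (k : ℕ) :
    IsProbabilityMeasure (gapLaw μ P X B n k) := by
  have hT := fun m => h.isProbabilityMeasure_map_gapTime (n := n) k m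
  constructor
  rw [h.gapLaw_eq hp hn hpn, Measure.sum_apply _ MeasurableSet.univ]
  simp only [Measure.smul_apply, measure_univ, smul_eq_mul, mul_one]
  have hs := hasSum_geometric_weights (hp n).1 hpn
  rw [← ENNReal.ofReal_tsum_of_nonneg _ hs.summable, hs.tsum_eq, ENNReal.ofReal_one]
  intro m
  have := (hp n).1
  have : 0 ≤ 1 - p n := by linarith
  positivity

lemma IsModel.gapLaw_add_alpha (h : IsModel μ P p ν X B)
    (hp : ∀ m, 0 ≤ p m ∧ p m ≤ 1) (hn : ∃ k, P k = n) (hpn : p n < 1) (k : ℕ) :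
    gapLaw μ P X B n (k + alpha P n) = gapLaw μ P X B n k := by
  simp_rw [h.gapLaw_eq hp hn hpn, h.map_gapTime_add_alpha hn]

lemma IsModel.integrable_gapLaw (h : IsModel μ P p ν X B)
    (hp : ∀ m, 0 ≤ p m ∧ p m ≤ 1) (hn : ∃ k, P k = n) (hpn : p n < 1) (k : ℕ)
    {f : ℝ → ℝ} (hfm : Measurable f) (hf : ∀ m, Integrable (fun ω => f (gapTime P X n k m ω)) μ)
    (hs : Summable fun m => (1 - p n) * p n ^ m * ∫ ω, |f (gapTime P X n k m ω)| ∂μ) :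
    Integrable f (gapLaw μ P X B n k) := by
  have hu : 0 < 1 - p n := by linarith
  rw [h.gapLaw_eq hp hn hpn]
  refine integrable_mixture (fun m => mul_nonneg hu.le (pow_nonneg (hp n).1 _)) (fun m => ?_) ?_
  · exact (integrable_map_measure hfm.aestronglyMeasurable
      (h.measurable_gapTime k m).aemeasurable).2 (hf m)
  · convert hs using 3 with m
    exact integral_map (h.measurable_gapTime k m).aemeasurable hfm.abs.aestronglyMeasurable

lemma IsModel.hasSum_integral_gapLaw (h : IsModel μ P p ν X B)
    (hp : ∀ m, 0 ≤ p m ∧ p m ≤ 1) (hn : ∃ k, P k = n) (hpn : p n < 1) (k : ℕ)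
    {f : ℝ → ℝ} (hfm : Measurable f) (hf : Integrable f (gapLaw μ P X B n k)) :
    HasSum (fun m => (1 - p n) * p n ^ m * ∫ ω, f (gapTime P X n k m ω) ∂μ)
      (∫ x, f x ∂gapLaw μ P X B n k) := by
  have hu : 0 < 1 - p n := by linarith
  rw [h.gapLaw_eq hp hn hpn] at hf ⊢
  have e : ∀ m, ∫ ω, f (gapTime P X n k m ω) ∂μ = ∫ x, f x ∂(μ.map (gapTime P X n k m)) := fun m =>
    (integral_map (h.measurable_gapTime k m).aemeasurable hfm.aestronglyMeasurable).symm
  simp_rw [e]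
  exact hasSum_integral_mixture (fun m => mul_nonneg hu.le (pow_nonneg (hp n).1 _)) hf

end GapLaw

end

end CyclicAoI

namespace CyclicAoI

noncomputable section

/-! ### The closed form of a periodic geometric-type recursion -/

section ClosedForm

variable {R : Type*} [CommRing R] {p g : R} {h w : ℕ → R} {α : ℕ}

lemma recursion_iterate (hw : ∀ k, w k = h k * ((1 - p) + p * g * w (k + 1))) (k m : ℕ) :
    w k = numer p g h m k + p ^ m * g ^ m * (∏ l ∈ Icc 1 m, h (k + l - 1)) * w (k + m) := by
  induction m with
  | zero => simp [numer]
  | succ m ih =>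
    rw [ih, numer, numer, sum_Icc_succ_top (by omega), prod_Icc_succ_top (by omega), hw (k + m)]
    simp only [Nat.add_sub_cancel, ← add_assoc]
    ring

lemma prod_Icc_sub_one (h : ℕ → R) (k m : ℕ) :
    ∏ l ∈ Icc 1 m, h (k + l - 1) = ∏ l ∈ range m, h (k + l) := by
  induction m with
  | zero => simp
  | succ m ih => rw [prod_Icc_succ_top (by omega), ih, prod_range_succ]; rfl

lemma prod_range_add_of_periodic (hα : 0 < α) (hh : ∀ i, h (i + α) = h i) (k : ℕ) :
    ∏ l ∈ range α, h (k + l) = ∏ l ∈ range α, h l := by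
  obtain ⟨β, rfl⟩ : ∃ β, α = β + 1 := ⟨α - 1, by omega⟩
  induction k with
  | zero => simp
  | succ k ih =>
    rw [← ih, prod_range_succ, prod_range_succ' (fun l => h (k + l))]
    congr 1
    · exact prod_congr rfl fun l _ => by congr 1; ring
    · rw [add_zero, ← hh k]; congr 1; ring

lemma prod_Icc_periodic (hα : 0 < α) (hh : ∀ i, h (i + α) = h i) (k : ℕ) :
    ∏ l ∈ Icc 1 α, h (k + l - 1) = ∏ m ∈ Icc 1 α, h (m - 1) := by
  have h0 := prod_Icc_sub_one h 0 α
  simp only [zero_add] at h0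
  rw [prod_Icc_sub_one, h0, prod_range_add_of_periodic hα hh]

/-- Iterating the recursion over a full period returns to `w k`, with the product of all the `h i`
in front, whatever the starting point. The product form is kept because the lemma is used both in
`ℝ` and in `ℝ[X] / (X ^ 3)`. -/
lemma denom_mul_eq_numer (hα : 0 < α) (hh : ∀ i, h (i + α) = h i) (hwα : ∀ i, w (i + α) = w i)
    (hw : ∀ k, w k = h k * ((1 - p) + p * g * w (k + 1))) (k : ℕ) :
    denom p g h α * w k = numer p g h α k := by
  have := recursion_iterate hw k α
  rw [hwα, prod_Icc_periodic hα hh] at this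
  rw [denom]
  linear_combination this

end ClosedForm

/-- Splitting off the first `α` terms gives `S N ≤ S (α + N) = S α + r * S N` for the partial sums,
hence the uniform bound `S α / (1 - r)`. -/
lemma summable_of_geometric_shift {c : ℕ → ℝ} {α : ℕ} {r : ℝ} (hc : ∀ i, 0 ≤ c i)
    (hr : r < 1) (h : ∀ i, c (i + α) = r * c i) : Summable c := by
  refine summable_of_sum_range_le (c := (∑ i ∈ range α, c i) / (1 - r)) hc fun N => ?_
  rw [le_div_iff₀ (by linarith)]
  have h1 : ∑ i ∈ range (α + N), c i = ∑ i ∈ range α, c i + r * ∑ i ∈ range N, c i := by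
    rw [sum_range_add, mul_sum]
    congr 1
    exact sum_congr rfl fun i _ => by rw [add_comm, h]
  have h2 : ∑ i ∈ range N, c i ≤ ∑ i ∈ range (α + N), c i :=
    sum_le_sum_of_subset_of_nonneg (range_mono (by omega)) fun i _ _ => hc i
  linarith

/-! ### Moment generating functions of the gaps -/

section MGF

variable {N K : ℕ} [NeZero K] {P : Fin K → Fin N} {n : Fin N} {Ω : Type*} [MeasurableSpace Ω]
  {μ : Measure Ω} [IsProbabilityMeasure μ] {p : Fin N → ℝ} {ν : Fin N → Measure ℝ}
  {X : ℕ → Ω → ℝ} {B : ℕ → Ω → Bool}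

omit [IsProbabilityMeasure μ] in
lemma IsModel.iIndepFun_service (h : IsModel μ P p ν X B) : iIndepFun X μ :=
  h.indep.comp (fun _ y => y.1) fun _ => measurable_fst

omit [IsProbabilityMeasure μ] in
lemma IsModel.mgf_service (h : IsModel μ P p ν X B) (i : ℕ) (z : ℝ) :
    mgf (X i) μ z = mgf id (ν (sched P i)) z := by
  rw [← h.map_service i, mgf_id_map (h.measurable_service i).aemeasurable]

omit [IsProbabilityMeasure μ] in
lemma IsModel.mgf_sum_service (h : IsModel μ P p ν X B) (s : Finset ℕ) (z : ℝ) :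
    mgf (fun ω => ∑ i ∈ s, X i ω) μ z = ∏ i ∈ s, mgf id (ν (sched P i)) z := by
  have := h.iIndepFun_service.mgf_sum (t := z) h.measurable_service s
  rw [show (fun ω => ∑ i ∈ s, X i ω) = ∑ i ∈ s, X i by ext; simp, this]
  exact prod_congr rfl fun i _ => h.mgf_service i z

omit [IsProbabilityMeasure μ] in
lemma IsModel.mem_integrableExpSet_service (h : IsModel μ P p ν X B) {i : ℕ} {z : ℝ}
    (hz : z ∈ integrableExpSet id (ν (sched P i))) : z ∈ integrableExpSet (X i) μ := by
  rw [← h.map_service i] at hz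
  exact (integrable_map_measure (by fun_prop) (h.measurable_service i).aemeasurable).1 hz

lemma IsModel.mem_integrableExpSet_sum_service (h : IsModel μ P p ν X B) (s : Finset ℕ) {z : ℝ}
    (hz : ∀ i ∈ s, z ∈ integrableExpSet id (ν (sched P i))) :
    z ∈ integrableExpSet (fun ω => ∑ i ∈ s, X i ω) μ := by
  have := h.iIndepFun_service.integrable_exp_mul_sum (t := z) h.measurable_service (s := s)
    fun i hi => h.mem_integrableExpSet_service (hz i hi)
  rw [show (fun ω => ∑ i ∈ s, X i ω) = ∑ i ∈ s, X i by ext; simp]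
  exact this

omit [IsProbabilityMeasure μ] in
-- The factors are grouped by source. No finiteness is required: the product formula for independent
-- variables is compatible with the value `0` of a divergent `mgf`.
lemma IsModel.mgf_subTime (h : IsModel μ P p ν X B) (hn : ∃ k, P k = n) (k : ℕ) (z : ℝ) :
    mgf (subTime P X n k) μ z = ∏ m ∈ univ.erase n, mgf id (ν m) z ^ alphaSub P n k m := by
  have h1 := h.mgf_sum_service (Ioo (pos P n k) (pos P n (k + 1))) z
  rw [show subTime P X n k = fun ω => ∑ i ∈ Ioo (pos P n k) (pos P n (k + 1)), X i ω from rfl, h1,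
    ← prod_fiberwise_of_maps_to (t := univ.erase n) (g := fun i => sched P i)]
  · refine prod_congr rfl fun m _ => ?_
    rw [alphaSub, ← prod_const]
    refine prod_congr rfl fun i hi => ?_
    rw [(mem_filter.1 hi).2]
  · intro i hi
    simpa using sched_ne_of_mem_Ioo hn hi

omit [IsProbabilityMeasure μ] in
lemma IsModel.mgf_gapTime (h : IsModel μ P p ν X B) (hn : ∃ k, P k = n) (k m : ℕ) (z : ℝ) :
    mgf (gapTime P X n k m) μ z =
      mgf id (ν n) z ^ m * ∏ l ∈ range (m + 1), mgf (subTime P X n (k + l)) μ z := by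
  induction m with
  | zero => simp [show gapTime P X n k 0 = subTime P X n k from rfl]
  | succ m ih =>
    have h1 : mgf (gapTime P X n k m) μ z =
        ∏ i ∈ Ioo (pos P n k) (pos P n (k + 1 + m)), mgf id (ν (sched P i)) z :=
      h.mgf_sum_service _ z
    have h2 : mgf (gapTime P X n k (m + 1)) μ z =
        ∏ i ∈ Ioo (pos P n k) (pos P n (k + 1 + (m + 1))), mgf id (ν (sched P i)) z :=
      h.mgf_sum_service _ z
    have h3 : mgf (subTime P X n (k + 1 + m)) μ z =
        ∏ i ∈ Ioo (pos P n (k + 1 + m)) (pos P n (k + 1 + m + 1)), mgf id (ν (sched P i)) z :=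
      h.mgf_sum_service _ z
    rw [h2, Ioo_pos_succ hn, prod_insert (by simp), prod_union, ← h1, ← h3, ih, sched_pos hn,
      prod_range_succ _ (m + 1), show k + (m + 1) = k + 1 + m by ring]
    · ring
    · rw [Finset.disjoint_left]; intro i; simp only [mem_Ioo]; omega

lemma IsModel.map_subTime_add_alpha (h : IsModel μ P p ν X B) (hn : ∃ k, P k = n) (k : ℕ) :
    μ.map (subTime P X n (k + alpha P n)) = μ.map (subTime P X n k) :=
  h.map_gapTime_add_alpha hn k 0

omit [IsProbabilityMeasure μ] in
lemma IsModel.measurable_subTime (h : IsModel μ P p ν X B) (k : ℕ) :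
    Measurable (subTime P X n k) := h.measurable_gapTime k 0

lemma IsModel.integral_subTime_add_alpha (h : IsModel μ P p ν X B) (hn : ∃ k, P k = n) (k : ℕ) :
    ∫ ω, subTime P X n (k + alpha P n) ω ∂μ = ∫ ω, subTime P X n k ω ∂μ := by
  have h1 := fun k => integral_map (μ := μ) (h.measurable_subTime (n := n) k).aemeasurable
    (f := fun x => x) (by fun_prop)
  rw [← h1, ← h1, h.map_subTime_add_alpha hn]

lemma IsModel.integral_subTime_sq_add_alpha (h : IsModel μ P p ν X B) (hn : ∃ k, P k = n)
    (k : ℕ) : ∫ ω, subTime P X n (k + alpha P n) ω ^ 2 ∂μ = ∫ ω, subTime P X n k ω ^ 2 ∂μ := by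
  have h1 := fun k => integral_map (μ := μ) (h.measurable_subTime (n := n) k).aemeasurable
    (f := fun x => x ^ 2) (by fun_prop)
  rw [← h1, ← h1, h.map_subTime_add_alpha hn]

lemma IsModel.mgf_subTime_add_alpha (h : IsModel μ P p ν X B) (hn : ∃ k, P k = n) (k : ℕ) (z : ℝ) :
    mgf (subTime P X n (k + alpha P n)) μ z = mgf (subTime P X n k) μ z := by
  rw [← mgf_id_map (h.measurable_subTime _).aemeasurable,
    ← mgf_id_map (h.measurable_subTime _).aemeasurable, h.map_subTime_add_alpha hn]

/-- The hypotheses on `z` under which the series for the MGFs of the gaps converge. -/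
structure IsConvergent (μ : Measure Ω) (P : Fin K → Fin N) (p : Fin N → ℝ) (ν : Fin N → Measure ℝ)
    (X : ℕ → Ω → ℝ) (n : Fin N) (z : ℝ) : Prop where
  integrable : ∀ i, z ∈ integrableExpSet id (ν (sched P i))
  lt_one : p n ^ alpha P n * mgf id (ν n) z ^ alpha P n *
    ∏ m ∈ Icc 1 (alpha P n), mgf (subTime P X n (m - 1)) μ z < 1

lemma IsModel.summable_mgf (h : IsModel μ P p ν X B)
    (hp : ∀ m, 0 ≤ p m ∧ p m ≤ 1) (hn : ∃ k, P k = n) {z : ℝ}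
    (hz : IsConvergent μ P p ν X n z) (k : ℕ) :
    Summable fun i : ℕ => p n ^ i * mgf id (ν n) z ^ i *
      ∏ l ∈ range (i + 1), mgf (subTime P X n (k + l)) μ z := by
  have hp0 := (hp n).1
  have hg : 0 ≤ mgf id (ν n) z := mgf_nonneg
  -- Raising the index by `alpha P n` multiplies a term by the quantity bounded in `hz.lt_one`,
  -- since a product of sub-pattern MGFs over one full period does not depend on where it starts.
  refine summable_of_geometric_shift (α := alpha P n) (fun i => ?_) hz.lt_one fun i => ?_
  · exact mul_nonneg (by positivity) (prod_nonneg fun _ _ => mgf_nonneg)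
  · rw [← prod_Icc_periodic (alpha_pos hn) (h := fun l => mgf (subTime P X n l) μ z)
      (fun l => h.mgf_subTime_add_alpha hn l z) (k + i + 1), prod_Icc_sub_one
      (fun l => mgf (subTime P X n l) μ z),
      show i + alpha P n + 1 = i + 1 + alpha P n by ring, prod_range_add]
    simp only [← add_assoc]
    rw [show (∏ x ∈ range (alpha P n), mgf (subTime P X n (k + i + 1 + x)) μ z) = _ from rfl]
    ring

lemma IsModel.integrable_exp_gapLaw (h : IsModel μ P p ν X B)
    (hp : ∀ m, 0 ≤ p m ∧ p m ≤ 1) (hn : ∃ k, P k = n) (hpn : p n < 1) {z : ℝ}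
    (hz : IsConvergent μ P p ν X n z) (k : ℕ) : z ∈ integrableExpSet id (gapLaw μ P X B n k) := by
  refine h.integrable_gapLaw hp hn hpn k (f := fun x => Real.exp (z * id x)) (by fun_prop)
    (fun m => ?_) ?_
  · have := h.mem_integrableExpSet_sum_service (Ioo (pos P n k) (pos P n (k + 1 + m)))
      fun i _ => hz.integrable i
    exact this
  have h1 : ∀ m, ∫ ω, |Real.exp (z * id (gapTime P X n k m ω))| ∂μ =
      mgf (gapTime P X n k m) μ z := fun m => by simp [mgf]
  simp_rw [h1, h.mgf_gapTime hn]
  refine ((h.summable_mgf hp hn hz k).mul_left (1 - p n)).congr fun m => ?_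
  ring

lemma IsModel.hasSum_mgf_gapLaw (h : IsModel μ P p ν X B)
    (hp : ∀ m, 0 ≤ p m ∧ p m ≤ 1) (hn : ∃ k, P k = n) (hpn : p n < 1) {z : ℝ}
    (hz : IsConvergent μ P p ν X n z) (k : ℕ) :
    HasSum (fun i : ℕ => (1 - p n) * (p n ^ i * mgf id (ν n) z ^ i *
      ∏ l ∈ range (i + 1), mgf (subTime P X n (k + l)) μ z)) (mgf id (gapLaw μ P X B n k) z) := by
  have h0 := h.hasSum_integral_gapLaw hp hn hpn k (f := fun x => Real.exp (z * id x)) (by fun_prop)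
    (h.integrable_exp_gapLaw hp hn hpn hz k)
  have h1 : ∀ m, ∫ ω, Real.exp (z * id (gapTime P X n k m ω)) ∂μ =
      mgf (gapTime P X n k m) μ z := fun m => by simp [mgf]
  simp_rw [h1, h.mgf_gapTime hn] at h0
  convert h0 using 1
  · funext m
    ring
  · rfl

/-- After the `k`-th sub-pattern the attempt either succeeds, or costs one service time of source
`n` and restarts the search from appearance `k + 1`. On the series this is splitting off the term of
index `0`. -/
lemma IsModel.mgf_gapLaw_recursion (h : IsModel μ P p ν X B)
    (hp : ∀ m, 0 ≤ p m ∧ p m ≤ 1) (hn : ∃ k, P k = n) (hpn : p n < 1) {z : ℝ}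
    (hz : IsConvergent μ P p ν X n z) (k : ℕ) :
    mgf id (gapLaw μ P X B n k) z = mgf (subTime P X n k) μ z *
      ((1 - p n) + p n * mgf id (ν n) z * mgf id (gapLaw μ P X B n (k + 1)) z) := by
  have h0 := h.hasSum_mgf_gapLaw hp hn hpn hz k
  have h1 := (h.hasSum_mgf_gapLaw hp hn hpn hz (k + 1)).mul_left
    (mgf (subTime P X n k) μ z * (p n * mgf id (ν n) z))
  rw [← hasSum_nat_add_iff' 1] at h0
  have h2 : ∀ i, (1 - p n) * (p n ^ (i + 1) * mgf id (ν n) z ^ (i + 1) *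
      ∏ l ∈ range (i + 1 + 1), mgf (subTime P X n (k + l)) μ z) =
      mgf (subTime P X n k) μ z * (p n * mgf id (ν n) z) *
        ((1 - p n) * (p n ^ i * mgf id (ν n) z ^ i *
          ∏ l ∈ range (i + 1), mgf (subTime P X n (k + 1 + l)) μ z)) := fun i => by
    have e : ∏ l ∈ range (i + 1), mgf (subTime P X n (k + (l + 1))) μ z =
        ∏ l ∈ range (i + 1), mgf (subTime P X n (k + 1 + l)) μ z :=
      prod_congr rfl fun l _ => by rw [show k + (l + 1) = k + 1 + l by ring]
    rw [prod_range_succ', e, add_zero]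
    ring
  simp_rw [h2] at h0
  have := h0.unique h1
  simp only [range_one, sum_singleton, pow_zero, one_mul, zero_add, prod_singleton,
    add_zero] at this
  linear_combination this

lemma IsModel.mgf_gapLaw_eq_div (h : IsModel μ P p ν X B)
    (hp : ∀ m, 0 ≤ p m ∧ p m ≤ 1) (hn : ∃ k, P k = n) (hpn : p n < 1) {z : ℝ}
    (hz : IsConvergent μ P p ν X n z) (k : ℕ) :
    mgf id (gapLaw μ P X B n k) z =
      numer (p n) (mgf id (ν n) z) (fun i => mgf (subTime P X n i) μ z) (alpha P n) k /
      denom (p n) (mgf id (ν n) z) (fun i => mgf (subTime P X n i) μ z) (alpha P n) := by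
  have hd : denom (p n) (mgf id (ν n) z) (fun i => mgf (subTime P X n i) μ z) (alpha P n) ≠ 0 :=
    (sub_pos.2 hz.lt_one).ne'
  rw [eq_div_iff hd, mul_comm]
  exact denom_mul_eq_numer (w := fun k => mgf id (gapLaw μ P X B n k) z) (alpha_pos hn)
    (fun i => h.mgf_subTime_add_alpha hn i z)
    (fun i => by simp only [h.gapLaw_add_alpha hp hn hpn i]) (h.mgf_gapLaw_recursion hp hn hpn hz) k

end MGF

end

end CyclicAoI

namespace CyclicAoI

noncomputable section

/-! ### Moments of the gaps -/

section Moments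

variable {N K : ℕ} [NeZero K] {P : Fin K → Fin N} {n : Fin N} {Ω : Type*} [MeasurableSpace Ω]
  {μ : Measure Ω} [IsProbabilityMeasure μ] {p : Fin N → ℝ} {ν : Fin N → Measure ℝ}
  {X : ℕ → Ω → ℝ} {B : ℕ → Ω → Bool}

omit [IsProbabilityMeasure μ] in
lemma IsModel.memLp_service (h : IsModel μ P p ν X B)
    (hν : ∀ m, MemLp (fun x : ℝ => x) 2 (ν m)) (i : ℕ) : MemLp (X i) 2 μ := by
  have := hν (sched P i)
  rw [← h.map_service i] at this
  exact (memLp_map_measure_iff this.1 (h.measurable_service i).aemeasurable).1 this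

omit [IsProbabilityMeasure μ] in
lemma IsModel.integral_service (h : IsModel μ P p ν X B) (i : ℕ) :
    ∫ ω, X i ω ∂μ = mean (ν (sched P i)) := by
  rw [mean, ← h.map_service i]
  exact (integral_map (h.measurable_service i).aemeasurable (f := fun x => x) (by fun_prop)).symm

omit [IsProbabilityMeasure μ] in
lemma IsModel.integral_service_sq (h : IsModel μ P p ν X B) (i : ℕ) :
    ∫ ω, X i ω ^ 2 ∂μ = secondMoment (ν (sched P i)) := by
  rw [secondMoment, ← h.map_service i]
  exact (integral_map (h.measurable_service i).aemeasurable (f := fun x => x ^ 2)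
    (by fun_prop)).symm

omit [IsProbabilityMeasure μ] in
lemma IsModel.memLp_gapTime (h : IsModel μ P p ν X B)
    (hν : ∀ m, MemLp (fun x : ℝ => x) 2 (ν m)) (k m : ℕ) : MemLp (gapTime P X n k m) 2 μ :=
  memLp_finsetSum _ fun i _ => h.memLp_service hν i

/-- Each pattern contains at least one appearance, so `m` further appearances need at most `m`
patterns. -/
lemma pos_add_le (hn : ∃ k, P k = n) (k m : ℕ) : pos P n (k + m) ≤ pos P n k + m * K := by
  rw [← pos_add_mul_alpha hn]
  refine (pos_strictMono hn).monotone ?_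
  have := Nat.mul_le_mul_left m (alpha_pos hn)
  omega

lemma card_Ioo_pos_le (hn : ∃ k, P k = n) (k m : ℕ) :
    ((Ioo (pos P n k) (pos P n (k + 1 + m))).card : ℝ) ≤ K * (m + 1) := by
  have h1 := pos_add_le hn k (m + 1)
  rw [show k + (m + 1) = k + 1 + m by ring] at h1
  have h2 : (Ioo (pos P n k) (pos P n (k + 1 + m))).card ≤ K * (m + 1) := by
    rw [Nat.card_Ioo, mul_comm K]; omega
  exact_mod_cast h2

omit [IsProbabilityMeasure μ] in
-- A gap with `m` failures has at most `K * (m + 1)` slots, so Cauchy–Schwarz bounds its second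
-- moment by a quadratic in `m`, uniformly in `k`. The geometric weights absorb such growth.
lemma IsModel.exists_integral_sq_le (h : IsModel μ P p ν X B)
    (hν : ∀ m, MemLp (fun x : ℝ => x) 2 (ν m)) (hn : ∃ k, P k = n) :
    ∃ C : ℝ, ∀ k m : ℕ, ∫ ω, gapTime P X n k m ω ^ 2 ∂μ ≤ C * ((m : ℝ) + 1) ^ 2 := by
  set Q : ℝ := ∑ m, secondMoment (ν m) with hQ
  have hq0 : ∀ m, 0 ≤ secondMoment (ν m) := fun m => integral_nonneg fun x => sq_nonneg x
  have hQ0 : 0 ≤ Q := sum_nonneg fun m _ => hq0 m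
  -- One factor `K` comes from the cardinality in Cauchy–Schwarz, the other from the number of
  -- summands; `Q` bounds every second moment of a service time.
  refine ⟨K * K * Q, fun k m => ?_⟩
  set s := Ioo (pos P n k) (pos P n (k + 1 + m)) with hs
  have hcard : (s.card : ℝ) ≤ K * (m + 1) := card_Ioo_pos_le hn k m
  have hint : ∀ i, Integrable (fun ω => X i ω ^ 2) μ :=
    fun i => (h.memLp_service hν i).integrable_sq
  have h1 : ∫ ω, gapTime P X n k m ω ^ 2 ∂μ ≤ ∫ ω, (s.card : ℝ) * ∑ i ∈ s, X i ω ^ 2 ∂μ := by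
    refine integral_mono (h.memLp_gapTime hν k m).integrable_sq
      ?_ fun ω => sq_sum_le_card_mul_sum_sq
    exact (integrable_finsetSum _ fun i _ => hint i).const_mul _
  have h2 : ∫ ω, (s.card : ℝ) * ∑ i ∈ s, X i ω ^ 2 ∂μ =
      s.card * ∑ i ∈ s, secondMoment (ν (sched P i)) := by
    rw [integral_const_mul, integral_finsetSum _ fun i _ => hint i]
    simp_rw [h.integral_service_sq]
  have h3 : ∑ i ∈ s, secondMoment (ν (sched P i)) ≤ s.card * Q := by
    rw [← nsmul_eq_mul]
    exact sum_le_card_nsmul _ _ _ fun i _ =>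
      single_le_sum (f := fun m => secondMoment (ν m)) (fun m _ => hq0 m) (mem_univ _)
  calc _ ≤ (s.card : ℝ) * (s.card * Q) := by
        rw [h2] at h1; exact h1.trans (mul_le_mul_of_nonneg_left h3 (by positivity))
    _ ≤ (K * (m + 1)) * ((K * (m + 1)) * Q) := by gcongr
    _ = _ := by ring

lemma summable_weights_mul_sq {p : ℝ} (h0 : 0 ≤ p) (h1 : p < 1) (C : ℝ) :
    Summable fun m : ℕ => (1 - p) * p ^ m * (C * ((m : ℝ) + 1) ^ 2) := by
  have hnorm : ‖p‖ < 1 := by rwa [Real.norm_of_nonneg h0]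
  have s0 := summable_geometric_of_norm_lt_one hnorm
  have s1 := summable_pow_mul_geometric_of_norm_lt_one 1 hnorm
  have s2 := summable_pow_mul_geometric_of_norm_lt_one 2 hnorm
  refine (((s0.add (s1.mul_left 2)).add s2).mul_left ((1 - p) * C)).congr fun m => ?_
  ring

lemma IsModel.integrable_gapLaw_of_le (h : IsModel μ P p ν X B)
    (hp : ∀ m, 0 ≤ p m ∧ p m ≤ 1) (hn : ∃ k, P k = n) (hpn : p n < 1)
    (hν : ∀ m, MemLp (fun x : ℝ => x) 2 (ν m)) (k : ℕ)
    {f : ℝ → ℝ} (hf : Measurable f) (hfle : ∀ x, |f x| ≤ 1 + x ^ 2) :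
    Integrable f (gapLaw μ P X B n k) := by
  obtain ⟨C, hC⟩ := h.exists_integral_sq_le hν hn
  have hint : ∀ m, Integrable (fun ω => 1 + gapTime P X n k m ω ^ 2) μ := fun m =>
    (integrable_const _).add (h.memLp_gapTime hν k m).integrable_sq
  have hintf : ∀ m, Integrable (fun ω => f (gapTime P X n k m ω)) μ := fun m =>
    (hint m).mono' (hf.comp (h.measurable_gapTime k m)).aestronglyMeasurable
      (Eventually.of_forall fun ω => hfle _)
  have hu : 0 ≤ 1 - p n := by linarith
  refine h.integrable_gapLaw hp hn hpn k hf hintf ?_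
  refine Summable.of_nonneg_of_le (fun m => ?_) (fun m => ?_)
    (summable_weights_mul_sq (hp n).1 hpn (1 + C))
  · exact mul_nonneg (mul_nonneg hu (pow_nonneg (hp n).1 _)) (integral_nonneg fun _ => abs_nonneg _)
  · refine mul_le_mul_of_nonneg_left ?_ (mul_nonneg hu (pow_nonneg (hp n).1 _))
    calc ∫ ω, |f (gapTime P X n k m ω)| ∂μ ≤ ∫ ω, (1 + gapTime P X n k m ω ^ 2) ∂μ :=
          integral_mono (hintf m).abs (hint m) fun ω => hfle _
      _ = 1 + ∫ ω, gapTime P X n k m ω ^ 2 ∂μ := by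
          rw [integral_add (integrable_const _) (h.memLp_gapTime hν k m).integrable_sq]; simp
      _ ≤ (1 + C) * ((m : ℝ) + 1) ^ 2 := by
          have : (1 : ℝ) ≤ ((m : ℝ) + 1) ^ 2 := by
            have : (0 : ℝ) ≤ m := by positivity
            nlinarith
          linarith [hC k m]

lemma integrable_id_gapLaw (h : IsModel μ P p ν X B)
    (hp : ∀ m, 0 ≤ p m ∧ p m ≤ 1) (hn : ∃ k, P k = n) (hpn : p n < 1)
    (hν : ∀ m, MemLp (fun x : ℝ => x) 2 (ν m)) (k : ℕ) :
    Integrable (fun x => x) (gapLaw μ P X B n k) :=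
  h.integrable_gapLaw_of_le hp hn hpn hν k measurable_id fun x => by
    rw [abs_le]; constructor <;> nlinarith [sq_nonneg (x - 1), sq_nonneg (x + 1)]

lemma integrable_sq_gapLaw (h : IsModel μ P p ν X B)
    (hp : ∀ m, 0 ≤ p m ∧ p m ≤ 1) (hn : ∃ k, P k = n) (hpn : p n < 1)
    (hν : ∀ m, MemLp (fun x : ℝ => x) 2 (ν m)) (k : ℕ) :
    Integrable (fun x => x ^ 2) (gapLaw μ P X B n k) :=
  h.integrable_gapLaw_of_le hp hn hpn hν k (by fun_prop) fun x => by
    rw [abs_of_nonneg (sq_nonneg x)]; linarith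

omit [MeasurableSpace Ω] in
-- Unlike `gapTime_succ`, this peels off the front of the gap, which is what relates appearance `k`
-- to appearance `k + 1`.
lemma gapTime_succ' (hn : ∃ k, P k = n) (k m : ℕ) (ω : Ω) :
    gapTime P X n k (m + 1) ω = subTime P X n k ω + X (pos P n (k + 1)) ω
      + gapTime P X n (k + 1) m ω := by
  induction m with
  | zero => rw [gapTime_succ hn]; rfl
  | succ m ih =>
    rw [gapTime_succ hn, ih, gapTime_succ hn]
    simp only [show k + 1 + (m + 1) = k + 1 + 1 + m by ring]
    ring

lemma IsModel.indepFun_service (h : IsModel μ P p ν X B) {S T : Set ℕ} (hST : Disjoint S T)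
    {f g : Ω → ℝ} (hf : Measurable[slotAlg X B (servicePart S)] f)
    (hg : Measurable[slotAlg X B (servicePart T)] g) : IndepFun f g μ :=
  h.indepFun (disjoint_servicePart hST) hf hg

omit [IsProbabilityMeasure μ] in
lemma integral_add_sq_of_indepFun {U V : Ω → ℝ} (hU : MemLp U 2 μ) (hV : MemLp V 2 μ)
    (hUV : IndepFun U V μ) : ∫ ω, (U ω + V ω) ^ 2 ∂μ =
      ∫ ω, U ω ^ 2 ∂μ + 2 * (∫ ω, U ω ∂μ) * (∫ ω, V ω ∂μ) + ∫ ω, V ω ^ 2 ∂μ := by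
  have hi : Integrable (fun ω => U ω * V ω) μ := hU.integrable_mul hV
  have h1 : ∀ ω, (U ω + V ω) ^ 2 = U ω ^ 2 + 2 * (U ω * V ω) + V ω ^ 2 := fun ω => by ring
  simp_rw [h1]
  have h2 : Integrable (fun ω => U ω ^ 2 + 2 * (U ω * V ω)) μ :=
    hU.integrable_sq.add (hi.const_mul 2)
  rw [integral_add h2 hV.integrable_sq, integral_add hU.integrable_sq (hi.const_mul 2),
    integral_const_mul, hUV.integral_fun_mul_eq_mul_integral hU.1 hV.1]
  ring

lemma IsModel.integral_gapTime_succ (h : IsModel μ P p ν X B)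
    (hν : ∀ m, MemLp (fun x : ℝ => x) 2 (ν m)) (hn : ∃ k, P k = n) (k m : ℕ) :
    ∫ ω, gapTime P X n k (m + 1) ω ∂μ =
      ∫ ω, subTime P X n k ω ∂μ + mean (ν n) + ∫ ω, gapTime P X n (k + 1) m ω ∂μ := by
  have hi : ∀ {f : Ω → ℝ}, MemLp f 2 μ → Integrable f μ := fun hf => hf.integrable one_le_two
  have h1 : Integrable (subTime P X n k) μ := hi (h.memLp_gapTime (n := n) hν k 0)
  have h2 := hi (h.memLp_service hν (pos P n (k + 1)))
  have h3 := hi (h.memLp_gapTime (n := n) hν (k + 1) m)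
  simp_rw [gapTime_succ' hn]
  have h12 : Integrable (fun ω => subTime P X n k ω + X (pos P n (k + 1)) ω) μ := h1.add h2
  rw [integral_add h12 h3, integral_add h1 h2, h.integral_service, sched_pos hn]

lemma IsModel.integral_gapTime_succ_sq (h : IsModel μ P p ν X B)
    (hν : ∀ m, MemLp (fun x : ℝ => x) 2 (ν m)) (hn : ∃ k, P k = n) (k m : ℕ) :
    ∫ ω, gapTime P X n k (m + 1) ω ^ 2 ∂μ =
      ∫ ω, subTime P X n k ω ^ 2 ∂μ + secondMoment (ν n) + ∫ ω, gapTime P X n (k + 1) m ω ^ 2 ∂μ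
      + 2 * ((∫ ω, subTime P X n k ω ∂μ) * mean (ν n) +
        (∫ ω, subTime P X n k ω ∂μ + mean (ν n)) * ∫ ω, gapTime P X n (k + 1) m ω ∂μ) := by
  have hi : ∀ {f : Ω → ℝ}, MemLp f 2 μ → Integrable f μ := fun hf => hf.integrable one_le_two
  have h1 : MemLp (subTime P X n k) 2 μ := h.memLp_gapTime (n := n) hν k 0
  have h2 := h.memLp_service hν (pos P n (k + 1))
  have h3 := h.memLp_gapTime (n := n) hν (k + 1) m
  have hlt := pos_strictMono hn (Nat.lt_succ_self k)
  have m1 : Measurable[slotAlg X B (servicePart (Set.Iio (pos P n (k + 1))))] (subTime P X n k) :=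
    measurable_sum_service fun i hi => (mem_Ioo.1 hi).2
  have m1' : Measurable[slotAlg X B (servicePart (Set.Iic (pos P n (k + 1))))] (subTime P X n k) :=
    measurable_sum_service fun i hi => (mem_Ioo.1 hi).2.le
  have m2 : Measurable[slotAlg X B (servicePart {pos P n (k + 1)})] (X (pos P n (k + 1))) :=
    measurable_service_slotAlg (mem_servicePart (Set.mem_singleton _))
  have m2' : Measurable[slotAlg X B (servicePart (Set.Iic (pos P n (k + 1))))]
      (X (pos P n (k + 1))) :=
    measurable_service_slotAlg (mem_servicePart (Set.mem_Iic.2 le_rfl))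
  have m3 : Measurable[slotAlg X B (servicePart (Set.Ioi (pos P n (k + 1))))]
      (gapTime P X n (k + 1) m) :=
    measurable_sum_service fun i hi => (mem_Ioo.1 hi).1
  have i12 : IndepFun (subTime P X n k) (X (pos P n (k + 1))) μ :=
    h.indepFun_service (by simp) m1 m2
  have i3 : IndepFun (fun ω => subTime P X n k ω + X (pos P n (k + 1)) ω)
      (gapTime P X n (k + 1) m) μ :=
    h.indepFun_service
      (by rw [Set.disjoint_left]; intro x hx hx'; exact not_lt.2 (Set.mem_Iic.1 hx) hx')
      (m1'.add m2') m3
  simp_rw [gapTime_succ' hn]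
  have h12 : MemLp (fun ω => subTime P X n k ω + X (pos P n (k + 1)) ω) 2 μ := h1.add h2
  rw [integral_add_sq_of_indepFun h12 h3 i3, integral_add_sq_of_indepFun h1 h2 i12,
    h.integral_service_sq, sched_pos hn, integral_add (hi h1) (hi h2), h.integral_service,
    sched_pos hn]
  ring

lemma hasSum_of_eq {f g : ℕ → ℝ} {a : ℝ} (hf : HasSum f a) (e : ∀ m, g m = f m) : HasSum g a :=
  (funext e : g = f) ▸ hf

lemma IsModel.mean_gapLaw (h : IsModel μ P p ν X B)
    (hp : ∀ m, 0 ≤ p m ∧ p m ≤ 1) (hn : ∃ k, P k = n) (hpn : p n < 1)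
    (hν : ∀ m, MemLp (fun x : ℝ => x) 2 (ν m)) (k : ℕ) :
    mean (gapLaw μ P X B n k) = ∫ ω, subTime P X n k ω ∂μ +
      p n * (mean (ν n) + mean (gapLaw μ P X B n (k + 1))) := by
  have hs : ∀ k, HasSum (fun m => (1 - p n) * p n ^ m * ∫ ω, gapTime P X n k m ω ∂μ)
      (mean (gapLaw μ P X B n k)) := fun k =>
    h.hasSum_integral_gapLaw hp hn hpn k (f := fun x => x) measurable_id
      (integrable_id_gapLaw h hp hn hpn hν k)
  have h0 := hs k
  rw [← hasSum_nat_add_iff' 1] at h0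
  have h1 := ((hasSum_geometric_weights (hp n).1 hpn).mul_left
    (p n * (∫ ω, subTime P X n k ω ∂μ + mean (ν n)))).add ((hs (k + 1)).mul_left (p n))
  have h2 := (hasSum_of_eq h0 fun m => by rw [h.integral_gapTime_succ hν hn]; ring).unique h1
  simp only [range_one, sum_singleton, pow_zero] at h2
  rw [show gapTime P X n k 0 = subTime P X n k from rfl] at h2
  linear_combination h2

/-- Expanding the square of front sub-pattern, failed service and remaining gap, three independent
terms, leaves only products of means as cross terms. With `IsModel.mean_gapLaw` it is the second
order part of the MGF recursion, obtained from finite second moments alone. -/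
lemma IsModel.secondMoment_gapLaw (h : IsModel μ P p ν X B)
    (hp : ∀ m, 0 ≤ p m ∧ p m ≤ 1) (hn : ∃ k, P k = n) (hpn : p n < 1)
    (hν : ∀ m, MemLp (fun x : ℝ => x) 2 (ν m)) (k : ℕ) :
    secondMoment (gapLaw μ P X B n k) = ∫ ω, subTime P X n k ω ^ 2 ∂μ +
      p n * (secondMoment (ν n) + secondMoment (gapLaw μ P X B n (k + 1)) +
        2 * ((∫ ω, subTime P X n k ω ∂μ) * mean (ν n) +
          (∫ ω, subTime P X n k ω ∂μ + mean (ν n)) * mean (gapLaw μ P X B n (k + 1)))) := by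
  have hs : ∀ k, HasSum (fun m => (1 - p n) * p n ^ m * ∫ ω, gapTime P X n k m ω ∂μ)
      (mean (gapLaw μ P X B n k)) := fun k =>
    h.hasSum_integral_gapLaw hp hn hpn k (f := fun x => x) measurable_id
      (integrable_id_gapLaw h hp hn hpn hν k)
  have hs2 : ∀ k, HasSum (fun m => (1 - p n) * p n ^ m * ∫ ω, gapTime P X n k m ω ^ 2 ∂μ)
      (secondMoment (gapLaw μ P X B n k)) := fun k =>
    h.hasSum_integral_gapLaw hp hn hpn k (f := fun x => x ^ 2) (by fun_prop)
      (integrable_sq_gapLaw h hp hn hpn hν k)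
  have h0 := hs2 k
  rw [← hasSum_nat_add_iff' 1] at h0
  have h1 := (((hasSum_geometric_weights (hp n).1 hpn).mul_left
    (p n * (∫ ω, subTime P X n k ω ^ 2 ∂μ + secondMoment (ν n) +
      2 * (∫ ω, subTime P X n k ω ∂μ) * mean (ν n)))).add ((hs2 (k + 1)).mul_left (p n))).add
    ((hs (k + 1)).mul_left (p n * (2 * (∫ ω, subTime P X n k ω ∂μ + mean (ν n)))))
  have h2 := (hasSum_of_eq h0 fun m => by rw [h.integral_gapTime_succ_sq hν hn]; ring).unique h1
  simp only [range_one, sum_singleton, pow_zero] at h2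
  rw [show gapTime P X n k 0 = subTime P X n k from rfl] at h2
  linear_combination h2

end Moments

/-! ### Moments as coefficients modulo `X ^ 3` -/

section Truncation

lemma coeff_zero_truncMGF (a b : ℝ) : (truncMGF a b).coeff 0 = 1 := by simp [truncMGF]

lemma coeff_one_truncMGF (a b : ℝ) : (truncMGF a b).coeff 1 = a := by
  simp [truncMGF, coeff_one, coeff_X_pow]

lemma coeff_two_truncMGF (a b : ℝ) : (truncMGF a b).coeff 2 = b / 2 := by
  simp [truncMGF, coeff_one]

lemma map_numer {R S : Type*} [CommRing R] [CommRing S] (φ : R →+* S) (p g : R) (h : ℕ → R)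
    (α k : ℕ) : φ (numer p g h α k) = numer (φ p) (φ g) (fun i => φ (h i)) α k := by
  simp [numer, map_sum, map_prod]

lemma map_denom {R S : Type*} [CommRing R] [CommRing S] (φ : R →+* S) (p g : R) (h : ℕ → R)
    (α : ℕ) : φ (denom p g h α) = denom (φ p) (φ g) (fun i => φ (h i)) α := by
  simp [denom, map_prod]

variable {p s q : ℝ} {sSub qSub w₁ w₂ : ℕ → ℝ} {α : ℕ}

/-- The hypotheses `ha` and `hb` are exactly the equality of the coefficients of degree `1` and `2`;
`hb` enters halved because `truncMGF` stores half the second moment. -/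
lemma X_pow_three_dvd_truncMGF_sub (p s q a b a' b' w w' : ℝ) (ha : a = w + p * (s + a'))
    (hb : b = w' + p * (q + b' + 2 * (w * s + (w + s) * a'))) :
    (X : ℝ[X]) ^ 3 ∣ truncMGF a b -
      truncMGF w w' * ((1 - C p) + C p * truncMGF s q * truncMGF a' b') := by
  rw [X_pow_dvd_iff]
  intro d hd
  interval_cases d
  · simp [truncMGF, mul_coeff_zero]
  · rw [coeff_sub, mul_assoc (C p), coeff_mul, Nat.antidiagonal_succ]
    simp [coeff_zero_truncMGF, coeff_one_truncMGF, coeff_mul,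
      Nat.antidiagonal_succ, coeff_one, coeff_C]
    linear_combination ha
  · rw [coeff_sub, mul_assoc (C p), coeff_mul, Nat.antidiagonal_succ]
    simp [coeff_zero_truncMGF, coeff_one_truncMGF, coeff_two_truncMGF, coeff_mul,
      Nat.antidiagonal_succ, coeff_one, coeff_C]
    linear_combination hb / 2

lemma coeff_zero_denomPoly : (denomPoly p s q sSub qSub α).coeff 0 = 1 - p ^ α := by
  rw [coeff_zero_eq_eval_zero, denomPoly, ← coe_evalRingHom, map_denom]
  simp [denom, truncMGF]

lemma coeff_zero_numerPoly (k : ℕ) : (numerPoly p s q sSub qSub α k).coeff 0 = 1 - p ^ α := by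
  rw [coeff_zero_eq_eval_zero, numerPoly, ← coe_evalRingHom, map_numer]
  simp only [numer, truncMGF, coe_evalRingHom, eval_C, eval_add, eval_one, eval_mul, eval_X,
    eval_pow, mul_zero, add_zero, one_pow, mul_one, prod_const_one, ne_eq, OfNat.ofNat_ne_zero,
    not_false_eq_true, zero_pow]
  induction α with
  | zero => simp
  | succ α ih => rw [sum_Icc_succ_top (by omega), mul_add, ih, Nat.add_sub_cancel]; ring

/-- In `ℝ[X] / (X ^ 3)` the truncated MGFs satisfy the recursion exactly, so `denom_mul_eq_numer`
applies there and no exponential moments are needed. -/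
lemma X_pow_three_dvd_denomPoly_mul_sub (hα : 0 < α) (hs : ∀ i, sSub (i + α) = sSub i)
    (hq : ∀ i, qSub (i + α) = qSub i) (hw₁ : ∀ i, w₁ (i + α) = w₁ i) (hw₂ : ∀ i, w₂ (i + α) = w₂ i)
    (h₁ : ∀ k, w₁ k = sSub k + p * (s + w₁ (k + 1)))
    (h₂ : ∀ k, w₂ k = qSub k + p * (q + w₂ (k + 1) +
      2 * (sSub k * s + (sSub k + s) * w₁ (k + 1)))) (k : ℕ) :
    (X : ℝ[X]) ^ 3 ∣ denomPoly p s q sSub qSub α * truncMGF (w₁ k) (w₂ k)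
      - numerPoly p s q sSub qSub α k := by
  rw [← Ideal.mem_span_singleton, ← Ideal.Quotient.eq_zero_iff_mem, map_sub, sub_eq_zero, map_mul,
    denomPoly, numerPoly, map_denom, map_numer]
  refine denom_mul_eq_numer (w := fun k => Ideal.Quotient.mk _ (truncMGF (w₁ k) (w₂ k))) hα
    (fun i => by simp only [hs, hq]) (fun i => by simp only [hw₁, hw₂]) (fun k => ?_) k
  have := X_pow_three_dvd_truncMGF_sub p s q _ _ _ _ _ _ (h₁ k) (h₂ k)
  rw [← Ideal.mem_span_singleton, ← Ideal.Quotient.eq_zero_iff_mem, map_sub, sub_eq_zero] at this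
  rw [this]
  simp only [map_mul, map_add, map_sub, map_one]

lemma secondMoment_eq_of_recursion (hα : 0 < α) (hp0 : 0 ≤ p) (hp1 : p < 1)
    (hs : ∀ i, sSub (i + α) = sSub i)
    (hq : ∀ i, qSub (i + α) = qSub i) (hw₁ : ∀ i, w₁ (i + α) = w₁ i) (hw₂ : ∀ i, w₂ (i + α) = w₂ i)
    (h₁ : ∀ k, w₁ k = sSub k + p * (s + w₁ (k + 1)))
    (h₂ : ∀ k, w₂ k = qSub k + p * (q + w₂ (k + 1) +
      2 * (sSub k * s + (sSub k + s) * w₁ (k + 1)))) (k : ℕ)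
    {a b c d : ℝ} (ha : a = (numerPoly p s q sSub qSub α k).coeff 1)
    (hb : b = (numerPoly p s q sSub qSub α k).coeff 2)
    (hc : c = (denomPoly p s q sSub qSub α).coeff 1)
    (hd : d = (denomPoly p s q sSub qSub α).coeff 2) :
    w₂ k = 2 * c * (c - a) / (1 - p ^ α) ^ 2 + 2 * (b - d) / (1 - p ^ α) := by
  have hdvd := X_pow_three_dvd_denomPoly_mul_sub hα hs hq hw₁ hw₂ h₁ h₂ k
  rw [X_pow_dvd_iff] at hdvd
  have e1 := hdvd 1 (by norm_num)
  have e2 := hdvd 2 (by norm_num)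
  rw [coeff_sub, coeff_mul, ← ha] at e1
  rw [coeff_sub, coeff_mul, ← hb] at e2
  simp only [Nat.antidiagonal_succ, Nat.antidiagonal_zero, map_singleton,
    sum_cons, sum_singleton, Function.Embedding.prodMap, Function.Embedding.coeFn_mk, map_cons,
    Prod.map, Function.Embedding.refl_apply, coeff_zero_truncMGF, coeff_one_truncMGF,
    coeff_two_truncMGF, coeff_zero_denomPoly, Nat.succ_eq_add_one, zero_add, Nat.reduceAdd,
    ← hc, ← hd] at e1 e2
  have hne : 1 - p ^ α ≠ 0 := by
    have := pow_lt_one₀ hp0 hp1 hα.ne'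
    linarith
  field_simp
  -- With `D = 1 - p ^ α`, the coefficients say `D * w₁ + c = a` and `D * w₂ / 2 + c * w₁ + d = b`;
  -- this combination eliminates `w₁`.
  linear_combination 2 * (1 - p ^ α) * e2 - 2 * c * e1

lemma sum_range_succ_of_periodic {f : ℕ → ℝ} (hf : ∀ i, f (i + α) = f i) :
    ∑ k ∈ range α, f (k + 1) = ∑ k ∈ range α, f k := by
  have h1 := sum_range_succ f α
  rw [sum_range_succ'] at h1
  have h2 := hf 0
  rw [zero_add] at h2
  linarith

lemma sum_Icc_sub_one (f : ℕ → ℝ) : ∑ k ∈ Icc 1 α, f (k - 1) = ∑ k ∈ range α, f k := by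
  induction α with
  | zero => simp
  | succ m ih => rw [sum_Icc_succ_top (by omega), ih, sum_range_succ]; rfl

/-- Summed over one period, the shifted means have the same total as the unshifted ones, so the
recursion becomes a single linear equation for the average. -/
lemma average_eq_of_recursion (hα : 0 < α) (hp1 : p < 1)
    (hw₁ : ∀ i, w₁ (i + α) = w₁ i) (h₁ : ∀ k, w₁ k = sSub k + p * (s + w₁ (k + 1))) :
    1 / (α : ℝ) * ∑ k ∈ range α, w₁ k =
      (1 / (1 - p)) * (p * s + 1 / (α : ℝ) * ∑ k ∈ range α, sSub k) := by
  have h2 : ∑ k ∈ range α, w₁ k = ∑ k ∈ range α, sSub k + p * (α * s + ∑ k ∈ range α, w₁ k) := by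
    conv_lhs => rw [sum_congr rfl fun k _ => h₁ k]
    rw [sum_add_distrib, ← mul_sum, sum_add_distrib, sum_range_succ_of_periodic hw₁]
    simp
  have hu : 1 - p ≠ 0 := by linarith
  have hα' : (α : ℝ) ≠ 0 := by positivity
  field_simp
  linear_combination h2

end Truncation

end

end CyclicAoI

namespace CyclicAoI

noncomputable section

/-! ### Expansions at `0` up to `O(z ^ 3)` -/

/-- `Q` is an expansion of `f` at `0` up to `O(z ^ 3)`. -/
def HasExpansion (f : ℝ → ℝ) (Q : ℝ[X]) : Prop :=
  (fun z => f z - Q.eval z) =O[𝓝 0] (fun z : ℝ => z ^ 3)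

namespace HasExpansion

variable {f g : ℝ → ℝ} {Q R : ℝ[X]}

lemma const (c : ℝ) : HasExpansion (fun _ => c) (C c) := by
  simpa [HasExpansion] using isBigO_zero _ _

lemma one : HasExpansion (fun _ => 1) 1 := by simpa using const 1

lemma add (hf : HasExpansion f Q) (hg : HasExpansion g R) :
    HasExpansion (fun z => f z + g z) (Q + R) := by
  refine (IsBigO.add hf hg).congr_left fun z => ?_
  rw [eval_add]; ring

lemma sub (hf : HasExpansion f Q) (hg : HasExpansion g R) :
    HasExpansion (fun z => f z - g z) (Q - R) := by
  refine (IsBigO.sub hf hg).congr_left fun z => ?_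
  rw [eval_sub]; ring

lemma isBigO_eval (Q : ℝ[X]) : (fun z => Q.eval z) =O[𝓝 0] (fun _ : ℝ => (1 : ℝ)) :=
  (Q.continuous.tendsto 0).isBigO_one ℝ

lemma isBigO_one (hf : HasExpansion f Q) : f =O[𝓝 0] (fun _ : ℝ => (1 : ℝ)) := by
  have h3 : (fun z : ℝ => z ^ 3) =O[𝓝 0] (fun _ : ℝ => (1 : ℝ)) :=
    ((continuous_pow 3).tendsto 0).isBigO_one ℝ
  refine ((IsBigO.trans hf h3).add (isBigO_eval Q)).congr_left fun z => ?_
  ring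

/-- The error splits as `f * (g - R) + (f - Q) * R`, with `f` and `R` bounded near `0`. -/
lemma mul (hf : HasExpansion f Q) (hg : HasExpansion g R) :
    HasExpansion (fun z => f z * g z) (Q * R) := by
  have h1 := hf.isBigO_one.mul hg
  have h2 := IsBigO.mul hf (isBigO_eval R)
  simp only [one_mul, mul_one] at h1 h2
  refine (h1.add h2).congr_left fun z => ?_
  rw [eval_mul]; ring

lemma pow (hf : HasExpansion f Q) (k : ℕ) : HasExpansion (fun z => f z ^ k) (Q ^ k) := by
  induction k with
  | zero => simpa using one
  | succ k ih => simpa only [pow_succ] using ih.mul hf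

lemma sum {ι : Type*} (s : Finset ι) {f : ι → ℝ → ℝ} {Q : ι → ℝ[X]}
    (h : ∀ i, HasExpansion (f i) (Q i)) :
    HasExpansion (fun z => ∑ i ∈ s, f i z) (∑ i ∈ s, Q i) := by
  classical
  induction s using Finset.induction_on with
  | empty => simpa using const 0
  | insert i s hi ih => simpa only [sum_insert hi] using (h i).add ih

lemma prod {ι : Type*} (s : Finset ι) {f : ι → ℝ → ℝ} {Q : ι → ℝ[X]}
    (h : ∀ i, HasExpansion (f i) (Q i)) :
    HasExpansion (fun z => ∏ i ∈ s, f i z) (∏ i ∈ s, Q i) := by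
  classical
  induction s using Finset.induction_on with
  | empty => simpa using one
  | insert i s hi ih => simpa only [prod_insert hi] using (h i).mul ih

lemma coeffs (hf : HasExpansion f Q) :
    (fun z => f z - (Q.coeff 0 + Q.coeff 1 * z + Q.coeff 2 * z ^ 2)) =O[𝓝 0]
      (fun z : ℝ => z ^ 3) := by
  have hdvd : (X : ℝ[X]) ^ 3 ∣ Q - (C (Q.coeff 0) + C (Q.coeff 1) * X + C (Q.coeff 2) * X ^ 2) := by
    rw [X_pow_dvd_iff]
    intro d hd
    interval_cases d <;> simp [coeff_X, coeff_C, coeff_X_pow]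
  obtain ⟨R, hR⟩ := hdvd
  have h1 : (fun z => z ^ 3 * R.eval z) =O[𝓝 0] (fun z : ℝ => z ^ 3) := by
    simpa using (isBigO_refl (fun z : ℝ => z ^ 3) (𝓝 0)).mul (isBigO_eval R)
  refine (IsBigO.add hf h1).congr_left fun z => ?_
  have := congrArg (Polynomial.eval z) hR
  simp only [eval_sub, eval_add, eval_mul, eval_C, eval_X, eval_pow] at this
  linear_combination -this

lemma numer (p : ℝ) (hf : HasExpansion f Q) {h : ℕ → ℝ → ℝ} {H : ℕ → ℝ[X]}
    (hh : ∀ i, HasExpansion (h i) (H i)) (α k : ℕ) :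
    HasExpansion (fun z => CyclicAoI.numer p (f z) (fun i => h i z) α k)
      (CyclicAoI.numer (C p) Q H α k) :=
  (one.sub (const p)).mul (sum _ fun j =>
    (((const p).pow (j - 1)).mul (hf.pow (j - 1))).mul (prod _ fun _ => hh _))

lemma denom (p : ℝ) (hf : HasExpansion f Q) {h : ℕ → ℝ → ℝ} {H : ℕ → ℝ[X]}
    (hh : ∀ i, HasExpansion (h i) (H i)) (α : ℕ) :
    HasExpansion (fun z => CyclicAoI.denom p (f z) (fun i => h i z) α)
      (CyclicAoI.denom (C p) Q H α) :=
  one.sub ((((const p).pow α).mul (hf.pow α)).mul (prod _ fun _ => hh _))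

end HasExpansion

/-- In the interior of its domain the MGF is analytic with the moments as Taylor coefficients, so
the partial sum of three terms leaves an error `O(z ^ 3)`. -/
lemma hasExpansion_mgf {Ω : Type*} [MeasurableSpace Ω] {μ : Measure Ω} [IsProbabilityMeasure μ]
    {Y : Ω → ℝ} (h : 0 ∈ interior (integrableExpSet Y μ)) :
    HasExpansion (mgf Y μ) (truncMGF (∫ ω, Y ω ∂μ) (∫ ω, Y ω ^ 2 ∂μ)) := by
  have h1 := (hasFPowerSeriesAt_mgf h).isBigO_sub_partialSum_pow 3
  have h2 : (fun y : ℝ => ‖y‖ ^ 3) =O[𝓝 0] (fun z : ℝ => z ^ 3) :=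
    (isBigO_refl (fun z : ℝ => z ^ 3) (𝓝 0)).norm_left.congr_left fun z => norm_pow z 3
  refine (h1.trans h2).congr_left fun z => ?_
  simp [FormalMultilinearSeries.partialSum, sum_range_succ, truncMGF, Nat.factorial]
  ring

section Model

variable {N K : ℕ} [NeZero K] {P : Fin K → Fin N} {n : Fin N} {Ω : Type*} [MeasurableSpace Ω]
  {μ : Measure Ω} [IsProbabilityMeasure μ] {p : Fin N → ℝ} {ν : Fin N → Measure ℝ}
  {X : ℕ → Ω → ℝ} {B : ℕ → Ω → Bool}

lemma IsModel.hasExpansion_mgf_subTime (h : IsModel μ P p ν X B)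
    (h0 : ∀ i, 0 ∈ interior (integrableExpSet id (ν (sched P i)))) (k : ℕ) :
    HasExpansion (mgf (subTime P X n k) μ)
      (truncMGF (∫ ω, subTime P X n k ω ∂μ) (∫ ω, subTime P X n k ω ^ 2 ∂μ)) := by
  refine hasExpansion_mgf ?_
  simp only [mem_interior_iff_mem_nhds] at h0 ⊢
  have h1 := (Filter.biInter_finset_mem (Ioo (pos P n k) (pos P n (k + 1)))).2 fun i _ => h0 i
  filter_upwards [h1] with z hz
  exact h.mem_integrableExpSet_sum_service _ fun i hi => by simpa using Set.mem_iInter₂.1 hz i hi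

lemma hasExpansion_mgf_id {ρ : Measure ℝ} [IsProbabilityMeasure ρ]
    (h0 : 0 ∈ interior (integrableExpSet id ρ)) :
    HasExpansion (mgf id ρ) (truncMGF (mean ρ) (secondMoment ρ)) :=
  hasExpansion_mgf h0

end Model

end

end CyclicAoI

namespace CyclicAoI

noncomputable section

/-! ### Convergence to the uniform distribution on `ZMod α` -/

section Uniform

variable {α : ℕ} [NeZero α]

lemma sum_range_zmod {M : Type*} [AddCommMonoid M] (f : ZMod α → M) :
    ∑ i ∈ range α, f i = ∑ r, f r := by
  refine sum_bij' (fun i _ => (i : ZMod α)) (fun r _ => r.val) (fun _ _ => mem_univ _)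
    (fun r _ => mem_range.2 (ZMod.val_lt r)) (fun i hi => ZMod.val_cast_of_lt (mem_range.1 hi))
    (fun r _ => ZMod.natCast_zmod_val r) (fun _ _ => rfl)

lemma sum_range_add_zmod {M : Type*} [AddCommMonoid M] (f : ZMod α → M) (r : ZMod α) :
    ∑ i ∈ range α, f (r + i) = ∑ r, f r := by
  rw [sum_range_zmod (fun i => f (r + i))]
  exact Fintype.sum_equiv (Equiv.addLeft r) _ _ fun _ => rfl

variable {p : ℝ} {e : ℕ → ZMod α → ℝ}

omit [NeZero α] in
lemma recursion_iterate_zmod (he : ∀ j r, e (j + 1) (r + 1) = p * e (j + 1) r + (1 - p) * e j r)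
    (j : ℕ) (r : ZMod α) (m : ℕ) : e (j + 1) (r + m) =
      p ^ m * e (j + 1) r + (1 - p) * ∑ i ∈ range m, p ^ (m - 1 - i) * e j (r + i) := by
  induction m with
  | zero => simp
  | succ m ih =>
    rw [Nat.cast_succ, ← add_assoc, he, ih, sum_range_succ]
    have : ∑ i ∈ range m, p ^ (m + 1 - 1 - i) * e j (r + i) =
        p * ∑ i ∈ range m, p ^ (m - 1 - i) * e j (r + i) := by
      rw [mul_sum]
      refine sum_congr rfl fun i hi => ?_
      rw [show m + 1 - 1 - i = m - 1 - i + 1 by have := mem_range.1 hi; omega]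
      ring
    rw [this, Nat.add_sub_cancel, Nat.sub_self]
    ring

lemma sum_range_pow_sub (p : ℝ) (m : ℕ) :
    (1 - p) * ∑ i ∈ range m, p ^ (m - 1 - i) = 1 - p ^ m := by
  rw [sum_range_reflect (fun i => p ^ i) m, mul_neg_geom_sum]

/-- Going once round the residues expresses `(1 - p ^ α) * e (j + 1) r` through `e j` with weights
`p ^ (α - 1 - i)`. Since `e j` has total `0`, the constant `p ^ α`, which lies below every weight,
can be subtracted from them; the weights stay nonnegative and lose mass, as in a Doeblin
minorization. -/
lemma abs_le_of_recursion (hp0 : 0 ≤ p) (hp1 : p < 1)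
    (he : ∀ j r, e (j + 1) (r + 1) = p * e (j + 1) r + (1 - p) * e j r)
    (hsum : ∀ j, ∑ r, e j r = 0) {j : ℕ} {c : ℝ} (hc : ∀ r, |e j r| ≤ c) (r : ZMod α) :
    |e (j + 1) r| ≤ (1 - (1 - p) * α * p ^ α / (1 - p ^ α)) * c := by
  have hα : α ≠ 0 := NeZero.ne α
  have hpα : 0 < 1 - p ^ α := by linarith [pow_lt_one₀ hp0 hp1 hα]
  have h1 := recursion_iterate_zmod he j r α
  rw [ZMod.natCast_self, add_zero] at h1
  have h2 : (1 - p ^ α) * e (j + 1) r =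
      (1 - p) * ∑ i ∈ range α, (p ^ (α - 1 - i) - p ^ α) * e j (r + i) := by
    simp_rw [sub_mul (p ^ _), sum_sub_distrib, ← mul_sum, sum_range_add_zmod (e j), hsum]
    linear_combination h1
  have h3 : |∑ i ∈ range α, (p ^ (α - 1 - i) - p ^ α) * e j (r + i)| ≤
      ∑ i ∈ range α, (p ^ (α - 1 - i) - p ^ α) * c := by
    refine (abs_sum_le_sum_abs _ _).trans (sum_le_sum fun i hi => ?_)
    have h4 : 0 ≤ p ^ (α - 1 - i) - p ^ α :=
      sub_nonneg.2 (pow_le_pow_of_le_one hp0 hp1.le (by omega))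
    rw [abs_mul, abs_of_nonneg h4]
    exact mul_le_mul_of_nonneg_left (hc _) h4
  have h5 : (1 - p) * ∑ i ∈ range α, (p ^ (α - 1 - i) - p ^ α) * c =
      ((1 - p ^ α) - (1 - p) * α * p ^ α) * c := by
    rw [← sum_mul, sum_sub_distrib, ← sum_range_pow_sub p α]
    simp only [sum_const, card_range, nsmul_eq_mul]
    ring
  have h6 : (1 - p ^ α) * |e (j + 1) r| ≤ ((1 - p ^ α) - (1 - p) * α * p ^ α) * c := by
    rw [← abs_of_pos hpα, ← abs_mul, abs_of_pos hpα, h2, abs_mul,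
      abs_of_pos (by linarith : 0 < 1 - p),
      ← h5]
    exact mul_le_mul_of_nonneg_left h3 (by linarith)
  rw [← mul_le_mul_iff_right₀ hpα]
  refine h6.trans (le_of_eq ?_)
  field_simp

lemma tendsto_zero_of_recursion (hp0 : 0 < p) (hp1 : p < 1)
    (he : ∀ j r, e (j + 1) (r + 1) = p * e (j + 1) r + (1 - p) * e j r)
    (hsum : ∀ j, ∑ r, e j r = 0) (hbd : ∀ r, |e 0 r| ≤ 1) (r : ZMod α) :
    Tendsto (fun j => e j r) atTop (𝓝 0) := by
  have hα : α ≠ 0 := NeZero.ne α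
  have hα' : (0 : ℝ) < α := by positivity
  have hpα : 0 < 1 - p ^ α := by linarith [pow_lt_one₀ hp0.le hp1 hα]
  set κ : ℝ := 1 - (1 - p) * α * p ^ α / (1 - p ^ α) with hκ
  -- Strictness is where `0 < p` enters; for `p = 0` and `α > 1` the factor would be `1`.
  have hκ1 : κ < 1 := by
    have : 0 < (1 - p) * α * p ^ α / (1 - p ^ α) := by
      have : 0 < 1 - p := by linarith
      positivity
    linarith
  have hκ0 : 0 ≤ κ := by
    rw [hκ, sub_nonneg, div_le_one hpα, ← sum_range_pow_sub, mul_assoc]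
    refine mul_le_mul_of_nonneg_left ?_ (by linarith)
    have := card_nsmul_le_sum (range α) (fun i => p ^ (α - 1 - i)) (p ^ α) fun i _ =>
      pow_le_pow_of_le_one hp0.le hp1.le (by omega)
    simpa using this
  have key : ∀ j r, |e j r| ≤ κ ^ j := by
    intro j
    induction j with
    | zero => simpa using hbd
    | succ j ih =>
      intro r
      rw [pow_succ']
      exact abs_le_of_recursion hp0.le hp1 he hsum ih r
  exact squeeze_zero_norm (fun j => key j r) (tendsto_pow_atTop_nhds_zero_of_lt_one hκ0 hκ1)

/-- Summed over `j < M`, the recursion telescopes: the sums at neighbouring residues differ by at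
most `4`, whatever `M`. Since they add up to `0` over all residues, each is at most `4 * α` in
absolute value, and division by `M` sends it to `0`. No contraction is used, so `p = 0` is allowed.
-/
lemma tendsto_cesaro_of_recursion (hp0 : 0 ≤ p) (hp1 : p < 1)
    (he : ∀ j r, e (j + 1) (r + 1) = p * e (j + 1) r + (1 - p) * e j r)
    (hsum : ∀ j, ∑ r, e j r = 0) (hbd : ∀ j r, |e j r| ≤ 1) (r : ZMod α) :
    Tendsto (fun M : ℕ => (M : ℝ)⁻¹ * ∑ j ∈ range M, e j r) atTop (𝓝 0) := by
  have hα' : (0 : ℝ) < α := by have := NeZero.ne α; positivity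
  have hstep : ∀ M r, |∑ j ∈ range M, e j (r + 1) - ∑ j ∈ range M, e j r| ≤ 4 := by
    intro M r
    have h1 : ∀ r, ∑ j ∈ range M, e (j + 1) r = ∑ j ∈ range M, e j r + e M r - e 0 r := by
      intro r
      have := sum_range_succ (fun j => e j r) M
      rw [sum_range_succ'] at this
      linarith
    have h2 : ∑ j ∈ range M, e (j + 1) (r + 1) =
        p * ∑ j ∈ range M, e (j + 1) r + (1 - p) * ∑ j ∈ range M, e j r := by
      rw [mul_sum, mul_sum, ← sum_add_distrib]
      exact sum_congr rfl fun j _ => he j r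
    rw [h1, h1] at h2
    have h3 : ∑ j ∈ range M, e j (r + 1) - ∑ j ∈ range M, e j r =
        p * (e M r - e 0 r) - e M (r + 1) + e 0 (r + 1) := by linarith
    rw [h3]
    have b1 := abs_le.1 (hbd M r)
    have b2 := abs_le.1 (hbd 0 r)
    have b3 := abs_le.1 (hbd M (r + 1))
    have b4 := abs_le.1 (hbd 0 (r + 1))
    rw [abs_le]
    constructor <;> nlinarith
  have hdiff : ∀ M r (m : ℕ), |∑ j ∈ range M, e j (r + m) - ∑ j ∈ range M, e j r| ≤ 4 * m := by
    intro M r m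
    induction m with
    | zero => simp
    | succ m ih =>
      have h1 := hstep M (r + m)
      rw [Nat.cast_succ, ← add_assoc]
      push_cast
      calc _ ≤ |∑ j ∈ range M, e j (r + m + 1) - ∑ j ∈ range M, e j (r + m)| +
          |∑ j ∈ range M, e j (r + m) - ∑ j ∈ range M, e j r| := abs_sub_le _ _ _
        _ ≤ _ := by linarith
  have hbound : ∀ M r, |∑ j ∈ range M, e j r| ≤ 4 * α := by
    intro M r
    have h0 : ∑ i ∈ range α, ∑ j ∈ range M, e j (r + i) = 0 := by
      rw [sum_range_add_zmod (fun r => ∑ j ∈ range M, e j r), sum_comm]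
      simp [hsum]
    have h1 : (α : ℝ) * ∑ j ∈ range M, e j r =
        -∑ i ∈ range α, (∑ j ∈ range M, e j (r + i) - ∑ j ∈ range M, e j r) := by
      rw [sum_sub_distrib, h0]; simp
    have h2 : |(α : ℝ) * ∑ j ∈ range M, e j r| ≤ α * (4 * α) := by
      rw [h1, abs_neg]
      refine (abs_sum_le_sum_abs _ _).trans ?_
      have := sum_le_card_nsmul (range α)
        (fun i : ℕ => |∑ j ∈ range M, e j (r + i) - ∑ j ∈ range M, e j r|) (4 * α) fun i hi => by
          refine (hdiff M r i).trans ?_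
          have : (i : ℝ) ≤ α := by exact_mod_cast (mem_range.1 hi).le
          linarith
      simpa using this
    rw [abs_mul, abs_of_pos hα'] at h2
    exact le_of_mul_le_mul_left h2 hα'
  have hlim : Tendsto (fun M : ℕ => (M : ℝ)⁻¹ * (4 * α)) atTop (𝓝 0) := by
    simpa using (tendsto_inv_atTop_nhds_zero_nat (𝕜 := ℝ)).mul_const (4 * (α : ℝ))
  refine squeeze_zero_norm (fun M => ?_) hlim
  rw [norm_mul, norm_inv, Real.norm_natCast]
  exact mul_le_mul_of_nonneg_left (hbound M r) (by positivity)

variable {w : ℕ → ZMod α → ℝ}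

omit [NeZero α] in
lemma sub_uniform_recursion
    (hw : ∀ j r, w (j + 1) (r + 1) = p * w (j + 1) r + (1 - p) * w j r) (j : ℕ) (r : ZMod α) :
    w (j + 1) (r + 1) - (α : ℝ)⁻¹ =
      p * (w (j + 1) r - (α : ℝ)⁻¹) + (1 - p) * (w j r - (α : ℝ)⁻¹) := by
  rw [hw]; ring

lemma sum_sub_uniform (hsum : ∀ j, ∑ r, w j r = 1) (j : ℕ) : ∑ r, (w j r - (α : ℝ)⁻¹) = 0 := by
  have : (α : ℝ) ≠ 0 := by exact_mod_cast NeZero.ne α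
  simp [sum_sub_distrib, hsum, ZMod.card, this]

lemma abs_sub_uniform_le (hsum : ∀ j, ∑ r, w j r = 1) (h0 : ∀ j r, 0 ≤ w j r) (j : ℕ)
    (r : ZMod α) : |w j r - (α : ℝ)⁻¹| ≤ 1 := by
  have h1 : w j r ≤ 1 := by
    rw [← hsum j]; exact single_le_sum (fun r _ => h0 j r) (mem_univ r)
  have h2 : (α : ℝ)⁻¹ ≤ 1 := Nat.cast_inv_le_one α
  have h3 : (0 : ℝ) ≤ (α : ℝ)⁻¹ := by positivity
  rw [abs_le]
  constructor <;> linarith [h0 j r]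

lemma tendsto_uniform (hp0 : 0 < p) (hp1 : p < 1)
    (hw : ∀ j r, w (j + 1) (r + 1) = p * w (j + 1) r + (1 - p) * w j r)
    (hsum : ∀ j, ∑ r, w j r = 1) (h0 : ∀ j r, 0 ≤ w j r) (r : ZMod α) :
    Tendsto (fun j => w j r) atTop (𝓝 (α : ℝ)⁻¹) := by
  have := tendsto_zero_of_recursion hp0 hp1 (sub_uniform_recursion hw) (sum_sub_uniform hsum)
    (abs_sub_uniform_le hsum h0 0) r
  simpa using this.add_const (α : ℝ)⁻¹

lemma tendsto_cesaro_uniform (hp0 : 0 ≤ p) (hp1 : p < 1)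
    (hw : ∀ j r, w (j + 1) (r + 1) = p * w (j + 1) r + (1 - p) * w j r)
    (hsum : ∀ j, ∑ r, w j r = 1) (h0 : ∀ j r, 0 ≤ w j r) (r : ZMod α) :
    Tendsto (fun M : ℕ => (M : ℝ)⁻¹ * ∑ j ∈ range M, w j r) atTop (𝓝 (α : ℝ)⁻¹) := by
  have := tendsto_cesaro_of_recursion hp0 hp1 (sub_uniform_recursion hw) (sum_sub_uniform hsum)
    (abs_sub_uniform_le hsum h0) r
  have h2 := this.add_const (α : ℝ)⁻¹
  rw [zero_add] at h2
  refine h2.congr' ?_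
  filter_upwards [eventually_gt_atTop 0] with M hM
  have hM' : (M : ℝ) ≠ 0 := by positivity
  rw [sum_sub_distrib]
  simp only [sum_const, card_range, nsmul_eq_mul]
  field_simp
  ring

end Uniform

/-! ### The steady-state law -/

section SteadyState

variable {N K : ℕ} [NeZero K] {P : Fin K → Fin N} {n : Fin N} {Ω : Type*} [MeasurableSpace Ω]
  {μ : Measure Ω} {p : Fin N → ℝ} {ν : Fin N → Measure ℝ}
  {X : ℕ → Ω → ℝ} {B : ℕ → Ω → Bool}

/-- The average of the laws of the gaps after the appearances in one period. -/
def steadyLaw (μ : Measure Ω) (P : Fin K → Fin N) (X : ℕ → Ω → ℝ) (B : ℕ → Ω → Bool)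
    (n : Fin N) : Measure ℝ :=
  ENNReal.ofReal (alpha P n : ℝ)⁻¹ • ∑ k ∈ range (alpha P n), gapLaw μ P X B n k

/-- The probability that the `j`-th success is at the `k`-th appearance. -/
def successWeight (μ : Measure Ω) (P : Fin K → Fin N) (B : ℕ → Ω → Bool) (p : Fin N → ℝ)
    (n : Fin N) (j k : ℕ) : ℝ := (1 - p n) * μ.real {ω | successCount P B n k ω = j}

/-- The probability that the `j`-th success is at an appearance congruent to `r`. -/
def residueWeight (μ : Measure Ω) (P : Fin K → Fin N) (B : ℕ → Ω → Bool) (p : Fin N → ℝ)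
    (n : Fin N) (j : ℕ) (r : ZMod (alpha P n)) : ENNReal :=
  ∑' k : ℕ, if (k : ZMod (alpha P n)) = r then
    ENNReal.ofReal (successWeight μ P B p n j k) else 0

variable [IsProbabilityMeasure μ]

lemma IsModel.ae_forall_exists_gapEvent (h : IsModel μ P p ν X B)
    (hp : ∀ m, 0 ≤ p m ∧ p m ≤ 1) (hn : ∃ k, P k = n) (hpn : p n < 1) :
    ∀ᵐ ω ∂μ, ∀ k, ∃ m, ω ∈ gapEvent P B n k m := by
  rw [ae_all_iff]
  intro k
  filter_upwards [h.ae_exists_gapEvent hp hn hpn k] with ω hω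
  simpa using hω

omit [MeasurableSpace Ω] in
lemma exists_successCount_eq {ω : Ω} (hω : ∀ k, ∃ m, ω ∈ gapEvent P B n k m) (j : ℕ) :
    ∃ k, successCount P B n k ω = j ∧ B (pos P n k) ω = true := by
  have hinf : {l | B (pos P n l) ω = true}.Infinite := by
    rw [Set.infinite_iff_exists_gt]
    intro k
    obtain ⟨m, hm⟩ := hω k
    exact ⟨k + 1 + m, hm.2, by omega⟩
  exact ⟨Nat.nth (fun l => B (pos P n l) ω = true) j, Nat.count_nth_of_infinite hinf j,
    Nat.nth_mem_of_infinite hinf j⟩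

/-- The event is cut according to the appearance `k` of the `j`-th success and the number `m` of
failures after it. The count before `k`, the drops from `k` on and the service times are
independent, so for fixed `k` the sum over `m` reassembles `gapLaw` at `k`. -/
lemma IsModel.map_interSuccess_apply (h : IsModel μ P p ν X B)
    (hp : ∀ m, 0 ≤ p m ∧ p m ≤ 1) (hn : ∃ k, P k = n) (hpn : p n < 1) (j : ℕ) {A : Set ℝ}
    (hA : MeasurableSet A) : μ {ω | interSuccess P X B n j ω ∈ A} =
      ∑' k, ENNReal.ofReal (successWeight μ P B p n j k) * gapLaw μ P X B n k A := by
  have hu : 0 ≤ 1 - p n := by linarith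
  let E : ℕ × ℕ → Set Ω := fun x =>
    {ω | successCount P B n x.1 ω = j} ∩ successGapEvent P B n x.1 x.2
  have hEs : ∀ x, MeasurableSet[slotAlg X B (dropPart Set.univ)] (E x) := fun x =>
    MeasurableSet.inter (slotAlg_mono X B (dropPart_mono (Set.subset_univ _)) _
      (measurableSet_successCount_slotAlg hn _ _)) (measurableSet_successGapEvent_slotAlg hn _ _)
  have hE : ∀ x, MeasurableSet (E x) := fun x => h.slotAlg_le _ _ (hEs x)
  have hd : Pairwise (Function.onFun Disjoint E) := by
    rintro ⟨k, m⟩ ⟨k', m'⟩ hne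
    change Disjoint (E (k, m)) (E (k', m'))
    rw [Set.disjoint_left]
    rintro ω ⟨h1, h2⟩ ⟨h1', h2'⟩
    have hk : k = k' := by
      have e1 := nth_success hn h2.1 h1
      have e2 := nth_success hn h2'.1 h1'
      exact (pos_strictMono hn).injective (e1.symm.trans e2)
    subst hk
    have hm : m ≠ m' := fun hm => hne (by rw [hm])
    exact Set.disjoint_left.1 (disjoint_successGapEvent k hm) h2 h2'
  have hY : ∀ x, ∀ ω ∈ E x, interSuccess P X B n j ω = gapTime P X n x.1 x.2 ω := fun x ω hω =>
    interSuccess_eq_of_mem_gapEvent hn hω.2.1 hω.1 hω.2.2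
  -- Almost surely there are infinitely many successes, so the pieces exhaust the space up to a null
  -- set.
  have hU : μ.restrict (⋃ x, E x) = μ := by
    rw [Measure.restrict_eq_self_of_ae_mem]
    filter_upwards [h.ae_forall_exists_gapEvent hp hn hpn] with ω hω
    obtain ⟨k, hk, hb⟩ := exists_successCount_eq hω j
    obtain ⟨m, hm⟩ := hω k
    exact Set.mem_iUnion.2 ⟨(k, m), hk, hb, hm⟩
  have hZ : ∀ x : ℕ × ℕ, Measurable (gapTime P X n x.1 x.2) := fun x => h.measurable_gapTime _ _
  have hYm := aemeasurable_restrict_iUnion (μ := μ) hE hZ hY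
  have hlaw := map_restrict_iUnion hE hd hZ hY fun x A hA =>
    h.measure_inter_service (hEs x) (measurable_gapTime_slotAlg_univ _ _) hA
  rw [hU] at hYm hlaw
  have h1 : μ {ω | interSuccess P X B n j ω ∈ A} = (μ.map (interSuccess P X B n j)) A :=
    (Measure.map_apply_of_aemeasurable hYm hA).symm
  rw [h1, hlaw, Measure.sum_apply _ hA, ENNReal.tsum_prod']
  refine tsum_congr fun k => ?_
  rw [h.gapLaw_eq hp hn hpn, Measure.sum_apply _ hA, ← ENNReal.tsum_mul_left]
  refine tsum_congr fun m => ?_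
  have h2 : μ (E (k, m)) = ENNReal.ofReal (successWeight μ P B p n j k) *
      ENNReal.ofReal ((1 - p n) * p n ^ m) := by
    have hw : 0 ≤ successWeight μ P B p n j k := mul_nonneg hu measureReal_nonneg
    rw [← ofReal_measureReal, ← ENNReal.ofReal_mul hw]
    congr 1
    rw [show μ.real (E (k, m)) = _ from h.real_successCount_inter hp hn j k m, successWeight]
    ring
  rw [Measure.smul_apply, Measure.smul_apply, h2, smul_eq_mul, smul_eq_mul, mul_assoc]

lemma IsModel.gapLaw_natCast (h : IsModel μ P p ν X B)
    (hp : ∀ m, 0 ≤ p m ∧ p m ≤ 1) (hn : ∃ k, P k = n) (hpn : p n < 1) (k : ℕ) :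
    gapLaw μ P X B n (k : ZMod (alpha P n)).val = gapLaw μ P X B n k := by
  have hper : Function.Periodic (gapLaw μ P X B n) (alpha P n) :=
    fun k => h.gapLaw_add_alpha hp hn hpn k
  rw [ZMod.val_natCast, hper.map_mod_nat]

lemma tsum_mul_residue {α : ℕ} [NeZero α] (w : ℕ → ENNReal) (L : ZMod α → ENNReal) :
    ∑' k : ℕ, w k * L k = ∑ r : ZMod α, (∑' k : ℕ, if (k : ZMod α) = r then w k else 0) * L r := by
  simp_rw [← ENNReal.tsum_mul_right]
  rw [← Summable.tsum_finsetSum fun _ _ => ENNReal.summable]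
  refine tsum_congr fun k => ?_
  simp [ite_mul]

lemma IsModel.measure_interSuccess (h : IsModel μ P p ν X B)
    (hp : ∀ m, 0 ≤ p m ∧ p m ≤ 1) (hn : ∃ k, P k = n) (hpn : p n < 1) [NeZero (alpha P n)] (j : ℕ)
    {A : Set ℝ} (hA : MeasurableSet A) : μ {ω | interSuccess P X B n j ω ∈ A} =
      ∑ r, residueWeight μ P B p n j r * gapLaw μ P X B n r.val A := by
  rw [h.map_interSuccess_apply hp hn hpn j hA]
  have := tsum_mul_residue (fun k => ENNReal.ofReal (successWeight μ P B p n j k))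
    (fun r : ZMod (alpha P n) => gapLaw μ P X B n r.val A)
  simp_rw [h.gapLaw_natCast hp hn hpn] at this
  exact this

/-- Evaluating the decomposition of the law on the whole line avoids summing the probabilities of
success positions by hand. -/
lemma IsModel.sum_residueWeight (h : IsModel μ P p ν X B)
    (hp : ∀ m, 0 ≤ p m ∧ p m ≤ 1) (hn : ∃ k, P k = n) (hpn : p n < 1) [NeZero (alpha P n)] (j : ℕ) :
    ∑ r, residueWeight μ P B p n j r = 1 := by
  have h1 := h.measure_interSuccess hp hn hpn j MeasurableSet.univ
  have := fun k => h.isProbabilityMeasure_gapLaw hp hn hpn k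
  simpa using h1.symm

lemma IsModel.residueWeight_succ (h : IsModel μ P p ν X B)
    (hp : ∀ m, 0 ≤ p m ∧ p m ≤ 1) (hn : ∃ k, P k = n) (hpn : p n < 1) (j : ℕ)
    (r : ZMod (alpha P n)) : residueWeight μ P B p n (j + 1) (r + 1) =
      ENNReal.ofReal (p n) * residueWeight μ P B p n (j + 1) r +
      ENNReal.ofReal (1 - p n) * residueWeight μ P B p n j r := by
  have hu : 0 ≤ 1 - p n := by linarith
  have hw0 : ∀ j k, 0 ≤ successWeight μ P B p n j k := fun j k => mul_nonneg hu measureReal_nonneg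
  simp only [residueWeight]
  rw [tsum_eq_zero_add' ENNReal.summable, ← ENNReal.tsum_mul_left, ← ENNReal.tsum_mul_left,
    ← ENNReal.tsum_add]
  -- Nothing precedes appearance `0`, so a success there cannot have index `j + 1`. Dropping this
  -- term makes the index shift, hence the shift of the residue by one, exact.
  have h0 : successWeight μ P B p n (j + 1) 0 = 0 := by
    simp [successWeight, successCount]
  rw [h0, ENNReal.ofReal_zero, ite_self, zero_add]
  refine tsum_congr fun k => ?_
  have h1 : successWeight μ P B p n (j + 1) (k + 1) =
      p n * successWeight μ P B p n (j + 1) k + (1 - p n) * successWeight μ P B p n j k := by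
    simp only [successWeight]
    rw [h.real_successCount_succ hp hn]
    ring
  by_cases hk : (k : ZMod (alpha P n)) = r
  · simp only [Nat.cast_succ, hk, if_true]
    rw [h1, ENNReal.ofReal_add (mul_nonneg (hp n).1 (hw0 _ _)) (mul_nonneg hu (hw0 _ _)),
      ENNReal.ofReal_mul (hp n).1, ENNReal.ofReal_mul hu]
  · simp [hk]

section Limits

variable [NeZero (alpha P n)]

lemma IsModel.residueWeight_ne_top (h : IsModel μ P p ν X B)
    (hp : ∀ m, 0 ≤ p m ∧ p m ≤ 1) (hn : ∃ k, P k = n) (hpn : p n < 1) (j : ℕ)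
    (r : ZMod (alpha P n)) : residueWeight μ P B p n j r ≠ ⊤ := by
  have h1 := h.sum_residueWeight hp hn hpn j
  have h2 : residueWeight μ P B p n j r ≤ 1 := by
    rw [← h1]
    exact single_le_sum (fun r _ => zero_le) (mem_univ r)
  exact (h2.trans_lt ENNReal.one_lt_top).ne

lemma IsModel.real_interSuccess (h : IsModel μ P p ν X B)
    (hp : ∀ m, 0 ≤ p m ∧ p m ≤ 1) (hn : ∃ k, P k = n) (hpn : p n < 1) (j : ℕ)
    {A : Set ℝ} (hA : MeasurableSet A) : μ.real {ω | interSuccess P X B n j ω ∈ A} =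
      ∑ r, (residueWeight μ P B p n j r).toReal * (gapLaw μ P X B n r.val).real A := by
  have := fun k => h.isProbabilityMeasure_gapLaw hp hn hpn k
  rw [measureReal_def, h.measure_interSuccess hp hn hpn j hA, ENNReal.toReal_sum]
  · simp [ENNReal.toReal_mul, measureReal_def]
  · exact fun r _ => ENNReal.mul_ne_top (h.residueWeight_ne_top hp hn hpn j r) (measure_ne_top _ _)

lemma IsModel.sum_toReal_residueWeight (h : IsModel μ P p ν X B)
    (hp : ∀ m, 0 ≤ p m ∧ p m ≤ 1) (hn : ∃ k, P k = n) (hpn : p n < 1) (j : ℕ) :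
    ∑ r, (residueWeight μ P B p n j r).toReal = 1 := by
  rw [← ENNReal.toReal_sum fun r _ => h.residueWeight_ne_top hp hn hpn j r,
    h.sum_residueWeight hp hn hpn]
  simp

lemma IsModel.toReal_residueWeight_succ (h : IsModel μ P p ν X B)
    (hp : ∀ m, 0 ≤ p m ∧ p m ≤ 1) (hn : ∃ k, P k = n) (hpn : p n < 1) (j : ℕ)
    (r : ZMod (alpha P n)) : (residueWeight μ P B p n (j + 1) (r + 1)).toReal =
      p n * (residueWeight μ P B p n (j + 1) r).toReal +
      (1 - p n) * (residueWeight μ P B p n j r).toReal := by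
  have hne := h.residueWeight_ne_top hp hn hpn
  rw [h.residueWeight_succ hp hn hpn, ENNReal.toReal_add, ENNReal.toReal_mul, ENNReal.toReal_mul,
    ENNReal.toReal_ofReal (hp n).1, ENNReal.toReal_ofReal (by linarith)]
  · exact ENNReal.mul_ne_top ENNReal.ofReal_ne_top (hne _ _)
  · exact ENNReal.mul_ne_top ENNReal.ofReal_ne_top (hne _ _)

lemma IsModel.real_steadyLaw (h : IsModel μ P p ν X B)
    (hp : ∀ m, 0 ≤ p m ∧ p m ≤ 1) (hn : ∃ k, P k = n) (hpn : p n < 1) (A : Set ℝ) :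
    (steadyLaw μ P X B n).real A =
      ∑ r : ZMod (alpha P n), (alpha P n : ℝ)⁻¹ * (gapLaw μ P X B n r.val).real A := by
  have := fun k => h.isProbabilityMeasure_gapLaw hp hn hpn k
  rw [← mul_sum, ← sum_range_zmod (fun r : ZMod (alpha P n) => (gapLaw μ P X B n r.val).real A)]
  simp_rw [h.gapLaw_natCast hp hn hpn]
  rw [steadyLaw, measureReal_def, Measure.smul_apply, smul_eq_mul, ENNReal.toReal_mul,
    ENNReal.toReal_ofReal (by positivity), Measure.finsetSum_apply, ENNReal.toReal_sum]
  · simp [measureReal_def]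
  · exact fun _ _ => measure_ne_top _ _

lemma IsModel.tendsto_real_interSuccess (h : IsModel μ P p ν X B)
    (hp : ∀ m, 0 ≤ p m ∧ p m ≤ 1) (hn : ∃ k, P k = n) (hpn : p n < 1) (hp0 : 0 < p n)
    {A : Set ℝ} (hA : MeasurableSet A) :
    Tendsto (fun j : ℕ => μ.real {ω | interSuccess P X B n j ω ∈ A}) atTop
      (𝓝 ((steadyLaw μ P X B n).real A)) := by
  simp_rw [h.real_interSuccess hp hn hpn _ hA, h.real_steadyLaw hp hn hpn A]
  refine tendsto_finsetSum _ fun r _ => Tendsto.mul_const _ ?_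
  exact tendsto_uniform hp0 hpn (fun j r => h.toReal_residueWeight_succ hp hn hpn j r)
    (h.sum_toReal_residueWeight hp hn hpn) (fun _ _ => ENNReal.toReal_nonneg) r

lemma IsModel.tendsto_cesaro_real_interSuccess (h : IsModel μ P p ν X B)
    (hp : ∀ m, 0 ≤ p m ∧ p m ≤ 1) (hn : ∃ k, P k = n) (hpn : p n < 1)
    {A : Set ℝ} (hA : MeasurableSet A) :
    Tendsto (fun M : ℕ => (M : ℝ)⁻¹ * ∑ j ∈ range M, μ.real {ω | interSuccess P X B n j ω ∈ A})
      atTop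
      (𝓝 ((steadyLaw μ P X B n).real A)) := by
  simp_rw [h.real_interSuccess hp hn hpn _ hA, h.real_steadyLaw hp hn hpn A]
  have h1 : ∀ M : ℕ, (M : ℝ)⁻¹ * ∑ j ∈ range M, ∑ r,
      (residueWeight μ P B p n j r).toReal * (gapLaw μ P X B n r.val).real A =
      ∑ r, ((M : ℝ)⁻¹ * ∑ j ∈ range M, (residueWeight μ P B p n j r).toReal) *
        (gapLaw μ P X B n r.val).real A := fun M => by
    rw [sum_comm, mul_sum]
    refine sum_congr rfl fun r _ => ?_
    rw [← sum_mul, mul_assoc]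
  simp_rw [h1]
  refine tendsto_finsetSum _ fun r _ => Tendsto.mul_const _ ?_
  exact tendsto_cesaro_uniform (hp n).1 hpn (fun j r => h.toReal_residueWeight_succ hp hn hpn j r)
    (h.sum_toReal_residueWeight hp hn hpn) (fun _ _ => ENNReal.toReal_nonneg) r

end Limits

lemma IsModel.isProbabilityMeasure_steadyLaw (h : IsModel μ P p ν X B)
    (hp : ∀ m, 0 ≤ p m ∧ p m ≤ 1) (hn : ∃ k, P k = n) (hpn : p n < 1) :
    IsProbabilityMeasure (steadyLaw μ P X B n) := by
  have := fun k => h.isProbabilityMeasure_gapLaw hp hn hpn k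
  have hα : (0 : ℝ) < alpha P n := by exact_mod_cast alpha_pos hn
  constructor
  rw [steadyLaw, Measure.smul_apply, Measure.finsetSum_apply]
  simp only [measure_univ, sum_const, card_range, nsmul_eq_mul, mul_one, smul_eq_mul]
  rw [← ENNReal.ofReal_natCast, ← ENNReal.ofReal_mul (by positivity), inv_mul_cancel₀ hα.ne',
    ENNReal.ofReal_one]

omit [IsProbabilityMeasure μ] in
lemma integrable_steadyLaw {f : ℝ → ℝ} (hf : ∀ k, Integrable f (gapLaw μ P X B n k)) :
    Integrable f (steadyLaw μ P X B n) :=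
  (integrable_finsetSum_measure.2 fun k _ => hf k).smul_measure ENNReal.ofReal_ne_top

omit [IsProbabilityMeasure μ] in
lemma integral_steadyLaw {f : ℝ → ℝ} (hf : ∀ k, Integrable f (gapLaw μ P X B n k)) :
    ∫ x, f x ∂steadyLaw μ P X B n =
      1 / (alpha P n : ℝ) * ∑ k ∈ range (alpha P n), ∫ x, f x ∂gapLaw μ P X B n k := by
  rw [steadyLaw, integral_smul_measure, integral_finsetSum_measure fun k _ => hf k,
    ENNReal.toReal_ofReal (by positivity), smul_eq_mul, one_div]

end SteadyState

end

end CyclicAoI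

namespace CyclicAoI

noncomputable section

/-! ### The pointwise ergodic theorem -/

section Birkhoff

variable {α : Type*} [MeasurableSpace α] {μ : Measure α} {T : α → α} {f : α → ℝ}

/-- The maximum of the Birkhoff sums of lengths `1, …, n + 1`. -/
def maxBirkhoff (T : α → α) (f : α → ℝ) : ℕ → α → ℝ
  | 0 => f
  | n + 1 => fun x => f x + max 0 (maxBirkhoff T f n (T x))

omit [MeasurableSpace α] in
lemma maxBirkhoff_le_succ (n : ℕ) (x : α) : maxBirkhoff T f n x ≤ maxBirkhoff T f (n + 1) x := by
  induction n generalizing x with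
  | zero => simp [maxBirkhoff]
  | succ n ih =>
    change f x + max 0 (maxBirkhoff T f n (T x)) ≤ f x + max 0 (maxBirkhoff T f (n + 1) (T x))
    gcongr
    exact ih (T x)

omit [MeasurableSpace α] in
lemma maxBirkhoff_mono (x : α) : Monotone fun n => maxBirkhoff T f n x :=
  monotone_nat_of_le_succ fun n => maxBirkhoff_le_succ n x

omit [MeasurableSpace α] in
lemma birkhoffSum_succ_le_maxBirkhoff (n : ℕ) (x : α) :
    birkhoffSum T f (n + 1) x ≤ maxBirkhoff T f n x := by
  induction n generalizing x with
  | zero => simp [maxBirkhoff]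
  | succ n ih =>
    rw [birkhoffSum_succ']
    change f x + _ ≤ f x + _
    gcongr
    exact (ih (T x)).trans (le_max_right _ _)

lemma measurable_maxBirkhoff (hT : Measurable T) (hf : Measurable f) (n : ℕ) :
    Measurable (maxBirkhoff T f n) := by
  induction n with
  | zero => exact hf
  | succ n ih => exact hf.add (measurable_const.max (ih.comp hT))

lemma integrable_maxBirkhoff (hT : MeasurePreserving T μ μ) (hf : Integrable f μ) (n : ℕ) :
    Integrable (maxBirkhoff T f n) μ := by
  induction n with
  | zero => exact hf
  | succ n ih =>
    have h1 : Integrable (fun x => maxBirkhoff T f n (T x)) μ := hT.integrable_comp_of_integrable ih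
    have h2 : Integrable (fun x => max 0 (maxBirkhoff T f n (T x))) μ := by
      simpa [max_comm] using h1.pos_part
    exact hf.add h2

/-- The set of points at which the Birkhoff sums are not bounded above. -/
def unboundedSet (T : α → α) (f : α → ℝ) : Set α :=
  {x | ∀ c : ℕ, ∃ n, (c : ℝ) < maxBirkhoff T f n x}

lemma measurableSet_unboundedSet (hT : Measurable T) (hf : Measurable f) :
    MeasurableSet (unboundedSet T f) := by
  have : unboundedSet T f = ⋂ c : ℕ, ⋃ n, {x | (c : ℝ) < maxBirkhoff T f n x} := by
    ext x; simp [unboundedSet]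
  rw [this]
  exact MeasurableSet.iInter fun c => MeasurableSet.iUnion fun n =>
    measurableSet_lt measurable_const (measurable_maxBirkhoff hT hf n)

omit [MeasurableSpace α] in
lemma preimage_unboundedSet : T ⁻¹' unboundedSet T f = unboundedSet T f := by
  ext x
  constructor
  · intro h c
    obtain ⟨d, hd⟩ := exists_nat_gt ((c : ℝ) - f x)
    obtain ⟨n, hn⟩ := h d
    refine ⟨n + 1, ?_⟩
    change (c : ℝ) < f x + max 0 (maxBirkhoff T f n (T x))
    linarith [le_max_right 0 (maxBirkhoff T f n (T x))]
  · intro h c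
    obtain ⟨d, hd⟩ := exists_nat_gt ((c : ℝ) + f x)
    obtain ⟨n, hn⟩ := h d
    have h1 := hn.trans_le (maxBirkhoff_le_succ n x)
    change (d : ℝ) < f x + max 0 (maxBirkhoff T f n (T x)) at h1
    refine ⟨n, ?_⟩
    rcases max_choice 0 (maxBirkhoff T f n (T x)) with h2 | h2 <;> rw [h2] at h1
    · have : (0 : ℝ) ≤ c := by positivity
      linarith
    · linarith

/-- The integrand equals `maxBirkhoff T f (n + 1) - maxBirkhoff T f n ∘ T`. Invariance of the
measure removes `T` from the second integral, and the maxima increase with `n`. -/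
lemma integral_maxBirkhoff_succ_sub (hT : MeasurePreserving T μ μ) (hf : Integrable f μ) (n : ℕ) :
    0 ≤ ∫ x, (f x + max 0 (-maxBirkhoff T f n (T x))) ∂μ := by
  have hi := integrable_maxBirkhoff hT hf
  have h1 : Integrable (fun x => maxBirkhoff T f n (T x)) μ :=
    hT.integrable_comp_of_integrable (hi n)
  have h2 : ∀ x, f x + max 0 (-maxBirkhoff T f n (T x)) =
      maxBirkhoff T f (n + 1) x - maxBirkhoff T f n (T x) := by
    intro x
    change _ = f x + max 0 (maxBirkhoff T f n (T x)) - maxBirkhoff T f n (T x)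
    rcases le_total 0 (maxBirkhoff T f n (T x)) with h | h
    · rw [max_eq_right h, max_eq_left (by linarith)]; ring
    · rw [max_eq_left h, max_eq_right (by linarith)]; ring
  simp_rw [h2]
  have h3 : ∫ x, maxBirkhoff T f n (T x) ∂μ = ∫ x, maxBirkhoff T f n x ∂μ := by
    conv_rhs => rw [← hT.map_eq]
    exact (integral_map hT.aemeasurable (by rw [hT.map_eq]; exact (hi n).1)).symm
  rw [integral_sub (hi (n + 1)) h1, h3, sub_nonneg]
  exact integral_mono (hi n) (hi (n + 1)) fun x => maxBirkhoff_le_succ n x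

/-- Where the Birkhoff sums are unbounded, the negative part of the maximal function at `T x`
vanishes eventually, so the preceding inequality passes to the limit. Domination by `|f| + |f ∘ T|`
holds because the maxima never fall below `f`. -/
lemma integral_nonneg_of_ae_mem_unboundedSet (hT : MeasurePreserving T μ μ) (hf : Integrable f μ)
    (h : ∀ᵐ x ∂μ, x ∈ unboundedSet T f) : 0 ≤ ∫ x, f x ∂μ := by
  have hfT : Integrable (fun x => f (T x)) μ := hT.integrable_comp_of_integrable hf
  have hlim : Tendsto (fun n => ∫ x, (f x + max 0 (-maxBirkhoff T f n (T x))) ∂μ) atTop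
      (𝓝 (∫ x, f x ∂μ)) := by
    refine tendsto_integral_of_dominated_convergence (fun x => |f x| + |f (T x)|) (fun n => ?_)
      (hf.abs.add hfT.abs) (fun n => Eventually.of_forall fun x => ?_) ?_
    · have h1 : Integrable (fun x => -maxBirkhoff T f n (T x)) μ :=
        (hT.integrable_comp_of_integrable (integrable_maxBirkhoff hT hf n)).neg
      have h2 : Integrable (fun x => max 0 (-maxBirkhoff T f n (T x))) μ := by
        simpa [max_comm] using h1.pos_part
      exact (hf.add h2).1
    · have h1 : maxBirkhoff T f 0 (T x) ≤ maxBirkhoff T f n (T x) :=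
        maxBirkhoff_mono (T x) n.zero_le
      change f (T x) ≤ _ at h1
      refine (norm_add_le _ _).trans (add_le_add le_rfl ?_)
      rw [Real.norm_of_nonneg (le_max_left _ _), max_le_iff]
      exact ⟨abs_nonneg _, by linarith [neg_abs_le (f (T x))]⟩
    · filter_upwards [h] with x hx
      have hx' : T x ∈ unboundedSet T f := by
        rw [← preimage_unboundedSet] at hx; exact hx
      obtain ⟨n, hn⟩ := hx' 0
      refine tendsto_const_nhds.congr' ?_
      filter_upwards [eventually_ge_atTop n] with m hm
      have h1 : maxBirkhoff T f n (T x) ≤ maxBirkhoff T f m (T x) := maxBirkhoff_mono (T x) hm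
      rw [max_eq_left, add_zero]
      push_cast at hn
      linarith
  exact ge_of_tendsto' hlim fun n => integral_maxBirkhoff_succ_sub hT hf n

/-- The unbounded set is exactly invariant, hence null or conull by ergodicity; a negative integral
excludes the second case. -/
lemma ae_birkhoffSum_bddAbove [IsProbabilityMeasure μ] (hT : Ergodic T μ) (hfm : Measurable f)
    (hf : Integrable f μ) (hneg : ∫ x, f x ∂μ < 0) :
    ∀ᵐ x ∂μ, ∃ c : ℝ, ∀ m, birkhoffSum T f m x ≤ c := by
  have hnot : ∀ᵐ x ∂μ, x ∉ unboundedSet T f := by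
    rcases hT.ae_mem_or_ae_notMem (measurableSet_unboundedSet hT.measurable hfm)
      preimage_unboundedSet with h | h
    · exact absurd (integral_nonneg_of_ae_mem_unboundedSet hT.toMeasurePreserving hf h)
        (not_le.2 hneg)
    · exact h
  filter_upwards [hnot] with x hx
  simp only [unboundedSet, Set.mem_ofPred_eq, not_forall, not_exists, not_lt] at hx
  obtain ⟨c, hc⟩ := hx
  refine ⟨c, fun m => ?_⟩
  cases m with
  | zero => simp
  | succ m => exact (birkhoffSum_succ_le_maxBirkhoff m x).trans (hc m)

lemma ae_birkhoffSum_le [IsProbabilityMeasure μ] (hT : Ergodic T μ) (hfm : Measurable f)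
    (hf : Integrable f μ) {ε : ℝ} (hε : 0 < ε) :
    ∀ᵐ x ∂μ, ∃ c : ℝ, ∀ m, birkhoffSum T f m x ≤ m * (∫ x, f x ∂μ + ε) + c := by
  have h1 : Integrable (fun x => f x - (∫ x, f x ∂μ + ε)) μ := hf.sub (integrable_const _)
  have h2 : ∫ x, (f x - (∫ x, f x ∂μ + ε)) ∂μ < 0 := by
    rw [integral_sub hf (integrable_const _)]
    simp [hε]
  filter_upwards [ae_birkhoffSum_bddAbove hT (hfm.sub_const _) h1 h2] with x ⟨c, hc⟩
  refine ⟨c, fun m => ?_⟩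
  have h3 := hc m
  simp only [birkhoffSum, sum_sub_distrib, sum_const, card_range, nsmul_eq_mul] at h3 ⊢
  linarith

lemma tendsto_birkhoff_of_measurable [IsProbabilityMeasure μ] (hT : Ergodic T μ)
    (hfm : Measurable f)
    (hf : Integrable f μ) : ∀ᵐ x ∂μ,
      Tendsto (fun m : ℕ => (m : ℝ)⁻¹ * birkhoffSum T f m x) atTop (𝓝 (∫ x, f x ∂μ)) := by
  have hup : ∀ᵐ x ∂μ, ∀ j : ℕ, ∃ c : ℝ, ∀ m,
      birkhoffSum T f m x ≤ m * (∫ x, f x ∂μ + 1 / ((j : ℝ) + 1)) + c :=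
    ae_all_iff.2 fun j => ae_birkhoffSum_le hT hfm hf (by positivity)
  have hlo : ∀ᵐ x ∂μ, ∀ j : ℕ, ∃ c : ℝ, ∀ m,
      birkhoffSum T (fun x => -f x) m x ≤ m * (∫ x, -f x ∂μ + 1 / ((j : ℝ) + 1)) + c :=
    ae_all_iff.2 fun j => ae_birkhoffSum_le hT hfm.neg hf.neg (by positivity)
  filter_upwards [hup, hlo] with x hu hl
  rw [Metric.tendsto_atTop]
  intro ε hε
  obtain ⟨j, hj⟩ := exists_nat_one_div_lt (half_pos hε)
  obtain ⟨c, hc⟩ := hu j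
  obtain ⟨d, hd⟩ := hl j
  -- Beyond `M` both additive constants are below `m * ε / 2`; the other half of `ε` covers `1 / (j
  -- + 1)`.
  obtain ⟨M, hM⟩ := exists_nat_gt (2 * max c d / ε)
  refine ⟨M + 1, fun m hm => ?_⟩
  have hm' : (M : ℝ) + 1 ≤ m := by exact_mod_cast hm
  have hmpos : (0 : ℝ) < m := by
    have : (0 : ℝ) ≤ M := by positivity
    linarith
  rw [div_lt_iff₀ hε] at hM
  have hmε : 2 * max c d < m * ε := hM.trans_le (by nlinarith)
  have h1 := hc m
  have h2 := hd m
  simp only [birkhoffSum, sum_neg_distrib, integral_neg] at h1 h2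
  have hjm : (m : ℝ) * (1 / ((j : ℝ) + 1)) < m * (ε / 2) := mul_lt_mul_of_pos_left hj hmpos
  have e : (m : ℝ)⁻¹ * birkhoffSum T f m x - ∫ x, f x ∂μ =
      (m : ℝ)⁻¹ * (birkhoffSum T f m x - m * ∫ x, f x ∂μ) := by
    field_simp
  rw [Real.dist_eq, e, abs_mul, abs_of_pos (inv_pos.2 hmpos), inv_mul_lt_iff₀ hmpos, abs_lt]
  simp only [birkhoffSum]
  constructor <;> nlinarith [le_max_left c d, le_max_right c d]

/-- **Birkhoff's pointwise ergodic theorem** for ergodic maps. -/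
theorem tendsto_birkhoff [IsProbabilityMeasure μ] (hT : Ergodic T μ) (hf : Integrable f μ) :
    ∀ᵐ x ∂μ, Tendsto (fun m : ℕ => (m : ℝ)⁻¹ * birkhoffSum T f m x) atTop (𝓝 (∫ x, f x ∂μ)) := by
  obtain ⟨g, hgm, hfg⟩ := hf.1.aemeasurable
  have hg : Integrable g μ := hf.congr hfg
  have hs : ∀ᵐ x ∂μ, ∀ m, birkhoffSum T f m x = birkhoffSum T g m x :=
    ae_all_iff.2 fun m =>
      hT.toMeasurePreserving.quasiMeasurePreserving.birkhoffSum_ae_eq_of_ae_eq hfg m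
  filter_upwards [tendsto_birkhoff_of_measurable hT hgm hg, hs] with x hx hsx
  simp_rw [hsx, integral_congr_ae hfg]
  exact hx

end Birkhoff

/-! ### Ergodicity of the shift of an independent sequence. -/

section Shift

variable {E : Type*} [MeasurableSpace E] {μ : Measure (ℕ → E)}

/-- The shift by `K` of a sequence. -/
def shift (E : Type*) (K : ℕ) (y : ℕ → E) (i : ℕ) : E := y (i + K)

omit [MeasurableSpace E] in
lemma shift_iterate_apply (K m : ℕ) (y : ℕ → E) (i : ℕ) :
    (shift E K)^[m] y i = y (i + m * K) := by
  induction m generalizing y with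
  | zero => simp
  | succ m ih => rw [Function.iterate_succ_apply, ih, shift]; congr 1; ring

lemma measurable_shift (K : ℕ) : Measurable (shift E K) :=
  measurable_pi_lambda _ fun i => measurable_pi_apply (i + K)

/-- An invariant set is its own preimage under the `j`-th iterate, which sees only coordinates from
`j * K ≥ j` on. It is thus a tail event, and Kolmogorov's zero-one law applies. -/
lemma ergodic_shift {K : ℕ} (hK : 0 < K)
    (hind : iIndepFun (fun (i : ℕ) (y : ℕ → E) => y i) μ)
    (hpres : MeasurePreserving (shift E K) μ μ) : Ergodic (shift E K) μ := by
  have := hind.isProbabilityMeasure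
  refine ⟨hpres, ⟨fun A hA hinv => ?_⟩⟩
  let s : ℕ → MeasurableSpace (ℕ → E) := fun i => MeasurableSpace.comap (fun y => y i) inferInstance
  have htail : MeasurableSet[limsup s atTop] A := by
    rw [limsup_eq_iInf_iSup_of_nat, MeasurableSpace.measurableSet_iInf]
    intro j
    have hj : A = (shift E K)^[j] ⁻¹' A := by
      have : (shift E K)^[j] ⁻¹' A = A := by
        clear hA
        induction j with
        | zero => rfl
        | succ j ih => rw [Function.iterate_succ, Set.preimage_comp, ih, hinv]
      exact this.symm
    rw [hj]
    have hmeas : @Measurable _ _ (⨆ i ≥ j, s i) _ ((shift E K)^[j]) := by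
      refine @measurable_pi_lambda _ _ _ (_) _ _ fun i => ?_
      have hle : s (i + j * K) ≤ ⨆ i ≥ j, s i :=
        le_iSup₂_of_le (i + j * K) (by nlinarith) le_rfl
      have h1 : (fun y : ℕ → E => (shift E K)^[j] y i) = fun y => y (i + j * K) := by
        funext y; exact shift_iterate_apply K j y i
      rw [h1]
      exact Measurable.of_comap_le hle
    exact hmeas hA
  have h01 := measure_zero_or_one_of_measurableSet_limsup_atTop (s := s) (μ := μ)
    (fun i => (measurable_pi_apply i).comap_le) ((iIndepFun_iff_iIndep _ _ _).1 hind) htail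
  rw [eventuallyConst_set']
  rcases h01 with h | h
  · exact Or.inl (ae_eq_empty.2 h)
  · exact Or.inr (ae_eq_univ.2 ((prob_compl_eq_zero_iff hA).2 h))

end Shift

end

end CyclicAoI

namespace CyclicAoI

noncomputable section

/-! ### The age along a path -/

section AgePath

variable {N K : ℕ} [NeZero K] {P : Fin K → Fin N} {n : Fin N} {Ω : Type*}
  {X : ℕ → Ω → ℝ} {B : ℕ → Ω → Bool} {ω : Ω} {a₀ : ℝ}

/-- The first slot from `i` on with a successful transmission of source `n`. -/
def nextSuccess (P : Fin K → Fin N) (B : ℕ → Ω → Bool) (n : Fin N) (i : ℕ) (ω : Ω) : ℕ :=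
  sInf {l | i ≤ l ∧ Success P B n ω l}

/-- The time at which the first successful transmission of source `n` from slot `i` on ends. -/
def nextReception (P : Fin K → Fin N) (X : ℕ → Ω → ℝ) (B : ℕ → Ω → Bool) (n : Fin N) (i : ℕ)
    (ω : Ω) : ℝ := startTime X (nextSuccess P B n i ω + 1) ω

/-- The time from the reception of the packet of slot `i` to the next one, and `0` when slot `i` is
not a success. -/
def receptionGap (P : Fin K → Fin N) (X : ℕ → Ω → ℝ) (B : ℕ → Ω → Bool) (n : Fin N) (i : ℕ)
    (ω : Ω) : ℝ := nextReception P X B n (i + 1) ω - nextReception P X B n i ω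

/-- The area below the age between the reception of the packet of slot `i` and the next one. -/
def gapArea (P : Fin K → Fin N) (X : ℕ → Ω → ℝ) (B : ℕ → Ω → Bool) (n : Fin N) (i : ℕ)
    (ω : Ω) : ℝ := X i ω * receptionGap P X B n i ω + receptionGap P X B n i ω ^ 2 / 2

/-- The generation time of the freshest update received by time `t`. -/
def freshest (P : Fin K → Fin N) (X : ℕ → Ω → ℝ) (B : ℕ → Ω → Bool) (n : Fin N) (a₀ t : ℝ)
    (ω : Ω) : ℝ :=
  sSup (insert (-a₀) {g | ∃ i, Success P B n ω i ∧ startTime X (i + 1) ω ≤ t ∧ g = startTime X i ω})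

lemma nextReception_of_not_success {i : ℕ} (hi : ¬ Success P B n ω i) :
    nextReception P X B n (i + 1) ω = nextReception P X B n i ω := by
  have : {l | i + 1 ≤ l ∧ Success P B n ω l} = {l | i ≤ l ∧ Success P B n ω l} := by
    ext l
    simp only [Set.mem_ofPred_eq]
    constructor
    · rintro ⟨h1, h2⟩; exact ⟨by omega, h2⟩
    · rintro ⟨h1, h2⟩
      refine ⟨Nat.lt_of_le_of_ne h1 ?_, h2⟩
      rintro rfl
      exact hi h2
  rw [nextReception, nextReception, nextSuccess, nextSuccess, this]

lemma receptionGap_of_not_success {i : ℕ} (hi : ¬ Success P B n ω i) :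
    receptionGap P X B n i ω = 0 := by
  rw [receptionGap, nextReception_of_not_success hi, sub_self]

lemma gapArea_of_not_success {i : ℕ} (hi : ¬ Success P B n ω i) : gapArea P X B n i ω = 0 := by
  rw [gapArea, receptionGap_of_not_success hi]; ring

lemma nextSuccess_of_success {i : ℕ} (hi : Success P B n ω i) : nextSuccess P B n i ω = i :=
  IsLeast.csInf_eq ⟨⟨le_rfl, hi⟩, fun _ hl => hl.1⟩

lemma isLeast_nextSuccess (hinf : ∀ i, ∃ l, i ≤ l ∧ Success P B n ω l) (i : ℕ) :
    IsLeast {l | i ≤ l ∧ Success P B n ω l} (nextSuccess P B n i ω) :=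
  ⟨Nat.sInf_mem (hinf i), fun _ hl => Nat.sInf_le hl⟩

lemma startTime_mono (hX : ∀ i, 0 ≤ X i ω) : Monotone fun i => startTime X i ω :=
  monotone_nat_of_le_succ fun i => by
    simp only [startTime, sum_range_succ]
    linarith [hX i]

lemma startTime_nonneg (hX : ∀ i, 0 ≤ X i ω) (i : ℕ) : 0 ≤ startTime X i ω :=
  sum_nonneg fun j _ => hX j

lemma nextReception_mono (hX : ∀ i, 0 ≤ X i ω) (hinf : ∀ i, ∃ l, i ≤ l ∧ Success P B n ω l) :
    Monotone fun i => nextReception P X B n i ω := by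
  intro i j hij
  refine startTime_mono hX (Nat.add_le_add_right ?_ 1)
  have h := (isLeast_nextSuccess hinf j).1
  exact (isLeast_nextSuccess hinf i).2 ⟨hij.trans h.1, h.2⟩

lemma bddAbove_freshest (hX : ∀ i, 0 ≤ X i ω) (t : ℝ) : BddAbove (insert (-a₀)
    {g | ∃ i, Success P B n ω i ∧ startTime X (i + 1) ω ≤ t ∧ g = startTime X i ω}) := by
  refine BddAbove.insert _ ⟨t, ?_⟩
  rintro g ⟨i, _, h, rfl⟩
  exact (startTime_mono hX (Nat.le_succ i)).trans h

lemma freshest_mono (hX : ∀ i, 0 ≤ X i ω) : Monotone fun t => freshest P X B n a₀ t ω := by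
  intro t t' htt
  refine csSup_le_csSup (bddAbove_freshest hX t') (Set.insert_nonempty _ _) ?_
  refine Set.insert_subset_insert ?_
  rintro g ⟨i, h1, h2, rfl⟩
  exact ⟨i, h1, h2.trans htt, rfl⟩

lemma age_eq (t : ℝ) : age P X B n a₀ t ω = t - freshest P X B n a₀ t ω := rfl

lemma age_nonneg (hX : ∀ i, 0 ≤ X i ω) (ha₀ : 0 ≤ a₀) {t : ℝ} (ht : 0 ≤ t) :
    0 ≤ age P X B n a₀ t ω := by
  rw [age_eq, sub_nonneg]
  refine csSup_le (Set.insert_nonempty _ _) ?_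
  rintro g (rfl | ⟨i, _, h, rfl⟩)
  · linarith
  · exact (startTime_mono hX (Nat.le_succ i)).trans h

lemma intervalIntegrable_age (hX : ∀ i, 0 ≤ X i ω) (a b : ℝ) :
    IntervalIntegrable (fun t => age P X B n a₀ t ω) volume a b := by
  simp_rw [age_eq]
  exact (continuous_id.intervalIntegrable a b).sub (freshest_mono hX).intervalIntegrable

/-- Earlier successes were generated no later than slot `i`, later ones have not yet been received,
and the initial update has generation time `-a₀ ≤ 0`. -/
lemma age_of_mem_Ico (hX : ∀ i, 0 ≤ X i ω) (ha₀ : 0 ≤ a₀)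
    (hinf : ∀ i, ∃ l, i ≤ l ∧ Success P B n ω l) {i : ℕ} (hi : Success P B n ω i) {t : ℝ}
    (ht : t ∈ Set.Ico (nextReception P X B n i ω) (nextReception P X B n (i + 1) ω)) :
    age P X B n a₀ t ω = t - startTime X i ω := by
  have h1 := ht.1
  rw [nextReception, nextSuccess_of_success hi] at h1
  rw [age_eq]
  congr 1
  refine IsGreatest.csSup_eq ⟨Set.mem_insert_of_mem _ ⟨i, hi, h1, rfl⟩, ?_⟩
  rintro g (rfl | ⟨l, hl, hlt, rfl⟩)
  · linarith [startTime_nonneg hX i]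
  · refine startTime_mono hX ?_
    by_contra! hil
    have h2 := (isLeast_nextSuccess hinf (i + 1)).2 ⟨hil, hl⟩
    have h3 : nextReception P X B n (i + 1) ω ≤ startTime X (l + 1) ω :=
      startTime_mono hX (Nat.add_le_add_right h2 1)
    linarith [ht.2]

lemma integral_age_gap (hX : ∀ i, 0 ≤ X i ω) (ha₀ : 0 ≤ a₀)
    (hinf : ∀ i, ∃ l, i ≤ l ∧ Success P B n ω l) (i : ℕ) :
    ∫ t in (nextReception P X B n i ω)..(nextReception P X B n (i + 1) ω), age P X B n a₀ t ω =
      gapArea P X B n i ω := by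
  by_cases hi : Success P B n ω i
  · have hle : nextReception P X B n i ω ≤ nextReception P X B n (i + 1) ω :=
      nextReception_mono hX hinf (Nat.le_succ i)
    have h1 : ∫ t in (nextReception P X B n i ω)..(nextReception P X B n (i + 1) ω),
        age P X B n a₀ t ω = ∫ t in (nextReception P X B n i ω)..(nextReception P X B n (i + 1) ω),
          (t - startTime X i ω) := by
      -- The formula for the age can fail at the right endpoint, where the next packet arrives, so
      -- the half-open interval is turned round.
      rw [intervalIntegral.integral_of_le hle, intervalIntegral.integral_of_le hle,
        ← integral_Ico_eq_integral_Ioc, ← integral_Ico_eq_integral_Ioc]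
      exact setIntegral_congr_fun measurableSet_Ico fun t ht => age_of_mem_Ico hX ha₀ hinf hi ht
    rw [h1, intervalIntegral.integral_sub (by simp) (by simp), integral_id,
      intervalIntegral.integral_const, smul_eq_mul]
    have h2 : nextReception P X B n i ω = startTime X i ω + X i ω := by
      rw [nextReception, nextSuccess_of_success hi, startTime, startTime, sum_range_succ]
    rw [gapArea, receptionGap, h2]
    ring
  · rw [nextReception_of_not_success hi, intervalIntegral.integral_same, gapArea_of_not_success hi]

lemma integral_age_nextReception (hX : ∀ i, 0 ≤ X i ω) (ha₀ : 0 ≤ a₀)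
    (hinf : ∀ i, ∃ l, i ≤ l ∧ Success P B n ω l) (m : ℕ) :
    ∫ t in (0 : ℝ)..(nextReception P X B n m ω), age P X B n a₀ t ω =
      (∫ t in (0 : ℝ)..(nextReception P X B n 0 ω), age P X B n a₀ t ω) +
        ∑ i ∈ range m, gapArea P X B n i ω := by
  induction m with
  | zero => simp
  | succ m ih =>
    rw [sum_range_succ, ← add_assoc, ← ih, ← integral_age_gap hX ha₀ hinf m,
      intervalIntegral.integral_add_adjacent_intervals (intervalIntegrable_age hX _ _)
        (intervalIntegrable_age hX _ _)]

lemma nextReception_eq_add (m : ℕ) : nextReception P X B n m ω =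
    nextReception P X B n 0 ω + ∑ i ∈ range m, receptionGap P X B n i ω := by
  simp only [receptionGap]
  rw [sum_range_sub (fun i => nextReception P X B n i ω)]
  ring

lemma tendsto_inv_mul_succ {c : ℕ → ℝ} {L : ℝ}
    (h : Tendsto (fun m : ℕ => (m : ℝ)⁻¹ * c m) atTop (𝓝 L)) :
    Tendsto (fun m : ℕ => (m : ℝ)⁻¹ * c (m + 1)) atTop (𝓝 L) := by
  have h1 := (tendsto_add_atTop_iff_nat 1).2 h
  have h2 : Tendsto (fun m : ℕ => 1 + (m : ℝ)⁻¹) atTop (𝓝 1) := by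
    simpa using (tendsto_inv_atTop_nhds_zero_nat (𝕜 := ℝ)).const_add 1
  have h3 := h2.mul h1
  rw [one_mul] at h3
  refine h3.congr' ?_
  filter_upwards [eventually_gt_atTop 0] with m hm
  have : (m : ℝ) ≠ 0 := by positivity
  push_cast
  field_simp

lemma tendsto_div_of_inv_mul {x y : ℕ → ℝ} {f d : ℝ} (hd : d ≠ 0)
    (hx : Tendsto (fun m : ℕ => (m : ℝ)⁻¹ * x m) atTop (𝓝 f))
    (hy : Tendsto (fun m : ℕ => (m : ℝ)⁻¹ * y m) atTop (𝓝 d)) :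
    Tendsto (fun m => x m / y m) atTop (𝓝 (f / d)) := by
  refine (hx.div hy hd).congr' ?_
  filter_upwards [eventually_gt_atTop 0] with m hm
  have : (m : ℝ)⁻¹ ≠ 0 := by positivity
  rw [Pi.div_apply, mul_div_mul_left _ _ this]

/-- If a nondecreasing nonnegative function grows linearly along a nondecreasing sequence of times
which grows linearly, then it grows linearly. -/
lemma tendsto_inv_mul_of_subsequence {I : ℝ → ℝ} {r : ℕ → ℝ} {f d : ℝ} (hd : 0 < d)
    (hI0 : ∀ t, 0 ≤ t → 0 ≤ I t) (hI : MonotoneOn I (Set.Ici 0)) (hr : Monotone r)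
    (hrd : Tendsto (fun m : ℕ => (m : ℝ)⁻¹ * r m) atTop (𝓝 d))
    (hIf : Tendsto (fun m : ℕ => (m : ℝ)⁻¹ * I (r m)) atTop (𝓝 f)) :
    Tendsto (fun t => t⁻¹ * I t) atTop (𝓝 (f / d)) := by
  have hr_top : Tendsto r atTop atTop := by
    have h1 := hrd.pos_mul_atTop hd tendsto_natCast_atTop_atTop
    refine h1.congr' ?_
    filter_upwards [eventually_gt_atTop 0] with m hm
    have : (m : ℝ) ≠ 0 := by positivity
    field_simp
  have hex : ∀ t, ∃ m, t < r m := fun t => (hr_top.eventually_gt_atTop t).exists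
  classical
  -- This is the last index with `r m ≤ t` as soon as `r 0 ≤ t`; the truncated subtraction only
  -- matters for smaller `t`.
  let M : ℝ → ℕ := fun t => Nat.find (hex t) - 1
  have hM_top : Tendsto M atTop atTop := by
    rw [tendsto_atTop]
    intro b
    filter_upwards [eventually_ge_atTop (r b)] with t ht
    have : b < Nat.find (hex t) := by
      by_contra! hle
      exact absurd ((Nat.find_spec (hex t)).trans_le (hr hle)) (not_lt.2 ht)
    change b ≤ Nat.find (hex t) - 1
    omega
  have hM : ∀ᶠ t in atTop, r (M t) ≤ t ∧ t < r (M t + 1) := by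
    filter_upwards [eventually_ge_atTop (r 0)] with t ht
    have hpos : 0 < Nat.find (hex t) := by
      rw [Nat.find_pos]; exact not_lt.2 ht
    have e : M t + 1 = Nat.find (hex t) := Nat.sub_add_cancel hpos
    refine ⟨?_, by rw [e]; exact Nat.find_spec (hex t)⟩
    exact not_lt.1 (Nat.find_min (hex t) (Nat.sub_lt hpos one_pos))
  have hlow := (tendsto_div_of_inv_mul hd.ne' hIf (tendsto_inv_mul_succ hrd)).comp hM_top
  have hupp := (tendsto_div_of_inv_mul hd.ne' (tendsto_inv_mul_succ (c := fun m => I (r m)) hIf)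
    hrd).comp hM_top
  have hpos : ∀ᶠ t in atTop, 0 < r (M t) :=
    hM_top.eventually (hr_top.eventually_gt_atTop 0)
  refine tendsto_of_tendsto_of_tendsto_of_le_of_le' hlow hupp ?_ ?_
  · filter_upwards [hM, hpos] with t ht hp
    have ht0 : 0 < t := hp.trans_le ht.1
    have h1 : I (r (M t)) ≤ I t := hI hp.le ht0.le ht.1
    change I (r (M t)) / r (M t + 1) ≤ t⁻¹ * I t
    rw [inv_mul_eq_div]
    exact div_le_div₀ (hI0 t ht0.le) h1 ht0 ht.2.le
  · filter_upwards [hM, hpos] with t ht hp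
    have ht0 : 0 < t := hp.trans_le ht.1
    have h1 : I t ≤ I (r (M t + 1)) := hI ht0.le (ht0.le.trans ht.2.le) ht.2.le
    change t⁻¹ * I t ≤ I (r (M t + 1)) / r (M t)
    rw [inv_mul_eq_div]
    exact div_le_div₀ ((hI0 t ht0.le).trans h1) h1 hp ht.1

lemma tendsto_inv_mul_const_add {c : ℕ → ℝ} {L : ℝ} (a : ℝ)
    (h : Tendsto (fun m : ℕ => (m : ℝ)⁻¹ * c m) atTop (𝓝 L)) :
    Tendsto (fun m : ℕ => (m : ℝ)⁻¹ * (a + c m)) atTop (𝓝 L) := by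
  have h1 := ((tendsto_inv_atTop_nhds_zero_nat (𝕜 := ℝ)).mul_const a).add h
  rw [zero_mul, zero_add] at h1
  exact h1.congr fun m => by ring

lemma tendsto_average_age (hX : ∀ i, 0 ≤ X i ω) (ha₀ : 0 ≤ a₀)
    (hinf : ∀ i, ∃ l, i ≤ l ∧ Success P B n ω l) {f d : ℝ} (hd : 0 < d)
    (hgap : Tendsto (fun m : ℕ => (m : ℝ)⁻¹ * ∑ i ∈ range (m * K), receptionGap P X B n i ω) atTop
      (𝓝 d))
    (harea : Tendsto (fun m : ℕ => (m : ℝ)⁻¹ * ∑ i ∈ range (m * K), gapArea P X B n i ω) atTop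
      (𝓝 f)) :
    Tendsto (fun T : ℝ => T⁻¹ * ∫ t in (0 : ℝ)..T, age P X B n a₀ t ω) atTop (𝓝 (f / d)) := by
  refine tendsto_inv_mul_of_subsequence (I := fun T => ∫ t in (0 : ℝ)..T, age P X B n a₀ t ω)
    (r := fun m => nextReception P X B n (m * K) ω) hd (fun t ht => ?_) ?_ ?_ ?_ ?_
  · exact intervalIntegral.integral_nonneg ht fun x hx => age_nonneg hX ha₀ hx.1
  · intro x hx y hy hxy
    have h1 := intervalIntegral.integral_add_adjacent_intervals
      (intervalIntegrable_age (P := P) (B := B) (n := n) (a₀ := a₀) hX 0 x)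
      (intervalIntegrable_age (P := P) (B := B) (n := n) (a₀ := a₀) hX x y)
    have h2 : 0 ≤ ∫ t in x..y, age P X B n a₀ t ω :=
      intervalIntegral.integral_nonneg hxy fun t ht => age_nonneg hX ha₀ (le_trans hx ht.1)
    change ∫ t in (0 : ℝ)..x, age P X B n a₀ t ω ≤ ∫ t in (0 : ℝ)..y, age P X B n a₀ t ω
    linarith
  · intro a b hab
    exact nextReception_mono hX hinf (Nat.mul_le_mul_right K hab)
  · refine (tendsto_inv_mul_const_add (nextReception P X B n 0 ω) hgap).congr fun m => ?_
    rw [← nextReception_eq_add]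
  · refine (tendsto_inv_mul_const_add
      (∫ t in (0 : ℝ)..(nextReception P X B n 0 ω), age P X B n a₀ t ω) harea).congr fun m => ?_
    rw [← integral_age_nextReception hX ha₀ hinf]

end AgePath

end

end CyclicAoI

namespace CyclicAoI

noncomputable section

/-! ### Mean length and mean area of the gaps between receptions -/

section GapMoments

variable {N K : ℕ} [NeZero K] {P : Fin K → Fin N} {n : Fin N} {Ω : Type*} [MeasurableSpace Ω]
  {μ : Measure Ω} [IsProbabilityMeasure μ] {p : Fin N → ℝ} {ν : Fin N → Measure ℝ}
  {X : ℕ → Ω → ℝ} {B : ℕ → Ω → Bool}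

omit [IsProbabilityMeasure μ] in
lemma IsModel.ae_service_nonneg (h : IsModel μ P p ν X B)
    (hν0 : ∀ m, ∀ᵐ x ∂(ν m), 0 ≤ x) : ∀ᵐ ω ∂μ, ∀ i, 0 ≤ X i ω := by
  rw [ae_all_iff]
  intro i
  have h1 := hν0 (sched P i)
  rw [← h.map_service i] at h1
  exact ae_of_ae_map (h.measurable_service i).aemeasurable h1

/-- The time from the end of the `k`-th to the end of the `(k+1+m)`-th appearance of source `n`. -/
def spanTime (P : Fin K → Fin N) (X : ℕ → Ω → ℝ) (n : Fin N) (k m : ℕ) (ω : Ω) : ℝ :=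
  gapTime P X n k m ω + X (pos P n (k + 1 + m)) ω

omit [MeasurableSpace Ω] in
lemma receptionGap_of_mem_successGapEvent (hn : ∃ k, P k = n) {k m : ℕ} {ω : Ω}
    (hω : ω ∈ successGapEvent P B n k m) :
    receptionGap P X B n (pos P n k) ω = spanTime P X n k m ω := by
  have h1 : nextSuccess P B n (pos P n k + 1) ω = pos P n (k + 1 + m) :=
    (isLeast_of_mem_gapEvent hn hω.2).csInf_eq
  rw [receptionGap, nextReception, nextReception, h1,
    nextSuccess_of_success ((success_pos_iff hn).2 hω.1), spanTime,
    ← startTime_sub_eq_gapTime hn, startTime, sum_range_succ, startTime, startTime]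
  ring

omit [MeasurableSpace Ω] in
lemma measurable_spanTime_slotAlg (hn : ∃ k, P k = n) (k m : ℕ) :
    Measurable[slotAlg X B (servicePart (Set.Ioi (pos P n k)))] (spanTime P X n k m) := by
  refine Measurable.add (measurable_sum_service fun i hi => (mem_Ioo.1 hi).1) ?_
  exact measurable_service_slotAlg (mem_servicePart (pos_strictMono hn (by omega)))

lemma servicePart_mono {S T : Set ℕ} (h : S ⊆ T) : servicePart S ⊆ servicePart T :=
  fun _ hx => ⟨h hx.1, hx.2⟩

omit [MeasurableSpace Ω] in
lemma measurable_spanTime_slotAlg_univ (hn : ∃ k, P k = n) (k m : ℕ) :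
    Measurable[slotAlg X B (servicePart Set.univ)] (spanTime P X n k m) :=
  (measurable_spanTime_slotAlg hn k m).mono
    (slotAlg_mono X B (servicePart_mono (Set.subset_univ _))) le_rfl

omit [IsProbabilityMeasure μ] in
lemma IsModel.memLp_spanTime (h : IsModel μ P p ν X B)
    (hν : ∀ m, MemLp (fun x : ℝ => x) 2 (ν m)) (k m : ℕ) : MemLp (spanTime P X n k m) 2 μ :=
  (h.memLp_gapTime hν k m).add (h.memLp_service hν _)

lemma IsModel.integral_spanTime (h : IsModel μ P p ν X B)
    (hν : ∀ m, MemLp (fun x : ℝ => x) 2 (ν m)) (hn : ∃ k, P k = n) (k m : ℕ) :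
    ∫ ω, spanTime P X n k m ω ∂μ = ∫ ω, gapTime P X n k m ω ∂μ + mean (ν n) := by
  simp only [spanTime]
  rw [integral_add ((h.memLp_gapTime hν k m).integrable one_le_two)
    ((h.memLp_service hν _).integrable one_le_two), h.integral_service, sched_pos hn]

lemma IsModel.integral_spanTime_sq (h : IsModel μ P p ν X B)
    (hν : ∀ m, MemLp (fun x : ℝ => x) 2 (ν m)) (hn : ∃ k, P k = n) (k m : ℕ) :
    ∫ ω, spanTime P X n k m ω ^ 2 ∂μ = ∫ ω, gapTime P X n k m ω ^ 2 ∂μ +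
      2 * (∫ ω, gapTime P X n k m ω ∂μ) * mean (ν n) + secondMoment (ν n) := by
  have hind : IndepFun (gapTime P X n k m) (X (pos P n (k + 1 + m))) μ :=
    h.indepFun_service (S := Set.Iio (pos P n (k + 1 + m))) (T := {pos P n (k + 1 + m)}) (by simp)
      (measurable_sum_service fun i hi => (mem_Ioo.1 hi).2)
      (measurable_service_slotAlg (mem_servicePart (Set.mem_singleton _)))
  simp only [spanTime]
  rw [integral_add_sq_of_indepFun (h.memLp_gapTime hν k m) (h.memLp_service hν _) hind,
    h.integral_service, h.integral_service_sq, sched_pos hn]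

lemma IsModel.integral_service_mul_spanTime (h : IsModel μ P p ν X B)
    (hν : ∀ m, MemLp (fun x : ℝ => x) 2 (ν m)) (hn : ∃ k, P k = n) (k m : ℕ) :
    ∫ ω, X (pos P n k) ω * spanTime P X n k m ω ∂μ =
      mean (ν n) * (∫ ω, gapTime P X n k m ω ∂μ + mean (ν n)) := by
  have hind : IndepFun (X (pos P n k)) (spanTime P X n k m) μ :=
    h.indepFun_service (S := {pos P n k}) (T := Set.Ioi (pos P n k)) (by simp)
      (measurable_service_slotAlg (mem_servicePart (Set.mem_singleton _)))
      (measurable_spanTime_slotAlg hn k m)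
  rw [hind.integral_fun_mul_eq_mul_integral (h.memLp_service hν _).1 (h.memLp_spanTime hν k m).1,
    h.integral_service, sched_pos hn, h.integral_spanTime hν hn]

/-- The factor `1 - p n` is the probability of success at appearance `k`, and `c` is the mean given
that success. Nonnegativity of the `Z m` makes convergence of the series of means enough for
integrability. -/
lemma IsModel.integral_of_eq_on_successGapEvent (h : IsModel μ P p ν X B)
    (hp : ∀ m, 0 ≤ p m ∧ p m ≤ 1) (hn : ∃ k, P k = n) (hpn : p n < 1) (k : ℕ)
    {Y : Ω → ℝ} {Z : ℕ → Ω → ℝ} {c : ℝ}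
    (hZ : ∀ m, Measurable[slotAlg X B (servicePart Set.univ)] (Z m))
    (hY : ∀ m, ∀ ω ∈ successGapEvent P B n k m, Y ω = Z m ω)
    (hY0 : ∀ ω, B (pos P n k) ω ≠ true → Y ω = 0)
    (hZi : ∀ m, Integrable (Z m) μ) (hZ0 : ∀ m, 0 ≤ᵐ[μ] Z m)
    (hc : HasSum (fun m => (1 - p n) * p n ^ m * ∫ ω, Z m ω ∂μ) c) :
    Integrable Y μ ∧ ∫ ω, Y ω ∂μ = (1 - p n) * c := by
  have hu : 0 < 1 - p n := by linarith
  have hZm : ∀ m, Measurable (Z m) := fun m => (hZ m).mono (h.slotAlg_le _) le_rfl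
  have hYm := h.aemeasurable_restrict_received hp hn hpn k hZm hY
  have hlaw := h.map_restrict_received hp hn hpn k hZ hY
  have hw : ∀ m, 0 ≤ (1 - p n) * ((1 - p n) * p n ^ m) := fun m =>
    mul_nonneg hu.le (mul_nonneg hu.le (pow_nonneg (hp n).1 _))
  have hmap : ∀ m, ∫ x, x ∂(μ.map (Z m)) = ∫ ω, Z m ω ∂μ := fun m =>
    integral_map (hZm m).aemeasurable (f := fun x => x) (by fun_prop)
  have habs : ∀ m, ∫ x, |x| ∂(μ.map (Z m)) = ∫ ω, Z m ω ∂μ := fun m => by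
    rw [integral_map (hZm m).aemeasurable (f := fun x => |x|) (by fun_prop)]
    exact integral_congr_ae ((hZ0 m).mono fun ω hω => abs_of_nonneg hω)
  have hsum := (hc.mul_left (1 - p n))
  have hint : Integrable (fun x : ℝ => x) ((μ.restrict {ω | B (pos P n k) ω = true}).map Y) := by
    rw [hlaw]
    refine integrable_mixture hw (fun m => ?_) ?_
    · exact (integrable_map_measure (by fun_prop) (hZm m).aemeasurable).2 (hZi m)
    · simp_rw [habs]
      exact hsum.summable.congr fun m => by ring
  have hval : ∫ x, x ∂((μ.restrict {ω | B (pos P n k) ω = true}).map Y) = (1 - p n) * c := by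
    rw [hlaw] at hint ⊢
    have h1 := hasSum_integral_mixture hw hint
    simp_rw [hmap] at h1
    exact h1.unique (hasSum_of_eq hsum fun m => by ring)
  constructor
  · rw [← integrableOn_iff_integrable_of_support_subset (s := {ω | B (pos P n k) ω = true})]
    · exact (integrable_map_measure (by fun_prop) hYm).1 hint
    · intro ω hω
      by_contra hb
      exact hω (hY0 ω hb)
  · rw [← setIntegral_eq_integral_of_forall_compl_eq_zero
      (s := {ω | B (pos P n k) ω = true}) hY0, ← hval]
    exact (integral_map hYm (f := fun x => x) (by fun_prop)).symm

omit [IsProbabilityMeasure μ] in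
lemma IsModel.ae_spanTime_nonneg (h : IsModel μ P p ν X B)
    (hν0 : ∀ m, ∀ᵐ x ∂(ν m), 0 ≤ x) (k m : ℕ) : 0 ≤ᵐ[μ] spanTime P X n k m := by
  filter_upwards [h.ae_service_nonneg hν0] with ω hω
  exact add_nonneg (sum_nonneg fun i _ => hω i) (hω _)

lemma IsModel.hasSum_mean_gapLaw (h : IsModel μ P p ν X B)
    (hp : ∀ m, 0 ≤ p m ∧ p m ≤ 1) (hn : ∃ k, P k = n) (hpn : p n < 1)
    (hν : ∀ m, MemLp (fun x : ℝ => x) 2 (ν m)) (k : ℕ) :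
    HasSum (fun m => (1 - p n) * p n ^ m * ∫ ω, gapTime P X n k m ω ∂μ)
      (mean (gapLaw μ P X B n k)) :=
  h.hasSum_integral_gapLaw hp hn hpn k (f := fun x => x) measurable_id
    (integrable_id_gapLaw h hp hn hpn hν k)

lemma IsModel.hasSum_secondMoment_gapLaw (h : IsModel μ P p ν X B)
    (hp : ∀ m, 0 ≤ p m ∧ p m ≤ 1) (hn : ∃ k, P k = n) (hpn : p n < 1)
    (hν : ∀ m, MemLp (fun x : ℝ => x) 2 (ν m)) (k : ℕ) :
    HasSum (fun m => (1 - p n) * p n ^ m * ∫ ω, gapTime P X n k m ω ^ 2 ∂μ)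
      (secondMoment (gapLaw μ P X B n k)) :=
  h.hasSum_integral_gapLaw hp hn hpn k (f := fun x => x ^ 2) (by fun_prop)
    (integrable_sq_gapLaw h hp hn hpn hν k)

lemma IsModel.mean_gapLaw_nonneg (h : IsModel μ P p ν X B)
    (hp : ∀ m, 0 ≤ p m ∧ p m ≤ 1) (hn : ∃ k, P k = n) (hpn : p n < 1)
    (hν : ∀ m, MemLp (fun x : ℝ => x) 2 (ν m)) (hν0 : ∀ m, ∀ᵐ x ∂(ν m), 0 ≤ x) (k : ℕ) :
    0 ≤ mean (gapLaw μ P X B n k) := by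
  refine (h.hasSum_mean_gapLaw hp hn hpn hν k).nonneg fun m => ?_
  refine mul_nonneg (mul_nonneg (by linarith) (pow_nonneg (hp n).1 _)) (integral_nonneg_of_ae ?_)
  filter_upwards [h.ae_service_nonneg hν0] with ω hω
  exact sum_nonneg fun i _ => hω i

omit [MeasurableSpace Ω] in
lemma receptionGap_pos_of_ne (k : ℕ) {ω : Ω} (hω : B (pos P n k) ω ≠ true) :
    receptionGap P X B n (pos P n k) ω = 0 := receptionGap_of_not_success fun h => hω h.2

lemma IsModel.integral_receptionGap (h : IsModel μ P p ν X B)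
    (hp : ∀ m, 0 ≤ p m ∧ p m ≤ 1) (hn : ∃ k, P k = n) (hpn : p n < 1)
    (hν : ∀ m, MemLp (fun x : ℝ => x) 2 (ν m)) (hν0 : ∀ m, ∀ᵐ x ∂(ν m), 0 ≤ x) (k : ℕ) :
    Integrable (receptionGap P X B n (pos P n k)) μ ∧
      ∫ ω, receptionGap P X B n (pos P n k) ω ∂μ =
        (1 - p n) * (mean (gapLaw μ P X B n k) + mean (ν n)) := by
  refine h.integral_of_eq_on_successGapEvent hp hn hpn k (measurable_spanTime_slotAlg_univ hn k)
    (fun m ω hω => receptionGap_of_mem_successGapEvent hn hω)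
    (fun ω hω => receptionGap_pos_of_ne k hω)
    (fun m => (h.memLp_spanTime hν k m).integrable one_le_two) (h.ae_spanTime_nonneg hν0 k) ?_
  have h1 := (h.hasSum_mean_gapLaw hp hn hpn hν k).add
    ((hasSum_geometric_weights (hp n).1 hpn).mul_left (mean (ν n)))
  rw [mul_one] at h1
  refine hasSum_of_eq h1 fun m => ?_
  rw [h.integral_spanTime hν hn]; ring

/-- The opening service time is independent of the span that follows, and the span is the gap plus
an independent service time; both the product and the square therefore factor into the moments of
the gap and of the service time. -/
lemma IsModel.integral_gapArea (h : IsModel μ P p ν X B)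
    (hp : ∀ m, 0 ≤ p m ∧ p m ≤ 1) (hn : ∃ k, P k = n) (hpn : p n < 1)
    (hν : ∀ m, MemLp (fun x : ℝ => x) 2 (ν m)) (hν0 : ∀ m, ∀ᵐ x ∂(ν m), 0 ≤ x) (k : ℕ) :
    Integrable (gapArea P X B n (pos P n k)) μ ∧
      ∫ ω, gapArea P X B n (pos P n k) ω ∂μ =
        (1 - p n) * (mean (ν n) * (mean (gapLaw μ P X B n k) + mean (ν n)) +
          (secondMoment (gapLaw μ P X B n k) + 2 * mean (gapLaw μ P X B n k) * mean (ν n)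
            + secondMoment (ν n)) / 2) := by
  have hprod : ∀ m, Integrable (fun ω => X (pos P n k) ω * spanTime P X n k m ω) μ := fun m =>
    (h.memLp_service hν _).integrable_mul (h.memLp_spanTime hν k m)
  have hsq : ∀ m, Integrable (fun ω => spanTime P X n k m ω ^ 2 / 2) μ := fun m =>
    (h.memLp_spanTime hν k m).integrable_sq.div_const 2
  refine h.integral_of_eq_on_successGapEvent hp hn hpn k
    (Z := fun m ω => X (pos P n k) ω * spanTime P X n k m ω + spanTime P X n k m ω ^ 2 / 2)
    (fun m => ?_) (fun m ω hω => ?_) (fun ω hω => ?_) (fun m => (hprod m).add (hsq m))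
    (fun m => ?_) ?_
  · have h1 := measurable_spanTime_slotAlg_univ (X := X) (B := B) hn k m
    have h2 := measurable_service_slotAlg (X := X) (B := B)
      (mem_servicePart (Set.mem_univ (pos P n k)))
    exact (h2.mul h1).add ((h1.pow_const 2).div_const 2)
  · rw [gapArea, receptionGap_of_mem_successGapEvent hn hω]
  · rw [gapArea, receptionGap_pos_of_ne k hω]; ring
  · filter_upwards [h.ae_service_nonneg hν0, h.ae_spanTime_nonneg hν0 k m] with ω h1 h2
    exact add_nonneg (mul_nonneg (h1 _) h2) (div_nonneg (sq_nonneg _) zero_le_two)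
  · have h1 := ((h.hasSum_mean_gapLaw hp hn hpn hν k).mul_left (2 * mean (ν n))).add
      ((h.hasSum_secondMoment_gapLaw hp hn hpn hν k).mul_left (1 / 2))
    have h2 := h1.add ((hasSum_geometric_weights (hp n).1 hpn).mul_left
      (mean (ν n) ^ 2 + secondMoment (ν n) / 2))
    have h3 := hasSum_of_eq h2 (g := fun m => (1 - p n) * p n ^ m *
        ∫ ω, (X (pos P n k) ω * spanTime P X n k m ω + spanTime P X n k m ω ^ 2 / 2) ∂μ)
      fun m => by
        rw [integral_add (hprod m) (hsq m), h.integral_service_mul_spanTime hν hn,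
          integral_div, h.integral_spanTime_sq hν hn]
        ring
    convert h3 using 1
    ring

end GapMoments

/-! ### The model on the space of paths -/

section Canonical

variable {N K : ℕ} [NeZero K] {P : Fin K → Fin N} {n : Fin N} {Ω : Type*} [MeasurableSpace Ω]
  {μ : Measure Ω} [IsProbabilityMeasure μ] {p : Fin N → ℝ} {ν : Fin N → Measure ℝ}
  {X : ℕ → Ω → ℝ} {B : ℕ → Ω → Bool}

/-- The service time of slot `i` as a function of the path. -/
def pathService (i : ℕ) (y : ℕ → ℝ × Bool) : ℝ := (y i).1

/-- The reception indicator of slot `i` as a function of the path. -/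
def pathReceived (i : ℕ) (y : ℕ → ℝ × Bool) : Bool := (y i).2

lemma measurable_pathService (i : ℕ) : Measurable (pathService i) :=
  measurable_fst.comp (measurable_pi_apply i)

lemma measurable_pathReceived (i : ℕ) : Measurable (pathReceived i) :=
  measurable_snd.comp (measurable_pi_apply i)

lemma IsModel.iIndepFun_path (h : IsModel μ P p ν X B) :
    iIndepFun (fun (i : ℕ) (y : ℕ → ℝ × Bool) => y i) (μ.map (path X B)) := by
  have := Measure.isProbabilityMeasure_map h.measurable_path.aemeasurable (μ := μ)
  rw [iIndepFun_iff_map_fun_eq_infinitePi_map fun i => measurable_pi_apply i]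
  have h1 : ∀ i, (μ.map (path X B)).map (fun y : ℕ → ℝ × Bool => y i) =
      μ.map fun ω => (X i ω, B i ω) := fun i =>
    Measure.map_map (measurable_pi_apply i) h.measurable_path
  simp_rw [h1, ← h.map_path]
  exact Measure.map_id

/-- The given space need not carry a shift map, so the ergodic theorem is applied on path space;
this transfers the moment computations there. -/
lemma IsModel.map_path_isModel (h : IsModel μ P p ν X B) :
    IsModel (μ.map (path X B)) P p ν pathService pathReceived where
  measurable_service := measurable_pathService
  measurable_received := measurable_pathReceived
  map_service i := by
    rw [Measure.map_map (measurable_pathService i) h.measurable_path, ← h.map_service i]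
    rfl
  prob_received i := by
    rw [← h.prob_received i]
    exact Measure.map_apply h.measurable_path
      (measurable_pathReceived i (measurableSet_singleton true))
  indep_slot i := by
    have := Measure.isProbabilityMeasure_map h.measurable_path.aemeasurable (μ := μ)
    rw [indepFun_iff_map_prod_eq_prod_map_map (measurable_pathService i).aemeasurable
      (measurable_pathReceived i).aemeasurable,
      Measure.map_map ((measurable_pathService i).prodMk (measurable_pathReceived i))
        h.measurable_path,
      Measure.map_map (measurable_pathService i) h.measurable_path,
      Measure.map_map (measurable_pathReceived i) h.measurable_path]
    exact (indepFun_iff_map_prod_eq_prod_map_map (h.measurable_service i).aemeasurable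
      (h.measurable_received i).aemeasurable).1 (h.indep_slot i)
  indep := h.iIndepFun_path

lemma IsModel.gapLaw_map_path (h : IsModel μ P p ν X B)
    (hp : ∀ m, 0 ≤ p m ∧ p m ≤ 1) (hn : ∃ k, P k = n) (hpn : p n < 1) (k : ℕ) :
    gapLaw (μ.map (path X B)) P pathService pathReceived n k = gapLaw μ P X B n k := by
  have := Measure.isProbabilityMeasure_map h.measurable_path.aemeasurable (μ := μ)
  have h1 : ∀ m, (μ.map (path X B)).map (gapTime P pathService n k m) =
      μ.map (gapTime P X n k m) := fun m =>
    Measure.map_map (h.map_path_isModel.measurable_gapTime k m) h.measurable_path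
  rw [h.gapLaw_eq hp hn hpn, h.map_path_isModel.gapLaw_eq hp hn hpn]
  simp_rw [h1]

lemma IsModel.ergodic_shift_map_path (h : IsModel μ P p ν X B) :
    Ergodic (shift (ℝ × Bool) K) (μ.map (path X B)) := by
  refine ergodic_shift (NeZero.pos K) h.iIndepFun_path ⟨measurable_shift K, ?_⟩
  rw [Measure.map_map (measurable_shift K) h.measurable_path]
  exact h.map_path_shift

/-! ### Equivariance under the shift by one period -/

lemma success_shift {y : ℕ → ℝ × Bool} {i : ℕ} :
    Success P pathReceived n (shift (ℝ × Bool) K y) i ↔ Success P pathReceived n y (i + K) := by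
  rw [Success, Success, sched_add_period]
  rfl

lemma exists_success_shift {y : ℕ → ℝ × Bool}
    (hinf : ∀ i, ∃ l, i ≤ l ∧ Success P pathReceived n y l) (i : ℕ) :
    ∃ l, i ≤ l ∧ Success P pathReceived n (shift (ℝ × Bool) K y) l := by
  obtain ⟨l, hl, hs⟩ := hinf (i + K)
  refine ⟨l - K, by omega, success_shift.2 ?_⟩
  rwa [Nat.sub_add_cancel (by omega)]

/-- Infinitely many successes are essential: the infimum of an empty set is `0`, which is not
translated by `K`. -/
lemma nextSuccess_add_period {y : ℕ → ℝ × Bool}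
    (hinf : ∀ i, ∃ l, i ≤ l ∧ Success P pathReceived n y l) (i : ℕ) :
    nextSuccess P pathReceived n (i + K) y =
      nextSuccess P pathReceived n i (shift (ℝ × Bool) K y) + K := by
  obtain ⟨⟨h1, h2⟩, h3⟩ := isLeast_nextSuccess (exists_success_shift hinf) i
  refine (isLeast_nextSuccess hinf (i + K)).unique ⟨⟨by omega, success_shift.1 h2⟩, ?_⟩
  rintro l ⟨hl, hs⟩
  have : nextSuccess P pathReceived n i (shift (ℝ × Bool) K y) ≤ l - K :=
    h3 ⟨by omega, success_shift.2 (by rwa [Nat.sub_add_cancel (by omega)])⟩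
  omega

/-- Reception times are equivariant only up to the duration of the first pattern, a term that
cancels in `receptionGap`. -/
lemma nextReception_add_period {y : ℕ → ℝ × Bool}
    (hinf : ∀ i, ∃ l, i ≤ l ∧ Success P pathReceived n y l) (i : ℕ) :
    nextReception P pathService pathReceived n (i + K) y = startTime pathService K y +
      nextReception P pathService pathReceived n i (shift (ℝ × Bool) K y) := by
  rw [nextReception, nextSuccess_add_period hinf, nextReception]
  set l := nextSuccess P pathReceived n i (shift (ℝ × Bool) K y)
  rw [show l + K + 1 = K + (l + 1) by ring, startTime, sum_range_add, startTime, startTime]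
  congr 1
  exact sum_congr rfl fun i _ => by rw [add_comm K i]; rfl

lemma receptionGap_add_period {y : ℕ → ℝ × Bool}
    (hinf : ∀ i, ∃ l, i ≤ l ∧ Success P pathReceived n y l) (i : ℕ) :
    receptionGap P pathService pathReceived n (i + K) y =
      receptionGap P pathService pathReceived n i (shift (ℝ × Bool) K y) := by
  rw [receptionGap, receptionGap, show i + K + 1 = i + 1 + K by ring,
    nextReception_add_period hinf, nextReception_add_period hinf]
  ring

lemma gapArea_add_period {y : ℕ → ℝ × Bool}
    (hinf : ∀ i, ∃ l, i ≤ l ∧ Success P pathReceived n y l) (i : ℕ) :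
    gapArea P pathService pathReceived n (i + K) y =
      gapArea P pathService pathReceived n i (shift (ℝ × Bool) K y) := by
  rw [gapArea, gapArea, receptionGap_add_period hinf]
  rfl

lemma sum_range_mul_eq_birkhoffSum {F : ℕ → (ℕ → ℝ × Bool) → ℝ}
    (hF : ∀ y, (∀ i, ∃ l, i ≤ l ∧ Success P pathReceived n y l) →
      ∀ i, F (i + K) y = F i (shift (ℝ × Bool) K y)) {y : ℕ → ℝ × Bool}
    (hinf : ∀ i, ∃ l, i ≤ l ∧ Success P pathReceived n y l) (m : ℕ) :
    ∑ i ∈ range (m * K), F i y =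
      birkhoffSum (shift (ℝ × Bool) K) (fun y => ∑ i ∈ range K, F i y) m y := by
  induction m generalizing y with
  | zero => simp
  | succ m ih =>
    rw [birkhoffSum_succ', ← ih (exists_success_shift hinf), add_mul, one_mul, add_comm,
      sum_range_add]
    congr 1
    exact sum_congr rfl fun i _ => by rw [add_comm, hF y hinf]

omit [MeasurableSpace Ω] in
lemma exists_success_of_mem_gapEvent (hn : ∃ k, P k = n) {ω : Ω}
    (hω : ∀ k, ∃ m, ω ∈ gapEvent P B n k m) (i : ℕ) : ∃ l, i ≤ l ∧ Success P B n ω l := by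
  obtain ⟨m, hm⟩ := hω i
  have h1 := (isLeast_of_mem_gapEvent hn hm).1
  -- Since `pos P n i ≥ i`, the first success after the `i`-th appearance comes after slot `i`.
  exact ⟨_, ((pos_strictMono hn).le_apply.trans_lt h1.1).le, h1.2⟩

/-- The ergodic theorem is applied to the sum of `F` over one pattern, where only the slots serving
`n` contribute. -/
lemma IsModel.tendsto_average_of_add_period (h : IsModel μ P p ν X B)
    (hp : ∀ m, 0 ≤ p m ∧ p m ≤ 1) (hn : ∃ k, P k = n) (hpn : p n < 1)
    {F : ℕ → (ℕ → ℝ × Bool) → ℝ} {c : ℕ → ℝ}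
    (hF : ∀ y, (∀ i, ∃ l, i ≤ l ∧ Success P pathReceived n y l) →
      ∀ i, F (i + K) y = F i (shift (ℝ × Bool) K y))
    (hF0 : ∀ i, sched P i ≠ n → F i = 0)
    (hFc : ∀ k, Integrable (F (pos P n k)) (μ.map (path X B)) ∧
      ∫ y, F (pos P n k) y ∂(μ.map (path X B)) = c k) :
    ∀ᵐ y ∂(μ.map (path X B)), Tendsto (fun m : ℕ => (m : ℝ)⁻¹ * ∑ i ∈ range (m * K), F i y) atTop
      (𝓝 (∑ k ∈ range (alpha P n), c k)) := by
  have := Measure.isProbabilityMeasure_map h.measurable_path.aemeasurable (μ := μ)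
  have hint : ∀ i, Integrable (F i) (μ.map (path X B)) := fun i => by
    by_cases hi : sched P i = n
    · obtain ⟨k, rfl⟩ := exists_pos_eq hi
      exact (hFc k).1
    · rw [hF0 i hi]; exact integrable_zero _ _ _
  have hval : ∫ y, ∑ i ∈ range K, F i y ∂(μ.map (path X B)) = ∑ k ∈ range (alpha P n), c k := by
    rw [integral_finsetSum _ fun i _ => hint i,
      sum_range_period hn (fun i => ∫ y, F i y ∂(μ.map (path X B))) fun i hi => by simp [hF0 i hi]]
    exact sum_congr rfl fun k _ => (hFc k).2
  rw [← hval]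
  filter_upwards [tendsto_birkhoff h.ergodic_shift_map_path
    (integrable_finsetSum (range K) fun i _ => hint i),
    h.map_path_isModel.ae_forall_exists_gapEvent hp hn hpn] with y hy hinf
  simp_rw [sum_range_mul_eq_birkhoffSum hF (exists_success_of_mem_gapEvent hn hinf)]
  exact hy

theorem IsModel.isMeanAge (h : IsModel μ P p ν X B)
    (hp : ∀ m, 0 ≤ p m ∧ p m ≤ 1) (hn : ∃ k, P k = n) (hpn : p n < 1)
    (hν : ∀ m, MemLp (fun x : ℝ => x) 2 (ν m)) (hν0 : ∀ m, ∀ᵐ x ∂(ν m), 0 ≤ x)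
    (hs : 0 < mean (ν n)) {a₀ : ℝ} (ha₀ : 0 ≤ a₀) :
    IsMeanAge μ P X B n a₀
      ((2 * mean (ν n) ^ 2 + 4 * mean (ν n) * mean (steadyLaw μ P X B n) + secondMoment (ν n)
        + secondMoment (steadyLaw μ P X B n)) /
          (2 * (mean (ν n) + mean (steadyLaw μ P X B n)))) := by
  have := Measure.isProbabilityMeasure_map h.measurable_path.aemeasurable (μ := μ)
  have hc := h.map_path_isModel
  have hgap := h.tendsto_average_of_add_period hp hn hpn
    (F := receptionGap P pathService pathReceived n)
    (fun y hy i => receptionGap_add_period hy i)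
    (fun i hi => by funext y; exact receptionGap_of_not_success fun hs => hi hs.1)
    (fun k => hc.integral_receptionGap hp hn hpn hν hν0 k)
  have harea := h.tendsto_average_of_add_period hp hn hpn
    (F := gapArea P pathService pathReceived n)
    (fun y hy i => gapArea_add_period hy i)
    (fun i hi => by funext y; exact gapArea_of_not_success fun hs => hi hs.1)
    (fun k => hc.integral_gapArea hp hn hpn hν hν0 k)
  simp only [h.gapLaw_map_path hp hn hpn] at hgap harea
  have hα : (0 : ℝ) < alpha P n := by exact_mod_cast alpha_pos hn
  have hu : 0 < 1 - p n := by linarith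
  have h1 : mean (steadyLaw μ P X B n) =
      1 / (alpha P n : ℝ) * ∑ k ∈ range (alpha P n), mean (gapLaw μ P X B n k) :=
    integral_steadyLaw (integrable_id_gapLaw h hp hn hpn hν)
  have h2 : secondMoment (steadyLaw μ P X B n) =
      1 / (alpha P n : ℝ) * ∑ k ∈ range (alpha P n), secondMoment (gapLaw μ P X B n k) :=
    integral_steadyLaw (integrable_sq_gapLaw h hp hn hpn hν)
  have h0 : 0 ≤ mean (steadyLaw μ P X B n) := by
    rw [h1]
    exact mul_nonneg (by positivity)
      (sum_nonneg fun k _ => h.mean_gapLaw_nonneg hp hn hpn hν hν0 k)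
  have e1 : ∑ k ∈ range (alpha P n), mean (gapLaw μ P X B n k) =
      alpha P n * mean (steadyLaw μ P X B n) := by rw [h1]; field_simp
  have e2 : ∑ k ∈ range (alpha P n), secondMoment (gapLaw μ P X B n k) =
      alpha P n * secondMoment (steadyLaw μ P X B n) := by rw [h2]; field_simp
  simp only [← mul_sum, ← sum_div, ← sum_mul, sum_add_distrib, sum_const, card_range, nsmul_eq_mul,
    e1, e2] at hgap harea
  have hall := (hgap.and harea).and
    ((hc.ae_service_nonneg hν0).and (hc.ae_forall_exists_gapEvent hp hn hpn))
  filter_upwards [ae_of_ae_map h.measurable_path.aemeasurable hall] with ω ⟨⟨hg, ha⟩, hX, hinf⟩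
  -- The mean time per pattern is positive because source `n` has positive mean service time and the
  -- gaps have nonnegative mean.
  have hd : 0 < (1 - p n) * (alpha P n * mean (steadyLaw μ P X B n) + alpha P n * mean (ν n)) := by
    positivity
  have hne : mean (ν n) + mean (steadyLaw μ P X B n) ≠ 0 := by positivity
  have key := tendsto_average_age hX ha₀ (exists_success_of_mem_gapEvent hn hinf) hd hg ha
  refine (congrArg (fun c => Tendsto _ atTop (𝓝 c)) ?_).mp key
  rw [div_eq_div_iff hd.ne' (mul_ne_zero two_ne_zero hne)]
  ring

end Canonical

end

end CyclicAoI

/-! ### Assembly of the theorem. -/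

theorem mainTheorem4 {N K : ℕ} [NeZero K] {Ω : Type*} [MeasurableSpace Ω]
    (μ : Measure Ω) [IsProbabilityMeasure μ]
    (P : Fin K → Fin N) (p : Fin N → ℝ) (ν : Fin N → Measure ℝ)
    (X : ℕ → Ω → ℝ) (B : ℕ → Ω → Bool)
    (hmodel : CyclicAoI.IsModel μ P p ν X B)
    (hν : ∀ m, IsProbabilityMeasure (ν m))
    (hν_nonneg : ∀ m, ∀ᵐ x ∂(ν m), 0 ≤ x)
    (hν_moment : ∀ m, MemLp (fun x : ℝ => x) 2 (ν m))
    (hp : ∀ m, 0 ≤ p m ∧ p m ≤ 1)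
    (n : Fin N) (hn : ∃ k, P k = n) (hpn : p n < 1) (hsn : 0 < CyclicAoI.mean (ν n))
    (a₀ : ℝ) (ha₀ : 0 ≤ a₀)
    -- `α` appearances in the pattern, success probability `u`, moments `s`, `q` of the service time
    (α : ℕ) (hα : α = CyclicAoI.alpha P n) (u : ℝ) (hu : u = 1 - p n)
    (s q : ℝ) (hs : s = CyclicAoI.mean (ν n)) (hq : q = CyclicAoI.secondMoment (ν n))
    -- MGFs `G` of the service time and `GSub k`, with moments `sSub k`, `qSub k`, of sub-pattern `k`
    (G : ℝ → ℝ) (hG : ∀ z, G z = mgf id (ν n) z)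
    (GSub : ℕ → ℝ → ℝ) (hGSub : ∀ k z, GSub k z = mgf (CyclicAoI.subTime P X n k) μ z)
    (sSub qSub : ℕ → ℝ) (hsSub : ∀ k, sSub k = ∫ ω, CyclicAoI.subTime P X n k ω ∂μ)
    (hqSub : ∀ k, qSub k = ∫ ω, CyclicAoI.subTime P X n k ω ^ 2 ∂μ)
    -- expansion coefficients of numerators and denominator
    (a b c d : ℕ → ℝ)
    (ha : ∀ k, a k = (CyclicAoI.numerPoly (p n) s q sSub qSub α k).coeff 1)
    (hb : ∀ k, b k = (CyclicAoI.numerPoly (p n) s q sSub qSub α k).coeff 2)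
    (hc : ∀ k, c k = (CyclicAoI.denomPoly (p n) s q sSub qSub α).coeff 1)
    (hd : ∀ k, d k = (CyclicAoI.denomPoly (p n) s q sSub qSub α).coeff 2) :
    -- the MGFs of the sub-patterns
    (∀ k z, GSub k z =
      ∏ m ∈ Finset.univ.erase n, mgf id (ν m) z ^ CyclicAoI.alphaSub P n k m) ∧
    -- the MGF of the inter-success time given the appearance `k` of the first success: it is finite
    -- and equals the geometric-type series and its closed form wherever the series converges
    (∀ z, (∀ i, z ∈ integrableExpSet id (ν (CyclicAoI.sched P i))) →
      p n ^ α * G z ^ α * ∏ m ∈ Finset.Icc 1 α, GSub (m - 1) z < 1 →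
      ∀ k, z ∈ integrableExpSet id (CyclicAoI.gapLaw μ P X B n k) ∧
        HasSum (fun i : ℕ => u * (p n ^ i * G z ^ i * ∏ l ∈ Finset.range (i + 1), GSub (k + l) z))
          (mgf id (CyclicAoI.gapLaw μ P X B n k) z) ∧
        mgf id (CyclicAoI.gapLaw μ P X B n k) z =
          CyclicAoI.numer (p n) (G z) (fun i => GSub i z) α k /
            CyclicAoI.denom (p n) (G z) (fun i => GSub i z) α) ∧
    -- `1 - p ^ α`, `a`, `b`, `c`, `d` are the coefficients of the expansions up to `O(z³)`
    ((∀ i, 0 ∈ interior (integrableExpSet id (ν (CyclicAoI.sched P i)))) → ∀ k,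
      (fun z => CyclicAoI.numer (p n) (G z) (fun i => GSub i z) α k
        - ((1 - p n ^ α) + a k * z + b k * z ^ 2)) =O[𝓝 0] (fun z : ℝ => z ^ 3) ∧
      (fun z => CyclicAoI.denom (p n) (G z) (fun i => GSub i z) α
        - ((1 - p n ^ α) + c k * z + d k * z ^ 2)) =O[𝓝 0] (fun z : ℝ => z ^ 3)) ∧
    -- the steady-state law `τ` of the inter-success times
    ∃ τ : Measure ℝ, CyclicAoI.IsSteadyStateLaw μ (CyclicAoI.interSuccess P X B n) τ ∧
      (0 < p n → ∀ A : Set ℝ, MeasurableSet A →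
        Tendsto (fun j : ℕ => μ.real {ω | CyclicAoI.interSuccess P X B n j ω ∈ A}) atTop
          (𝓝 (τ.real A))) ∧
      -- its MGF is the average over the appearances
      (∀ z, (∀ i, z ∈ integrableExpSet id (ν (CyclicAoI.sched P i))) →
        p n ^ α * G z ^ α * ∏ m ∈ Finset.Icc 1 α, GSub (m - 1) z < 1 →
        z ∈ integrableExpSet id τ ∧
        mgf id τ z = 1 / (α : ℝ) * ∑ k ∈ Finset.Icc 1 α,
          mgf id (CyclicAoI.gapLaw μ P X B n (k - 1)) z) ∧
      -- its first two moments
      MemLp (fun x : ℝ => x) 2 τ ∧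
      CyclicAoI.mean τ =
        (1 / u) * (p n * s + 1 / (α : ℝ) * ∑ k ∈ Finset.Icc 1 α, sSub (k - 1)) ∧
      CyclicAoI.secondMoment τ =
        1 / (α : ℝ) * ∑ k ∈ Finset.Icc 1 α,
          (2 * c k * (c k - a k) / (1 - p n ^ α) ^ 2 + 2 * (b k - d k) / (1 - p n ^ α)) ∧
      -- the mean age
      CyclicAoI.IsMeanAge μ P X B n a₀
        ((2 * s ^ 2 + 4 * s * CyclicAoI.mean τ + q + CyclicAoI.secondMoment τ) /
          (2 * (s + CyclicAoI.mean τ))) := by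
  obtain rfl : G = fun z => mgf id (ν n) z := funext hG
  obtain rfl : GSub = fun k z => mgf (CyclicAoI.subTime P X n k) μ z :=
    funext fun k => funext (hGSub k)
  subst hα hu hs hq
  have hαpos := CyclicAoI.alpha_pos hn
  have : NeZero (CyclicAoI.alpha P n) := ⟨hαpos.ne'⟩
  have hconv : ∀ z, (∀ i, z ∈ integrableExpSet id (ν (CyclicAoI.sched P i))) →
      p n ^ CyclicAoI.alpha P n * mgf id (ν n) z ^ CyclicAoI.alpha P n *
        ∏ m ∈ Finset.Icc 1 (CyclicAoI.alpha P n), mgf (CyclicAoI.subTime P X n (m - 1)) μ z < 1 →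
      CyclicAoI.IsConvergent μ P p ν X n z := fun z h1 h2 => ⟨h1, h2⟩
  have hsα : ∀ k, sSub (k + CyclicAoI.alpha P n) = sSub k := fun k => by
    rw [hsSub, hsSub, hmodel.integral_subTime_add_alpha hn]
  have hqα : ∀ k, qSub (k + CyclicAoI.alpha P n) = qSub k := fun k => by
    rw [hqSub, hqSub, hmodel.integral_subTime_sq_add_alpha hn]
  have hw₁ := fun k => (hmodel.mean_gapLaw hp hn hpn hν_moment k).trans (by rw [← hsSub])
  have hw₂ := fun k => (hmodel.secondMoment_gapLaw hp hn hpn hν_moment k).trans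
    (by rw [← hsSub, ← hqSub])
  have hid := CyclicAoI.integrable_id_gapLaw hmodel hp hn hpn hν_moment
  have hsq := CyclicAoI.integrable_sq_gapLaw hmodel hp hn hpn hν_moment
  refine ⟨fun k z => hmodel.mgf_subTime hn k z, fun z h1 h2 k => ?_, fun h0 k => ?_,
    CyclicAoI.steadyLaw μ P X B n, ⟨hmodel.isProbabilityMeasure_steadyLaw hp hn hpn, fun A hA =>
      hmodel.tendsto_cesaro_real_interSuccess hp hn hpn hA⟩,
    fun hp0 A hA => hmodel.tendsto_real_interSuccess hp hn hpn hp0 hA, fun z h1 h2 => ?_, ?_, ?_,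
    ?_, hmodel.isMeanAge hp hn hpn hν_moment hν_nonneg hsn ha₀⟩
  · exact ⟨hmodel.integrable_exp_gapLaw hp hn hpn (hconv z h1 h2) k,
      hmodel.hasSum_mgf_gapLaw hp hn hpn (hconv z h1 h2) k,
      hmodel.mgf_gapLaw_eq_div hp hn hpn (hconv z h1 h2) k⟩
  · have hg := CyclicAoI.hasExpansion_mgf_id (ρ := ν n) (by
      -- Finiteness near `0` is known slot by slot, so source `n` is reached through its first
      -- appearance.
      have := h0 (CyclicAoI.pos P n 0)
      rwa [CyclicAoI.sched_pos hn] at this)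
    have hh : ∀ i, CyclicAoI.HasExpansion (mgf (CyclicAoI.subTime P X n i) μ)
        (CyclicAoI.truncMGF (sSub i) (qSub i)) := fun i => by
      rw [hsSub, hqSub]; exact hmodel.hasExpansion_mgf_subTime h0 i
    have e1 := (CyclicAoI.HasExpansion.numer (p n) hg hh (CyclicAoI.alpha P n) k).coeffs
    have e2 := (CyclicAoI.HasExpansion.denom (p n) hg hh (CyclicAoI.alpha P n)).coeffs
    rw [← CyclicAoI.numerPoly, CyclicAoI.coeff_zero_numerPoly, ← ha, ← hb] at e1
    rw [← CyclicAoI.denomPoly, CyclicAoI.coeff_zero_denomPoly, ← hc k, ← hd k] at e2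
    exact ⟨e1, e2⟩
  · have hint := hmodel.integrable_exp_gapLaw hp hn hpn (hconv z h1 h2)
    refine ⟨CyclicAoI.integrable_steadyLaw hint, ?_⟩
    rw [CyclicAoI.sum_Icc_sub_one fun k => mgf id (CyclicAoI.gapLaw μ P X B n k) z]
    exact CyclicAoI.integral_steadyLaw hint
  · exact (memLp_two_iff_integrable_sq (by fun_prop)).2 (CyclicAoI.integrable_steadyLaw hsq)
  · rw [CyclicAoI.sum_Icc_sub_one, CyclicAoI.mean, CyclicAoI.integral_steadyLaw hid]
    exact CyclicAoI.average_eq_of_recursion hαpos hpn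
      (fun k => by rw [hmodel.gapLaw_add_alpha hp hn hpn]) hw₁
  · have key := fun k => CyclicAoI.secondMoment_eq_of_recursion hαpos (hp n).1 hpn hsα hqα
      (fun k => by rw [hmodel.gapLaw_add_alpha hp hn hpn])
      (fun k => by rw [hmodel.gapLaw_add_alpha hp hn hpn]) hw₁ hw₂ k (ha k) (hb k) (hc k) (hd k)
    have hτ : CyclicAoI.secondMoment (CyclicAoI.steadyLaw μ P X B n) =
        1 / (CyclicAoI.alpha P n : ℝ) * ∑ k ∈ Finset.range (CyclicAoI.alpha P n),
          CyclicAoI.secondMoment (CyclicAoI.gapLaw μ P X B n k) := CyclicAoI.integral_steadyLaw hsq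
    -- The steady law averages over `k = 0, …, α - 1`, whereas the coefficients are summed over `k =
    -- 1, …, α`; periodicity of the gap laws reconciles the two.
    rw [hτ, ← CyclicAoI.sum_range_succ_of_periodic fun k => by
        rw [hmodel.gapLaw_add_alpha hp hn hpn],
      ← CyclicAoI.sum_Icc_sub_one fun k =>
        CyclicAoI.secondMoment (CyclicAoI.gapLaw μ P X B n (k + 1))]
    congr 1
    refine Finset.sum_congr rfl fun k hk => ?_
    rw [Nat.sub_add_cancel (Finset.mem_Icc.1 hk).1]
    exact key k
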